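/- **Setting.** Let $1\le N\le D$ and $I\ge 1$ be integers, $a_1,\dots,a_I>0$, $\tau_\Sigma:=\sum_{i=1}^I 1/a_i$, $\alpha\in(0,1)$ and $0<\underline\delta<\overline\delta$. Let $C:[0,1]\to\mathbb R^{D\times D}$ be $\alpha$-Hölder continuous with $\underline\delta|y|^2\le y^TC(t)C(t)^Ty\le\overline\delta|y|^2$ for all $t\in[0,1]$, $y\in\mathbb R^D$, and let $\bar C(t)\in\mathbb R^{D\times N}$ consist of the first $N$ columns of $C(t)$. Let $W$ be a $D$-dimensional Brownian motion on $[0,1]$ on a probability space and $Y_t=\int_0^tC(u)\,dW_u$. Let $g^{(1)},\dots,g^{(I)}\in C^{2+\alpha}(\mathbb R^D)$, i.e. $g^{(i)}$ is $C^2$, and $g^{(i)},\partial_yg^{(i)},\partial_{yy}g^{(i)}$ are bounded with $\partial_{yy}g^{(i)}$ $\alpha$-Hölder continuous. **The market price of risk $\lambda$** for the endowments $g^{(i)}$ and maturity $T$. It is $$\lambda(t,y)=\tfrac1{\tau_\Sigma}\bar C(t)^T\sum_{j=1}^I\partial_yu^{(j)}(t,y),$$ where $u=(u^{(i)})_{i\le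 I}\subset C^{2+\alpha}([0,T]\times\mathbb R^D)$ solves the equilibrium system on $[0,T]\times\mathbb R^D$ $$\partial_tu^{(i)}+\tfrac1{2a_i}|\lambda|^2-\lambda^T\bar C^T\partial_yu^{(i)}+\tfrac{a_i}2\big(|\bar C^T\partial_yu^{(i)}|^2-|C^T\partial_yu^{(i)}|^2\big)+\tfrac12\mathrm{tr}\big(\partial_{yy}u^{(i)}CC^T\big)=0,\qquad u^{(i)}(T,\cdot)=g^{(i)}.$$ Here $C^{2+\alpha}([0,T]\times\mathbb R^D)$ is the parabolic Hölder space of $C^{1,2}$ functions with $u,\partial_yu$ bounded and $\partial_tu,\partial_{yy}u$ bounded and $\alpha$-Hölder for the distance $\sqrt{|t-s|}+|x-y|$. **The market price of risk $\tilde\lambda$** for the second-order Taylor approximations $\tilde g^{(i)}(y)=g^{(i)}(0)+\partial_yg^{(i)}(0)^Ty+\frac12y^T\partial_{yy}g^{(i)}(0)y$ and maturity $T$. It is $$\tilde\lambda(t,y)=\tfrac1{\tau_\Sigma}\bar C(t)^T\sum_{i=1}^I\Big(\beta^{(i)}(T-t)+\big(\gamma^{(i)}(T-t)+\gamma^{(i)}(T-t)^T\big)y\Big),$$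 where $\beta^{(i)}:[0,T]\to\mathbb R^D$, $\gamma^{(i)}:[0,T]\to\mathbb R^{D\times D}$ solve the Riccati system of maturity $T$: with $G_i=\gamma^{(i)}+(\gamma^{(i)})^T$, $G=\sum_jG_j$, $\beta=\sum_j\beta^{(j)}$, all at time to maturity $s\in[0,T]$, and $Q=CC^T$, $R=\bar C\bar C^T$ at calendar time $T-s$, $$(\gamma^{(i)})'=\tfrac{a_i}2G_i(R-Q)G_i-\tfrac1{\tau_\Sigma}G_iRG+\tfrac1{2a_i\tau_\Sigma^2}GRG,\qquad\gamma^{(i)}(0)=\tfrac12\partial_{yy}g^{(i)}(0),$$ $$(\beta^{(i)})'=a_iG_i(R-Q)\beta^{(i)}+\tfrac1{a_i\tau_\Sigma^2}GR\beta-\tfrac1{\tau_\Sigma}GR\beta^{(i)}-\tfrac1{\tau_\Sigma}G_iR\beta,\qquad\beta^{(i)}(0)=\partial_yg^{(i)}(0).$$ Let $T_0^{\rm Riccati}\in[0,\infty]$ be the largest $S$ such that for every $T\in(0,1]$ with $T<S$ the Riccati system of maturity $T$ has a solution on $[0,T]$ (so $T_0^{\rm Riccati}=\infty$ if it is solvable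 for every $T\in(0,1]$). **Theorem 4.2.** There is $T_0\in(0,1]$ such that for every $T\in(0,T_0)$ the equilibrium system has exactly one solution in $C^{2+\alpha}([0,T]\times\mathbb R^D)$; moreover $T_0^{\rm Riccati}>0$; and for every $T_1<T_0^{\rm Riccati}$ there is a constant $K$ such that for all $T\in(0,T_0)$ with $T\le T_1$ and all $t\in[0,T]$ the variable $|\lambda(t,Y_t)-\tilde\lambda(t,Y_t)|$ is integrable and $$\mathbb E\big[|\lambda(t,Y_t)-\tilde\lambda(t,Y_t)|\big]\le K\,T^{\frac{1+\alpha}2}.$$ The constant $K$ depends neither on $t$ nor on $T$. -/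

import Mathlib

open MeasureTheory ProbabilityTheory Set Filter Topology
open scoped Matrix

noncomputable section

namespace RadnerTaylor

/-- Euclidean space `ℝⁿ` with the Euclidean norm. -/
abbrev Vec (n : ℕ) : Type := EuclideanSpace ℝ (Fin n)

/-! ### Partial derivatives -/

/-- The partial derivative `∂g/∂y_d` at `y`. -/
def partialDeriv {D : ℕ} (d : Fin D) (g : Vec D → ℝ) (y : Vec D) : ℝ :=
  fderiv ℝ g y (EuclideanSpace.single d 1)

/-- The vector `∂_y g` of first order partial derivatives. -/
def grad {D : ℕ} (g : Vec D → ℝ) (y : Vec D) : Fin D → ℝ :=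
  fun d => partialDeriv d g y

/-- The matrix `∂_{yy} g` of second order partial derivatives. -/
def hess {D : ℕ} (g : Vec D → ℝ) (y : Vec D) : Matrix (Fin D) (Fin D) ℝ :=
  Matrix.of fun d e => partialDeriv e (partialDeriv d g) y

/-- The time derivative `∂_t u` on `[0,T]`, one-sided at the two end points. -/
def timeDeriv {D : ℕ} (T : ℝ) (u : ℝ → Vec D → ℝ) (t : ℝ) (y : Vec D) : ℝ :=
  derivWithin (fun s => u s y) (Icc 0 T) t

/-! ### Hölder spaces of bounded functions -/

/-- `|h|_α < ∞` on `ℝᴰ`: `h` is bounded with finite Hölder seminorm `[h]_α`. -/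
def IsHolder {D : ℕ} (α : ℝ) (h : Vec D → ℝ) : Prop :=
  (∃ M : ℝ, ∀ y, |h y| ≤ M) ∧ ∃ K : ℝ, ∀ x y, |h x - h y| ≤ K * ‖x - y‖ ^ α

/-- The Hölder space `C^{2+α}(ℝᴰ)`: twice continuously differentiable functions with
`|g|₀ + |∂_y g|₀ + |∂_{yy} g|₀ + [∂_{yy} g]_α < ∞`. -/
structure MemHolderTwo {D : ℕ} (α : ℝ) (g : Vec D → ℝ) : Prop where
  contDiff : ContDiff ℝ 2 g
  bounded : ∃ M : ℝ, ∀ y, |g y| ≤ M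
  bounded_grad : ∃ M : ℝ, ∀ y d, |grad g y d| ≤ M
  hess : ∀ d e, IsHolder α (fun y => hess g y d e)

/-- `|h|_α < ∞` on `[0,T] × ℝᴰ` for the parabolic distance `√|t-s| + |x-y|`. -/
def IsParabolicHolder {D : ℕ} (α T : ℝ) (h : ℝ → Vec D → ℝ) : Prop :=
  (∃ M : ℝ, ∀ t ∈ Icc 0 T, ∀ y, |h t y| ≤ M) ∧
    ∃ K : ℝ, ∀ t ∈ Icc 0 T, ∀ s ∈ Icc 0 T, ∀ x y,
      |h t x - h s y| ≤ K * (√|t - s| + ‖x - y‖) ^ α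

/-- The parabolic Hölder space `C^{2+α}([0,T] × ℝᴰ)`: functions of class `C^{1,2}` with
`|∂_t u|₀ + [∂_t u]_α + |u|₀ + |∂_y u|₀ + |∂_{yy} u|₀ + [∂_{yy} u]_α < ∞`
(joint continuity of `∂_t u` and `∂_{yy} u` is part of their Hölder continuity). -/
structure MemParabolicHolderTwo {D : ℕ} (α T : ℝ) (u : ℝ → Vec D → ℝ) : Prop where
  differentiableOn_time : ∀ y, DifferentiableOn ℝ (fun t => u t y) (Icc 0 T)
  contDiff_space : ∀ t ∈ Icc 0 T, ContDiff ℝ 2 (u t)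
  continuousOn : ContinuousOn (fun p : ℝ × Vec D => u p.1 p.2) (Icc 0 T ×ˢ univ)
  continuousOn_grad : ∀ d,
    ContinuousOn (fun p : ℝ × Vec D => grad (u p.1) p.2 d) (Icc 0 T ×ˢ univ)
  bounded : ∃ M : ℝ, ∀ t ∈ Icc 0 T, ∀ y, |u t y| ≤ M
  bounded_grad : ∃ M : ℝ, ∀ t ∈ Icc 0 T, ∀ y d, |grad (u t) y d| ≤ M
  timeDeriv : IsParabolicHolder α T (timeDeriv T u)
  hess : ∀ d e, IsParabolicHolder α T (fun t y => hess (u t) y d e)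

/-! ### Brownian motion and the factor process -/

section Factor

variable {Ω : Type*} [MeasurableSpace Ω]

/-- `W` is a one-dimensional standard Brownian motion on the time interval `[0,1]`
(values of `W` at other times play no role). -/
structure IsBrownianOnUnit (W : ℝ → Ω → ℝ) (P : Measure Ω) : Prop where
  zero : ∀ᵐ ω ∂P, W 0 ω = 0
  indepIncrements : HasIndepIncrements (fun t : Icc (0 : ℝ) 1 => W t) P
  hasLaw : ∀ s t : ℝ, 0 ≤ s → s ≤ t → t ≤ 1 →
    HasLaw (fun ω => W t ω - W s ω) (gaussianReal 0 (t - s).toNNReal) P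
  continuousOn : ∀ᵐ ω ∂P, ContinuousOn (fun t => W t ω) (Icc 0 1)

/-- `W = (W⁽¹⁾, …, W⁽ᴰ⁾)` is a `D`-dimensional Brownian motion on `[0,1]`: the coordinates are
Brownian motions and are independent as processes. -/
structure IsBrownianVector {D : ℕ} (W : Fin D → ℝ → Ω → ℝ) (P : Measure Ω) : Prop where
  coord : ∀ d, IsBrownianOnUnit (W d) P
  indep : iIndepFun (fun (d : Fin D) (ω : Ω) (t : Icc (0 : ℝ) 1) => W d t ω) P

/-- The left-point Riemann sum `∑_{k<n} C(t_k) (W_{t_{k+1}} - W_{t_k})`, `t_k = k t / n`. -/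
def riemannSum {D : ℕ} (C : ℝ → Matrix (Fin D) (Fin D) ℝ) (W : Fin D → ℝ → Ω → ℝ)
    (n : ℕ) (t : ℝ) (ω : Ω) : Vec D :=
  ∑ k ∈ Finset.range n, WithLp.toLp 2
    (C (k * t / n) *ᵥ fun d => W d ((k + 1) * t / n) ω - W d (k * t / n) ω)

/-- `Y_t = ∫₀ᵗ C(u) dW_u` for `t ∈ [0,1]`. For a continuous deterministic integrand `C` the
stochastic integral is the `L²`-limit of the left-point Riemann sums; this determines `Y_t`
almost surely. -/
def IsWienerIntegral {D : ℕ} (C : ℝ → Matrix (Fin D) (Fin D) ℝ) (W : Fin D → ℝ → Ω → ℝ)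
    (Y : ℝ → Ω → Vec D) (P : Measure Ω) : Prop :=
  ∀ t ∈ Icc (0 : ℝ) 1, AEStronglyMeasurable (Y t) P ∧
    Tendsto (fun n : ℕ => eLpNorm (fun ω => riemannSum C W n t ω - Y t ω) 2 P) atTop (𝓝 0)

end Factor

/-! ### The market price of risk for Hölder endowments -/

/-- `τ_Σ = ∑_i 1/a_i`, the aggregate risk tolerance. -/
def riskTolerance {I : ℕ} (a : Fin I → ℝ) : ℝ := ∑ i, (a i)⁻¹

/-- The `D × N` matrix `C̄` consisting of the first `N` columns of `C`. -/
def firstCols {D N : ℕ} (hND : N ≤ D) (C : Matrix (Fin D) (Fin D) ℝ) :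
    Matrix (Fin D) (Fin N) ℝ :=
  C.submatrix id (Fin.castLE hND)

/-- `λ(t,y) = τ_Σ⁻¹ C̄(t)ᵀ ∑_j ∂_y u⁽ʲ⁾(t,y)`. -/
def marketPrice {D N I : ℕ} (hND : N ≤ D) (a : Fin I → ℝ) (C : ℝ → Matrix (Fin D) (Fin D) ℝ)
    (u : Fin I → ℝ → Vec D → ℝ) (t : ℝ) (y : Vec D) : Vec N :=
  WithLp.toLp 2 ((riskTolerance a)⁻¹ • ((firstCols hND (C t))ᵀ *ᵥ ∑ j, grad (u j t) y))

/-- `u = (u⁽¹⁾, …, u⁽ᴵ⁾)` in `C^{2+α}([0,T] × ℝᴰ)` solves the coupled system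
`∂_t u⁽ⁱ⁾ + |λ|²/(2aᵢ) - λᵀC̄ᵀ∂_y u⁽ⁱ⁾ + (aᵢ/2)(|C̄ᵀ∂_y u⁽ⁱ⁾|² - |Cᵀ∂_y u⁽ⁱ⁾|²)
  + (1/2) tr(∂_{yy}u⁽ⁱ⁾ C Cᵀ) = 0`, `u⁽ⁱ⁾(T,·) = g⁽ⁱ⁾`,
where `λ` is the market price of risk formed from `u`. -/
structure IsEquilibriumSystem {D N I : ℕ} (hND : N ≤ D) (a : Fin I → ℝ)
    (C : ℝ → Matrix (Fin D) (Fin D) ℝ) (g : Fin I → Vec D → ℝ) (α T : ℝ)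
    (u : Fin I → ℝ → Vec D → ℝ) : Prop where
  regular : ∀ i, MemParabolicHolderTwo α T (u i)
  pde : ∀ i, ∀ t ∈ Icc 0 T, ∀ y,
    timeDeriv T (u i) t y
      + 1 / (2 * a i) * ‖marketPrice hND a C u t y‖ ^ 2
      - (marketPrice hND a C u t y).ofLp ⬝ᵥ ((firstCols hND (C t))ᵀ *ᵥ grad (u i t) y)
      + a i / 2 *
        (‖WithLp.toLp 2 ((firstCols hND (C t))ᵀ *ᵥ grad (u i t) y)‖ ^ 2
          - ‖WithLp.toLp 2 ((C t)ᵀ *ᵥ grad (u i t) y)‖ ^ 2)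
      + 1 / 2 * (hess (u i t) y * (C t * (C t)ᵀ)).trace = 0
  terminal : ∀ i y, u i T y = g i y

/-! ### The market price of risk for quadratic endowments -/

/-- Right-hand side of the matrix equation for `γ⁽ⁱ⁾`, for a given value `C` of the volatility
matrix. -/
def riccatiGamma {D N I : ℕ} (hND : N ≤ D) (a : Fin I → ℝ) (C : Matrix (Fin D) (Fin D) ℝ)
    (γ : Fin I → Matrix (Fin D) (Fin D) ℝ) (i : Fin I) : Matrix (Fin D) (Fin D) ℝ :=
  let Q := C * Cᵀ
  let R := firstCols hND C * (firstCols hND C)ᵀ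
  let G : Fin I → Matrix (Fin D) (Fin D) ℝ := fun j => γ j + (γ j)ᵀ
  let τ := riskTolerance a
  (a i / 2) • (G i * (R - Q) * G i)
    - τ⁻¹ • (G i * R * ∑ j, G j)
    + (1 / (2 * a i * τ ^ 2)) • ((∑ j, G j) * R * ∑ j, G j)

/-- Right-hand side of the vector equation for `β⁽ⁱ⁾`, for a given value `C` of the volatility
matrix. -/
def riccatiBeta {D N I : ℕ} (hND : N ≤ D) (a : Fin I → ℝ) (C : Matrix (Fin D) (Fin D) ℝ)
    (β : Fin I → Fin D → ℝ) (γ : Fin I → Matrix (Fin D) (Fin D) ℝ) (i : Fin I) : Fin D → ℝ :=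
  let Q := C * Cᵀ
  let R := firstCols hND C * (firstCols hND C)ᵀ
  let G : Fin I → Matrix (Fin D) (Fin D) ℝ := fun j => γ j + (γ j)ᵀ
  let τ := riskTolerance a
  a i • ((G i * (R - Q)) *ᵥ β i)
    + (1 / (a i * τ ^ 2)) • (((∑ j, G j) * R) *ᵥ ∑ j, β j)
    - τ⁻¹ • (((∑ j, G j) * R) *ᵥ β i)
    - τ⁻¹ • ((G i * R) *ᵥ ∑ j, β j)

/-- `(β, γ)`, as functions of the time to maturity `s ∈ [0,T]`, solve the coupled Riccati system
of maturity `T` for the quadratic endowments `f⁽ⁱ⁾ + h⁽ⁱ⁾ᵀ y + (1/2) yᵀ j⁽ⁱ⁾ y`. The system is the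
one making `α⁽ⁱ⁾(T-t) + β⁽ⁱ⁾(T-t)ᵀ y + yᵀ γ⁽ⁱ⁾(T-t) y` a solution of the equilibrium system, so the
volatility is evaluated at calendar time `T - s`; `α⁽ⁱ⁾` is obtained from `β, γ` by an integration
and does not enter the market price of risk. -/
structure IsRiccatiSolution {D N I : ℕ} (hND : N ≤ D) (a : Fin I → ℝ)
    (C : ℝ → Matrix (Fin D) (Fin D) ℝ) (h : Fin I → Fin D → ℝ)
    (j : Fin I → Matrix (Fin D) (Fin D) ℝ) (T : ℝ)
    (β : Fin I → ℝ → Fin D → ℝ) (γ : Fin I → ℝ → Matrix (Fin D) (Fin D) ℝ) : Prop where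
  gamma_deriv : ∀ i, ∀ s ∈ Icc 0 T, ∀ d e,
    HasDerivWithinAt (fun r => γ i r d e)
      (riccatiGamma hND a (C (T - s)) (fun k => γ k s) i d e) (Icc 0 T) s
  beta_deriv : ∀ i, ∀ s ∈ Icc 0 T, ∀ d,
    HasDerivWithinAt (fun r => β i r d)
      (riccatiBeta hND a (C (T - s)) (fun k => β k s) (fun k => γ k s) i d) (Icc 0 T) s
  gamma_zero : ∀ i, γ i 0 = (1 / 2 : ℝ) • j i
  beta_zero : ∀ i, β i 0 = h i

/-- The maturity `T₀^Riccati ∈ [0,∞]` up to which the Riccati systems are solvable: the largest `S`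
such that the system of maturity `T` has a solution on all of `[0,T]` for every `T ∈ (0,1]` with
`T < S`. It is `∞` if there is no explosion for maturities in `(0,1]`. -/
def riccatiMaturity {D N I : ℕ} (hND : N ≤ D) (a : Fin I → ℝ)
    (C : ℝ → Matrix (Fin D) (Fin D) ℝ) (h : Fin I → Fin D → ℝ)
    (j : Fin I → Matrix (Fin D) (Fin D) ℝ) : EReal :=
  sSup {S : EReal | ∀ T ∈ Ioc (0 : ℝ) 1, (T : EReal) < S →
    ∃ β γ, IsRiccatiSolution hND a C h j T β γ}

/-- `λ̃(t,y) = τ_Σ⁻¹ C̄(t)ᵀ ∑_i (β⁽ⁱ⁾(T-t) + (γ⁽ⁱ⁾(T-t) + γ⁽ⁱ⁾(T-t)ᵀ) y)`. -/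
def quadraticMarketPrice {D N I : ℕ} (hND : N ≤ D) (a : Fin I → ℝ)
    (C : ℝ → Matrix (Fin D) (Fin D) ℝ) (T : ℝ)
    (β : Fin I → ℝ → Fin D → ℝ) (γ : Fin I → ℝ → Matrix (Fin D) (Fin D) ℝ)
    (t : ℝ) (y : Vec D) : Vec N :=
  WithLp.toLp 2 ((riskTolerance a)⁻¹ • ((firstCols hND (C t))ᵀ *ᵥ
    ∑ i, (β i (T - t) + (γ i (T - t) + (γ i (T - t))ᵀ) *ᵥ y.ofLp)))

end RadnerTaylor

end

open RadnerTaylor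

noncomputable section

namespace RadnerTaylor

/-! ### Calculus with partial derivatives -/

section Calculus

variable {D : ℕ}

/-! Both prices of risk are the same linear image of a sum of gradients, so it is enough to compare
`∂_y u⁽ⁱ⁾(t,y)` with the affine map `β⁽ⁱ⁾ + (γ⁽ⁱ⁾ + γ⁽ⁱ⁾ᵀ) y` at time to maturity `T - t`. Between
them stand two intermediate quantities: `P_{t,T} ∂_y g⁽ⁱ⁾(y)`, where `P_{t,s} f(y) = 𝔼 f(y + X)`
with `X` Gaussian of covariance `∫_t^s C Cᵀ`, and the first order Taylor polynomial of `∂_y g⁽ⁱ⁾` at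
the origin.

The nonlinear terms of the system involve only gradients, which are bounded and Lipschitz in space.
Hence `∂_y u⁽ⁱ⁾ - P_{t,T} ∂_y g⁽ⁱ⁾` is the gradient of `∫_t^T P_{t,s} f_s ds` with a Lipschitz
source `f`, and is of order `T - t`. The Taylor remainder of `∂_y g⁽ⁱ⁾` has exponent `1 + α`; after
Gaussian averaging it is at most a constant times `T^((1+α)/2) (1 + |y|²/T)`. The Riccati solution
leaves its initial values, which are the Taylor coefficients, at most linearly in the time to
maturity. As `T ≤ 1`, all three errors are bounded by a multiple of `T^((1+α)/2) (1 + |y|²/T)`. This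
is `exists_norm_marketPrice_sub_le`. Inserting `y = Y_t` costs only `𝔼|Y_t|² ≤ c T`, which follows
from the variances of the Riemann sums (`IsWienerIntegral.integral_norm_sq_le`).

Solvability of the system is proved by hand from the Gaussian evolution family. Cameron–Martin gives
the smoothing bound `|∂ P_{t,s} f| ≤ c |f|₀ (s-t)^(-1/2)` (`evol_smoothing`); iterating it and
interpolating gives second derivatives and their Hölder seminorms with singularities integrable in
`s`. So linear equations with Lipschitz sources have solutions in `C^{2+α}` (`linSol_solves`). For
short maturities a contraction on the gradients produces a solution of the semilinear system
(`exists_isSemilinearSol`), with constants uniform in `T`. Conversely every classical solution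
satisfies the representation formula (`MemParabolicHolderTwo.eq_linSol`), and a Volterra inequality
with exponential weight yields uniqueness (`IsSemilinearSol.unique`). Uniqueness also transfers the
gradient estimate from the constructed solution to an arbitrary one. -/

lemma vec_eq_sum (v : Vec D) : v = ∑ d, v d • EuclideanSpace.single d (1 : ℝ) := by
  ext e
  simp [Finset.sum_apply, Pi.single_apply]

lemma abs_coord_le (v : Vec D) (d : Fin D) : |v d| ≤ ‖v‖ := by
  simpa using PiLp.norm_apply_le v d

lemma fderiv_apply_eq_sum (f : Vec D → ℝ) (y v : Vec D) :
    fderiv ℝ f y v = ∑ d, v d * partialDeriv d f y := by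
  conv_lhs => rw [vec_eq_sum v]
  simp [map_sum, partialDeriv]

lemma fderiv_eq_sum_proj (f : Vec D → ℝ) (y : Vec D) :
    fderiv ℝ f y = ∑ d, partialDeriv d f y • (EuclideanSpace.proj d : Vec D →L[ℝ] ℝ) := by
  ext v
  rw [fderiv_apply_eq_sum]
  simp [mul_comm]

lemma norm_fderiv_le_sum (f : Vec D → ℝ) (y : Vec D) :
    ‖fderiv ℝ f y‖ ≤ ∑ d, |partialDeriv d f y| := by
  refine ContinuousLinearMap.opNorm_le_bound _ (Finset.sum_nonneg fun _ _ => abs_nonneg _) fun v => ?_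
  rw [fderiv_apply_eq_sum, Finset.sum_mul]
  refine (Finset.abs_sum_le_sum_abs _ _).trans (Finset.sum_le_sum fun d _ => ?_)
  rw [abs_mul, mul_comm]
  exact mul_le_mul_of_nonneg_left (abs_coord_le v d) (abs_nonneg _)

lemma norm_fderiv_le_of_partialDeriv {f : Vec D → ℝ} {y : Vec D} {M : ℝ}
    (h : ∀ d, |partialDeriv d f y| ≤ M) : ‖fderiv ℝ f y‖ ≤ D * M := by
  refine (norm_fderiv_le_sum f y).trans ((Finset.sum_le_sum fun d _ => h d).trans ?_)
  simp

lemma contDiff_one_of_partialDeriv {f : Vec D → ℝ} (hf : Differentiable ℝ f)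
    (h : ∀ d, Continuous (partialDeriv d f)) : ContDiff ℝ 1 f := by
  rw [contDiff_one_iff_fderiv]
  refine ⟨hf, ?_⟩
  rw [show fderiv ℝ f = fun y => ∑ d, partialDeriv d f y • (EuclideanSpace.proj d : Vec D →L[ℝ] ℝ)
    from funext (fderiv_eq_sum_proj f)]
  exact continuous_finsetSum _ fun d _ => (h d).smul continuous_const

lemma contDiff_two_of_partialDeriv {f : Vec D → ℝ} (hf : Differentiable ℝ f)
    (h : ∀ d, ContDiff ℝ 1 (partialDeriv d f)) : ContDiff ℝ 2 f := by
  rw [show (2 : WithTop ℕ∞) = 1 + 1 from rfl, contDiff_succ_iff_fderiv]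
  refine ⟨hf, by simp, ?_⟩
  rw [show fderiv ℝ f = fun y => ∑ d, partialDeriv d f y • (EuclideanSpace.proj d : Vec D →L[ℝ] ℝ)
    from funext (fderiv_eq_sum_proj f)]
  exact ContDiff.sum fun d _ => (h d).smul contDiff_const

lemma contDiff_partialDeriv {f : Vec D → ℝ} (hf : ContDiff ℝ 2 f) (d : Fin D) :
    ContDiff ℝ 1 (partialDeriv d f) := by
  have h := (hf.fderiv_right (m := 1) (by norm_num)).clm_apply
    (contDiff_const (c := EuclideanSpace.single d (1 : ℝ)))
  exact h

lemma abs_sub_le_of_partialDeriv {f : Vec D → ℝ} (hf : Differentiable ℝ f) {M : ℝ}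
    (h : ∀ d y, |partialDeriv d f y| ≤ M) (x y : Vec D) : |f x - f y| ≤ D * M * ‖x - y‖ := by
  simpa using convex_univ.norm_image_sub_le_of_norm_fderiv_le (𝕜 := ℝ) (f := f)
    (fun z _ => hf z) (fun z _ => norm_fderiv_le_of_partialDeriv fun d => h d z)
    (mem_univ y) (mem_univ x)

lemma hasDerivAt_line {f : Vec D → ℝ} {y v : Vec D} {θ : ℝ}
    (hf : DifferentiableAt ℝ f (y + θ • v)) :
    HasDerivAt (fun r : ℝ => f (y + r • v)) (∑ d, v d * partialDeriv d f (y + θ • v)) θ := by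
  rw [← fderiv_apply_eq_sum]
  have h : HasDerivAt (fun r : ℝ => y + r • v) v θ := by
    simpa using ((hasDerivAt_id θ).smul_const v).const_add y
  exact hf.hasFDerivAt.comp_hasDerivAt θ h

lemma hasDerivAt_coord {f : Vec D → ℝ} {y : Vec D} (hf : DifferentiableAt ℝ f y) (d : Fin D) :
    HasDerivAt (fun r : ℝ => f (y + r • EuclideanSpace.single d (1 : ℝ))) (partialDeriv d f y) 0 := by
  have h : HasDerivAt (fun r : ℝ => y + r • EuclideanSpace.single d (1 : ℝ))
      (EuclideanSpace.single d (1 : ℝ)) 0 := by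
    simpa using ((hasDerivAt_id (0 : ℝ)).smul_const (EuclideanSpace.single d (1 : ℝ))).const_add y
  have hf' : HasFDerivAt f (fderiv ℝ f y) (y + (0 : ℝ) • EuclideanSpace.single d (1 : ℝ)) := by
    simpa using hf.hasFDerivAt
  exact hf'.comp_hasDerivAt 0 h

lemma partialDeriv_eq_of_hasFDerivAt {f : Vec D → ℝ} {y : Vec D} {A : Vec D →L[ℝ] ℝ}
    (h : HasFDerivAt f A y) (d : Fin D) : partialDeriv d f y = A (EuclideanSpace.single d 1) := by
  rw [partialDeriv, h.fderiv]

lemma partialDeriv_congr {f g : Vec D → ℝ} (h : ∀ y, f y = g y) (d : Fin D) (y : Vec D) :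
    partialDeriv d f y = partialDeriv d g y := by rw [funext h]

/-- A Hölder bound at `y` from a Lipschitz bound and boundedness. -/
lemma holder_of_bounded_of_lipschitz {a M N r α : ℝ} (hα0 : 0 < α) (hα1 : α < 1) (ha : 0 ≤ a)
    (hr : 0 ≤ r) (hM : 0 ≤ M) (hN : 0 ≤ N) (h1 : a ≤ M) (h2 : a ≤ N * r) :
    a ≤ M ^ (1 - α) * N ^ α * r ^ α := by
  have : a = a ^ (1 - α) * a ^ α := by
    rw [← Real.rpow_add_of_nonneg ha (by linarith) hα0.le]; simp
  rw [this, mul_assoc, ← Real.mul_rpow hN hr]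
  gcongr

/-- Differentiability is not needed, because `fderiv` is zero where it fails. -/
lemma abs_partialDeriv_le_of_lipschitz {f : Vec D → ℝ} {L : ℝ} (hL : 0 ≤ L)
    (h : ∀ x y, |f x - f y| ≤ L * ‖x - y‖) (d : Fin D) (y : Vec D) : |partialDeriv d f y| ≤ L := by
  have h1 : LipschitzWith L.toNNReal f := LipschitzWith.of_dist_le_mul fun x z => by
    rw [Real.dist_eq, dist_eq_norm, Real.coe_toNNReal _ hL]; exact h x z
  have h2 := norm_fderiv_le_of_lipschitz ℝ h1 (x₀ := y)
  rw [Real.coe_toNNReal _ hL] at h2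
  calc |partialDeriv d f y| ≤ ‖fderiv ℝ f y‖ * ‖(EuclideanSpace.single d (1 : ℝ) : Vec D)‖ :=
        (fderiv ℝ f y).le_opNorm _
    _ ≤ L := by simpa using h2

lemma abs_sum_mul_le {v : Vec D} {b : Fin D → ℝ} {K : ℝ} (h : ∀ d, |b d| ≤ K) :
    |∑ d, v d * b d| ≤ D * K * ‖v‖ := by
  refine (Finset.abs_sum_le_sum_abs _ _).trans ?_
  calc ∑ d, |v d * b d| ≤ ∑ _d : Fin D, K * ‖v‖ := Finset.sum_le_sum fun d _ => by
        rw [abs_mul, mul_comm]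
        exact mul_le_mul (h d) (abs_coord_le v d) (abs_nonneg _) ((abs_nonneg _).trans (h d))
    _ = D * K * ‖v‖ := by simp; ring

/-- First order Taylor expansion with Hölder remainder. -/
lemma taylor_one {f : Vec D → ℝ} (hf : Differentiable ℝ f) {K α : ℝ} (hα : 0 < α) (hK : 0 ≤ K)
    (h : ∀ d x y, |partialDeriv d f x - partialDeriv d f y| ≤ K * ‖x - y‖ ^ α) (y v : Vec D) :
    |f (y + v) - f y - ∑ d, v d * partialDeriv d f y| ≤ D * K * ‖v‖ ^ (1 + α) := by
  -- Mean value inequality on `[0,1]` for the restriction of `f` to the segment, with its tangent at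
  -- `r = 0` subtracted.
  have key := norm_image_sub_le_of_norm_deriv_le_segment_01'
    (f := fun r : ℝ => f (y + r • v) - r * ∑ d, v d * partialDeriv d f y)
    (f' := fun r => ∑ d, v d * partialDeriv d f (y + r • v) - 1 * ∑ d, v d * partialDeriv d f y)
    (C := D * K * ‖v‖ ^ (1 + α))
    (fun r _ => ((hasDerivAt_line (hf _)).sub ((hasDerivAt_id r).mul_const _)).hasDerivWithinAt)
    (fun r hr => by
      rw [one_mul, ← Finset.sum_sub_distrib]
      simp_rw [← mul_sub]
      have h3 : ∀ d, |partialDeriv d f (y + r • v) - partialDeriv d f y| ≤ K * ‖v‖ ^ α := by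
        intro d
        refine (h d _ _).trans (mul_le_mul_of_nonneg_left ?_ hK)
        refine Real.rpow_le_rpow (norm_nonneg _) ?_ hα.le
        rw [add_sub_cancel_left, norm_smul, Real.norm_of_nonneg hr.1]
        nlinarith [norm_nonneg v, hr.2]
      refine (abs_sum_mul_le h3).trans (le_of_eq ?_)
      rw [Real.rpow_add_of_nonneg (norm_nonneg v) zero_le_one hα.le, Real.rpow_one]; ring)
  simp only [one_smul, zero_smul, add_zero, one_mul, zero_mul, sub_zero, Real.norm_eq_abs] at key
  convert key using 2; ring

/-- Second order Taylor expansion with Hölder remainder. -/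
lemma taylor_two {f : Vec D → ℝ} (hf : Differentiable ℝ f)
    (hf2 : ∀ d, Differentiable ℝ (partialDeriv d f)) {K α : ℝ} (hα : 0 < α) (hK : 0 ≤ K)
    (h : ∀ d e x y, |partialDeriv e (partialDeriv d f) x - partialDeriv e (partialDeriv d f) y|
      ≤ K * ‖x - y‖ ^ α) (y v : Vec D) :
    |f (y + v) - f y - ∑ d, v d * partialDeriv d f y
      - 1 / 2 * ∑ d, ∑ e, v d * v e * partialDeriv e (partialDeriv d f) y|
      ≤ D * D * K * ‖v‖ ^ (2 + α) := by
  set A := ∑ d, ∑ e, v d * v e * partialDeriv e (partialDeriv d f) y with hA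
  -- With the quadratic part subtracted, the derivative in `r` is a combination of the first order
  -- remainders of the `∂_d f`, which `taylor_one` bounds for the increment `r • v`.
  have key := norm_image_sub_le_of_norm_deriv_le_segment_01'
    (f := fun r : ℝ => f (y + r • v) - r * ∑ d, v d * partialDeriv d f y - r ^ 2 * (1 / 2 * A))
    (f' := fun r => ∑ d, v d * partialDeriv d f (y + r • v) - 1 * ∑ d, v d * partialDeriv d f y
      - (↑2 * r ^ (2 - 1)) * (1 / 2 * A))
    (C := D * D * K * ‖v‖ ^ (2 + α))
    (fun r _ => (((hasDerivAt_line (hf _)).sub ((hasDerivAt_id r).mul_const _)).sub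
      ((hasDerivAt_pow 2 r).mul_const _)).hasDerivWithinAt)
    (fun r hr => by
      have h3 : ∀ d, |partialDeriv d f (y + r • v) - partialDeriv d f y
          - r * ∑ e, v e * partialDeriv e (partialDeriv d f) y| ≤ D * K * ‖v‖ ^ (1 + α) := by
        intro d
        have h4 := taylor_one (hf2 d) hα hK (h d) y (r • v)
        have h5 : ∑ e, (r • v) e * partialDeriv e (partialDeriv d f) y
            = r * ∑ e, v e * partialDeriv e (partialDeriv d f) y := by
          rw [Finset.mul_sum]; exact Finset.sum_congr rfl fun e _ => by simp [mul_assoc]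
        rw [h5] at h4
        refine h4.trans ?_
        gcongr
        rw [norm_smul, Real.norm_of_nonneg hr.1]
        nlinarith [norm_nonneg v, hr.2]
      have h6 : ∑ d, v d * partialDeriv d f (y + r • v) - 1 * ∑ d, v d * partialDeriv d f y
          - (↑2 * r ^ (2 - 1)) * (1 / 2 * A)
          = ∑ d, v d * (partialDeriv d f (y + r • v) - partialDeriv d f y
            - r * ∑ e, v e * partialDeriv e (partialDeriv d f) y) := by
        simp only [mul_sub, Finset.sum_sub_distrib, one_mul]
        congr 1
        rw [hA, Finset.mul_sum, Finset.mul_sum]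
        refine Finset.sum_congr rfl fun d _ => ?_
        rw [Finset.mul_sum, Finset.mul_sum, Finset.mul_sum, Finset.mul_sum]
        refine Finset.sum_congr rfl fun e _ => ?_
        norm_num
        ring
      push_cast at h6 ⊢
      rw [h6]
      refine (abs_sum_mul_le h3).trans (le_of_eq ?_)
      rw [show (2 : ℝ) + α = 1 + (1 + α) by ring,
        Real.rpow_add_of_nonneg (norm_nonneg v) zero_le_one (by linarith : 0 ≤ 1 + α),
        Real.rpow_one]; ring)
  simp only [one_smul, zero_smul, add_zero, one_mul, zero_mul, sub_zero, Real.norm_eq_abs,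
    one_pow, zero_pow two_ne_zero] at key
  convert key using 2; ring

lemma partialDeriv_comm {f : Vec D → ℝ} (hf : ContDiff ℝ 2 f) (d e : Fin D) (y : Vec D) :
    partialDeriv e (partialDeriv d f) y = partialDeriv d (partialDeriv e f) y := by
  have h : ∀ d e : Fin D, partialDeriv e (partialDeriv d f) y
      = fderiv ℝ (fderiv ℝ f) y (EuclideanSpace.single e 1) (EuclideanSpace.single d 1) := by
    intro d e
    have h1 : DifferentiableAt ℝ (fderiv ℝ f) y :=
      ((hf.fderiv_right (m := 1) (by norm_num)).differentiable (by norm_num)) y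
    have h2 := (h1.hasFDerivAt.clm_apply
      (hasFDerivAt_const (EuclideanSpace.single d (1 : ℝ) : Vec D) y))
    rw [partialDeriv_eq_of_hasFDerivAt (f := partialDeriv d f) h2]
    simp
  rw [h, h]
  exact (hf.contDiffAt.isSymmSndFDerivAt (by simp)) _ _

lemma partialDeriv_add {f g : Vec D → ℝ} {y : Vec D} (hf : DifferentiableAt ℝ f y)
    (hg : DifferentiableAt ℝ g y) (d : Fin D) :
    partialDeriv d (fun x => f x + g x) y = partialDeriv d f y + partialDeriv d g y := by
  rw [partialDeriv_eq_of_hasFDerivAt (hf.hasFDerivAt.fun_add hg.hasFDerivAt)]; rfl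

lemma partialDeriv_sub {f g : Vec D → ℝ} {y : Vec D} (hf : DifferentiableAt ℝ f y)
    (hg : DifferentiableAt ℝ g y) (d : Fin D) :
    partialDeriv d (fun x => f x - g x) y = partialDeriv d f y - partialDeriv d g y := by
  rw [partialDeriv_eq_of_hasFDerivAt (hf.hasFDerivAt.fun_sub hg.hasFDerivAt)]; rfl

/-! ### Partial derivatives of parameter integrals -/

/-- A sequence of increments is used so that partial derivatives of a parameter family become almost
everywhere limits of countably many measurable functions of the parameter. -/
lemma tendsto_diffQuot {f : Vec D → ℝ} {y : Vec D} (hf : DifferentiableAt ℝ f y) (d : Fin D) :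
    Tendsto (fun n : ℕ => ((n : ℝ) + 1) *
      (f (y + ((n : ℝ) + 1)⁻¹ • EuclideanSpace.single d (1 : ℝ)) - f y)) atTop
      (𝓝 (partialDeriv d f y)) := by
  have h := (hasDerivAt_coord hf d).tendsto_slope_zero
  have h2 : Tendsto (fun n : ℕ => ((n : ℝ) + 1)⁻¹) atTop (𝓝[≠] 0) := by
    refine tendsto_nhdsWithin_iff.2 ⟨?_, Eventually.of_forall fun n => ?_⟩
    · exact tendsto_inv_atTop_zero.comp (tendsto_natCast_atTop_atTop.atTop_add tendsto_const_nhds)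
    · simp only [mem_compl_iff, mem_singleton_iff]; positivity
  have h3 := h.comp h2
  simpa [Function.comp_def] using h3

lemma aestronglyMeasurable_partialDeriv {S : Type*} [MeasurableSpace S] {m : Measure S}
    {h : S → Vec D → ℝ} (hm : ∀ y, AEStronglyMeasurable (fun s => h s y) m)
    (hd : ∀ᵐ s ∂m, Differentiable ℝ (h s)) (d : Fin D) (y : Vec D) :
    AEStronglyMeasurable (fun s => partialDeriv d (h s) y) m := by
  refine aestronglyMeasurable_of_tendsto_ae atTop (fun n : ℕ => ?_)
    (hd.mono fun s hs => tendsto_diffQuot (hs y) d)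
  exact ((hm _).sub (hm _)).const_mul _

/-- Dominated differentiation stated coordinatewise. Measurability of the derivative in the
parameter comes from difference quotients and need not be supplied. -/
lemma hasFDerivAt_integral_of_partialDeriv {S : Type*} [MeasurableSpace S] {m : Measure S}
    {h : S → Vec D → ℝ} (hm : ∀ y, AEStronglyMeasurable (fun s => h s y) m)
    (hi : ∀ y, Integrable (fun s => h s y) m)
    (hd : ∀ᵐ s ∂m, Differentiable ℝ (h s)) {b : S → ℝ} (hb : Integrable b m)
    (hbd : ∀ᵐ s ∂m, ∀ d y, |partialDeriv d (h s) y| ≤ b s) (y : Vec D) :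
    DifferentiableAt ℝ (fun y => ∫ s, h s y ∂m) y ∧
      ∀ d, partialDeriv d (fun y => ∫ s, h s y ∂m) y = ∫ s, partialDeriv d (h s) y ∂m := by
  have hmeas : AEStronglyMeasurable (fun s => fderiv ℝ (h s) y) m := by
    simp_rw [fderiv_eq_sum_proj]
    exact Finset.aestronglyMeasurable_fun_sum _ fun d _ =>
      (aestronglyMeasurable_partialDeriv hm hd d y).smul_const _
  have key := hasFDerivAt_integral_of_dominated_of_fderiv_le (𝕜 := ℝ) (μ := m)
    (F := fun y s => h s y) (F' := fun y s => fderiv ℝ (h s) y) (x₀ := y) (s := univ)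
    (bound := fun s => D * b s) univ_mem (Eventually.of_forall hm) (hi y) hmeas
    (hbd.mono fun s hs x _ => norm_fderiv_le_of_partialDeriv fun d => hs d x)
    (hb.const_mul _) (hd.mono fun s hs x _ => (hs x).hasFDerivAt)
  refine ⟨key.differentiableAt, fun d => ?_⟩
  rw [partialDeriv_eq_of_hasFDerivAt key]
  have hint : Integrable (fun s => fderiv ℝ (h s) y) m :=
    (hb.const_mul (D : ℝ)).mono' hmeas
      (hbd.mono fun s hs => norm_fderiv_le_of_partialDeriv fun d => hs d y)
  exact ContinuousLinearMap.integral_apply hint _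

end Calculus

/-! ### Gaussian measures -/

section Gaussian

variable {D : ℕ}

/-- Fernique's theorem gives a square-exponential moment `exp (c ‖x‖²)`, and completing the square
gives `k ‖x‖ ≤ c ‖x‖² + k² / (4 c)`. -/
lemma integrable_exp_norm_gaussian (ν : Measure (Vec D)) [IsGaussian ν] (k : ℝ) :
    Integrable (fun x => Real.exp (k * ‖x‖)) ν := by
  obtain ⟨c, hc, hi⟩ := IsGaussian.exists_integrable_exp_sq ν
  refine (hi.const_mul (Real.exp (k ^ 2 / (4 * c)))).mono' (by fun_prop) (Eventually.of_forall fun x => ?_)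
  rw [Real.norm_of_nonneg (Real.exp_pos _).le, ← Real.exp_add, Real.exp_le_exp]
  have h : 0 ≤ c * (‖x‖ - k / (2 * c)) ^ 2 := by positivity
  have h2 : c * (‖x‖ - k / (2 * c)) ^ 2 = k ^ 2 / (4 * c) + c * ‖x‖ ^ 2 - k * ‖x‖ := by
    field_simp; ring
  linarith

/-- Complex exponents are allowed so that one formula covers the Laplace transform, the
characteristic function and the characteristic function of a tilted Gaussian. -/
lemma integral_cexp_stdGaussian (z : Fin D → ℂ) :
    ∫ x, Complex.exp (∑ j, z j * (x j : ℂ)) ∂(stdGaussian (Vec D))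
      = Complex.exp (∑ j, z j ^ 2 / 2) := by
  rw [← map_pi_eq_stdGaussian, integral_map (by fun_prop)
    (Measurable.aestronglyMeasurable (by fun_prop))]
  simp_rw [Complex.exp_sum]
  rw [integral_fintype_prod_eq_prod (f := fun (j : Fin D) (x : ℝ) => Complex.exp (z j * (x : ℂ)))]
  refine Finset.prod_congr rfl fun j _ => ?_
  have := complexMGF_id_gaussianReal (μ := 0) (v := 1) (z j)
  simpa [complexMGF] using this

lemma integral_exp_inner_stdGaussian (v : Vec D) :
    ∫ x, Real.exp (inner ℝ x v) ∂(stdGaussian (Vec D)) = Real.exp (‖v‖ ^ 2 / 2) := by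
  have h := integral_cexp_stdGaussian (fun j => ((v j : ℝ) : ℂ))
  have h2 : ∀ x : Vec D, Complex.exp (∑ j, ((v j : ℝ) : ℂ) * (x j : ℂ))
      = ((Real.exp (inner ℝ x v) : ℝ) : ℂ) := fun x => by
    simp [PiLp.inner_apply]
  simp_rw [h2] at h
  rw [integral_complex_ofReal] at h
  have h3 : Complex.exp (∑ j, ((v j : ℝ) : ℂ) ^ 2 / 2) = ((Real.exp (‖v‖ ^ 2 / 2) : ℝ) : ℂ) := by
    simp [EuclideanSpace.real_norm_sq_eq, Finset.sum_div]
  rw [h3] at h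
  exact_mod_cast h

/-- The Cameron–Martin formula for the standard Gaussian measure. -/
lemma map_add_stdGaussian (v : Vec D) :
    (stdGaussian (Vec D)).map (fun x => x + v)
      = (stdGaussian (Vec D)).tilted (fun x => inner ℝ x v) := by
  have hint : Integrable (fun x : Vec D => Real.exp (inner ℝ x v)) (stdGaussian (Vec D)) := by
    refine (integrable_exp_norm_gaussian _ ‖v‖).mono' (by fun_prop) (Eventually.of_forall fun x => ?_)
    rw [Real.norm_of_nonneg (Real.exp_pos _).le, Real.exp_le_exp, mul_comm]
    exact real_inner_le_norm x v
  have : IsProbabilityMeasure ((stdGaussian (Vec D)).tilted (fun x => inner ℝ x v)) :=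
    isProbabilityMeasure_tilted hint
  have : IsProbabilityMeasure ((stdGaussian (Vec D)).map (fun x => x + v)) :=
    Measure.isProbabilityMeasure_map (by fun_prop)
  -- Characteristic functions are compared: the shifted measure leads to the exponent `i t`, the
  -- tilted one to `v + i t`.
  apply Measure.ext_of_charFun
  ext t
  rw [charFun_apply, charFun_apply, integral_tilted, integral_map (by fun_prop)
    (Measurable.aestronglyMeasurable (by fun_prop)), integral_exp_inner_stdGaussian]
  have h1 : ∀ x : Vec D, Complex.exp ((inner ℝ (x + v) t : ℝ) * Complex.I)
      = Complex.exp (∑ j, (((t j : ℝ) : ℂ) * Complex.I) * (x j : ℂ))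
        * Complex.exp ((inner ℝ v t : ℝ) * Complex.I) := fun x => by
    rw [← Complex.exp_add, inner_add_left, PiLp.inner_apply x t]
    simp only [RCLike.inner_apply, conj_trivial]
    push_cast
    rw [add_mul, Finset.sum_mul]
    congr 2
    exact Finset.sum_congr rfl fun j _ => by ring
  have h2 : ∀ x : Vec D, (Real.exp (inner ℝ x v) / Real.exp (‖v‖ ^ 2 / 2)) •
        Complex.exp ((inner ℝ x t : ℝ) * Complex.I)
      = Complex.exp (∑ j, ((v j : ℂ) + ((t j : ℝ) : ℂ) * Complex.I) * (x j : ℂ))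
        * Complex.exp (-(‖v‖ ^ 2 / 2 : ℝ)) := fun x => by
    rw [← Real.exp_sub, Complex.real_smul, Complex.ofReal_exp, ← Complex.exp_add, ← Complex.exp_add,
      PiLp.inner_apply x t, PiLp.inner_apply x v]
    simp only [RCLike.inner_apply, conj_trivial]
    push_cast
    simp_rw [add_mul, Finset.sum_add_distrib]
    rw [Finset.sum_mul]
    congr 1
    have h3 : ∑ j, (t j : ℂ) * (x j : ℂ) * Complex.I = ∑ j, (t j : ℂ) * Complex.I * (x j : ℂ) :=
      Finset.sum_congr rfl fun j _ => by ring
    rw [h3]; ring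
  simp_rw [h1, h2]
  rw [integral_mul_const, integral_mul_const, integral_cexp_stdGaussian, integral_cexp_stdGaussian,
    ← Complex.exp_add, ← Complex.exp_add, EuclideanSpace.real_norm_sq_eq, PiLp.inner_apply v t]
  congr 1
  simp only [RCLike.inner_apply, conj_trivial]
  push_cast
  rw [Finset.sum_mul, Finset.sum_div, ← Finset.sum_add_distrib, ← Finset.sum_neg_distrib,
    ← Finset.sum_add_distrib]
  exact Finset.sum_congr rfl fun j _ => by ring

/-- The shift moves from `f` to a smooth density, so the integral can be differentiated in `v` even
when `f` is merely measurable. -/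
lemma integral_add_stdGaussian {f : Vec D → ℝ} (hf : Measurable f) (v : Vec D) :
    ∫ x, f (x + v) ∂(stdGaussian (Vec D))
      = ∫ x, f x * Real.exp (inner ℝ x v - ‖v‖ ^ 2 / 2) ∂(stdGaussian (Vec D)) := by
  rw [← integral_map (φ := fun x : Vec D => x + v) (by fun_prop) hf.aestronglyMeasurable,
    map_add_stdGaussian, integral_tilted, integral_exp_inner_stdGaussian]
  refine integral_congr_ae (Eventually.of_forall fun x => ?_)
  simp only [smul_eq_mul, Real.exp_sub]
  ring

lemma integrable_of_bounded {ν : Measure (Vec D)} [IsFiniteMeasure ν] {f : Vec D → ℝ}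
    (hf : Measurable f) {M : ℝ} (hM : ∀ y, |f y| ≤ M) : Integrable f ν :=
  Integrable.of_bound hf.aestronglyMeasurable M (Eventually.of_forall hM)

lemma hasFDerivAt_cameronMartin (x w : Vec D) (a : ℝ) :
    HasFDerivAt (fun w : Vec D => a * Real.exp (inner ℝ x w - ‖w‖ ^ 2 / 2))
      ((a * Real.exp (inner ℝ x w - ‖w‖ ^ 2 / 2)) • (innerSL ℝ x - innerSL ℝ w)) w := by
  have h1 : HasFDerivAt (fun w : Vec D => inner ℝ x w - ‖w‖ ^ 2 * (1 / 2))
      (innerSL ℝ x - innerSL ℝ w) w := by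
    have h2 := ((hasStrictFDerivAt_norm_sq w).hasFDerivAt.mul_const (1 / 2 : ℝ))
    have h3 : HasFDerivAt (fun w : Vec D => inner ℝ x w) (innerSL ℝ x) w :=
      (innerSL ℝ x).hasFDerivAt
    refine (h3.sub h2).congr_fderiv ?_
    ext z
    simp
  have h4 := (h1.exp).const_mul a
  simp only [mul_one_div] at h4
  rwa [smul_smul] at h4

/-- Differentiability and gradient bound of the heat semigroup on bounded measurable functions. -/
lemma exists_heat_gradient_bound (D : ℕ) : ∃ c : ℝ, 0 < c ∧ ∀ (f : Vec D → ℝ) (M r : ℝ),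
    Measurable f → (∀ y, |f y| ≤ M) → 0 < r →
      Differentiable ℝ (fun y => ∫ x, f (y + r • x) ∂(stdGaussian (Vec D))) ∧
      ∀ y, ‖fderiv ℝ (fun y => ∫ x, f (y + r • x) ∂(stdGaussian (Vec D))) y‖ ≤ c * M / r := by
  have hn : Integrable (fun x : Vec D => ‖x‖) (stdGaussian (Vec D)) :=
    IsGaussian.integrable_id.norm
  -- The gradient bound needs only the first absolute moment; the summand `1` makes the constant
  -- positive also for `D = 0`.
  refine ⟨(∫ x, ‖x‖ ∂(stdGaussian (Vec D))) + 1, by positivity, fun f M r hf hM hr => ?_⟩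
  have hM0 : 0 ≤ M := (abs_nonneg _).trans (hM 0)
  set γ := stdGaussian (Vec D)
  have key : ∀ y, ∃ A : Vec D →L[ℝ] ℝ,
      HasFDerivAt (fun y => ∫ x, f (y + r • x) ∂γ) A y ∧ ‖A‖ ≤ ((∫ x, ‖x‖ ∂γ) + 1) * M / r := by
    intro y
    have hmeas : ∀ w : Vec D, AEStronglyMeasurable
        (fun x => f (y + r • x) * Real.exp (inner ℝ x w - ‖w‖ ^ 2 / 2)) γ := fun w => by
      have : Measurable fun x : Vec D => f (y + r • x) := hf.comp (by fun_prop)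
      exact (this.mul (by fun_prop)).aestronglyMeasurable
    have hshift : ∀ w : Vec D, ∫ x, f (y + r • w + r • x) ∂γ
        = ∫ x, f (y + r • x) * Real.exp (inner ℝ x w - ‖w‖ ^ 2 / 2) ∂γ := fun w => by
      rw [← integral_add_stdGaussian (f := fun x => f (y + r • x)) (hf.comp (by fun_prop)) w]
      refine integral_congr_ae (Eventually.of_forall fun x => ?_)
      simp only [smul_add]
      congr 1; abel
    -- Differentiation in the shift `w` at `0`. On the unit ball the derivative of the density is at
    -- most `exp ‖x‖ (‖x‖ + 1) ≤ exp (2 ‖x‖)`.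
    have hd := hasFDerivAt_integral_of_dominated_of_fderiv_le (𝕜 := ℝ) (μ := γ)
      (F := fun w x => f (y + r • x) * Real.exp (inner ℝ x w - ‖w‖ ^ 2 / 2))
      (F' := fun w x => (f (y + r • x) * Real.exp (inner ℝ x w - ‖w‖ ^ 2 / 2)) •
        (innerSL ℝ x - innerSL ℝ w)) (x₀ := 0) (s := Metric.ball 0 1)
      (bound := fun x => M * Real.exp (2 * ‖x‖)) (Metric.ball_mem_nhds _ one_pos)
      (Eventually.of_forall hmeas)
      (by
        simp only [inner_zero_right, norm_zero, ne_eq, OfNat.ofNat_ne_zero, not_false_eq_true,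
          zero_pow, zero_div, sub_zero, Real.exp_zero, mul_one]
        exact integrable_of_bounded (hf.comp (by fun_prop)) fun x => hM _)
      ((hmeas 0).smul (by fun_prop))
      (Eventually.of_forall fun x w hw => by
        have hw1 : ‖w‖ ≤ 1 := by simpa using (Metric.mem_ball.1 hw).le
        rw [norm_smul, norm_mul, Real.norm_of_nonneg (Real.exp_pos _).le, mul_assoc]
        refine mul_le_mul (hM _) ?_ (by positivity) hM0
        rw [two_mul, Real.exp_add]
        refine mul_le_mul (Real.exp_le_exp.2 ?_) ?_ (norm_nonneg _) (Real.exp_pos _).le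
        · have := real_inner_le_norm x w
          nlinarith [norm_nonneg x, norm_nonneg w, sq_nonneg ‖w‖]
        · refine (norm_sub_le _ _).trans ?_
          rw [innerSL_apply_norm, innerSL_apply_norm]
          have := Real.add_one_le_exp ‖x‖
          linarith)
      ((integrable_exp_norm_gaussian γ 2).const_mul M)
      (Eventually.of_forall fun x w _ => hasFDerivAt_cameronMartin x w _)
    simp only [inner_zero_right, norm_zero, ne_eq, OfNat.ofNat_ne_zero, not_false_eq_true,
          zero_pow, zero_div, sub_zero, Real.exp_zero, mul_one, map_zero] at hd
    set A := ∫ x, f (y + r • x) • innerSL ℝ x ∂γ with hA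
    have hA' : ‖A‖ ≤ M * ∫ x, ‖x‖ ∂γ := by
      rw [← integral_const_mul]
      refine norm_integral_le_of_norm_le (hn.const_mul M) (Eventually.of_forall fun x => ?_)
      rw [norm_smul, innerSL_apply_norm]
      exact mul_le_mul_of_nonneg_right (hM _) (norm_nonneg _)
    -- Moving the base point from `y` to `z` is the shift `w = r⁻¹ (z - y)`; the chain rule gives
    -- the factor `r⁻¹`.
    refine ⟨r⁻¹ • A, ?_, ?_⟩
    · have hg : HasFDerivAt (fun z : Vec D => r⁻¹ • (z - y)) (r⁻¹ • ContinuousLinearMap.id ℝ (Vec D)) y :=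
        ((hasFDerivAt_id y).sub_const y).const_smul r⁻¹
      have hd' : HasFDerivAt (fun w => ∫ x, f (y + r • x) * Real.exp (inner ℝ x w - ‖w‖ ^ 2 / 2) ∂γ)
          A (r⁻¹ • (y - y)) := by simpa using hd
      have := hd'.comp y hg
      rw [ContinuousLinearMap.comp_smul, ContinuousLinearMap.comp_id] at this
      refine this.congr_of_eventuallyEq (Eventually.of_forall fun z => ?_)
      simp only [Function.comp]
      rw [← hshift, smul_smul, mul_inv_cancel₀ hr.ne', one_smul, add_sub_cancel]
    · rw [norm_smul, norm_inv, Real.norm_of_nonneg hr.le, inv_mul_eq_div]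
      refine div_le_div_of_nonneg_right (hA'.trans ?_) hr.le
      nlinarith
  refine ⟨fun y => (key y).choose_spec.1.differentiableAt, fun y => ?_⟩
  rw [(key y).choose_spec.1.fderiv]
  exact (key y).choose_spec.2

/-- This gives the evolution property, and it allows an isotropic part to be split off a Gaussian.
-/
lemma multivariateGaussian_conv {A B : Matrix (Fin D) (Fin D) ℝ} (hA : A.PosSemidef)
    (hB : B.PosSemidef) : multivariateGaussian 0 A ∗ multivariateGaussian 0 B
      = multivariateGaussian (0 : Vec D) (A + B) := by
  apply Measure.ext_of_charFun
  ext t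
  rw [charFun_conv, charFun_multivariateGaussian hA, charFun_multivariateGaussian hB,
    charFun_multivariateGaussian (hA.add hB), ← Complex.exp_add, Matrix.add_mulVec,
    dotProduct_add]
  congr 1
  push_cast
  simp
  ring

lemma multivariateGaussian_smul_one {r : ℝ} :
    multivariateGaussian (0 : Vec D) ((r ^ 2) • (1 : Matrix (Fin D) (Fin D) ℝ))
      = (stdGaussian (Vec D)).map (fun x => r • x) := by
  have : IsProbabilityMeasure ((stdGaussian (Vec D)).map (fun x => r • x)) :=
    Measure.isProbabilityMeasure_map (by fun_prop)
  apply Measure.ext_of_charFun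
  ext t
  rw [charFun_map_smul, charFun_stdGaussian,
    charFun_multivariateGaussian (Matrix.PosSemidef.one.smul (sq_nonneg r))]
  congr 1
  have h : t.ofLp ⬝ᵥ ((r ^ 2) • (1 : Matrix (Fin D) (Fin D) ℝ)) *ᵥ t.ofLp = ‖r • t‖ ^ 2 := by
    rw [Matrix.smul_mulVec, Matrix.one_mulVec, dotProduct_smul, norm_smul, mul_pow,
      EuclideanSpace.real_norm_sq_eq]
    simp [dotProduct, sq]
  rw [h, inner_zero_right]
  push_cast
  ring

open scoped MatrixOrder in
lemma norm_sqrt_apply_sq {A : Matrix (Fin D) (Fin D) ℝ} (hA : A.PosSemidef) (x : Vec D) :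
    ‖Matrix.toEuclideanCLM (𝕜 := ℝ) (CFC.sqrt A) x‖ ^ 2 = x.ofLp ⬝ᵥ A *ᵥ x.ofLp := by
  rw [← real_inner_self_eq_norm_sq, ← ContinuousLinearMap.adjoint_inner_right,
    IsSelfAdjoint.adjoint_eq ((CFC.sqrt_nonneg A).isSelfAdjoint.map _),
    ← ContinuousLinearMap.comp_apply, ← ContinuousLinearMap.mul_def, ← map_mul,
    CFC.sqrt_mul_sqrt_self _ hA.nonneg, Matrix.inner_toEuclideanCLM]

lemma integrable_norm_rpow_gaussian (ν : Measure (Vec D)) [IsGaussian ν] {p : ℝ} (hp : 0 ≤ p) :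
    Integrable (fun x => ‖x‖ ^ p) ν := by
  refine (integrable_exp_norm_gaussian ν p).mono' (by fun_prop) (Eventually.of_forall fun x => ?_)
  rw [Real.norm_of_nonneg (by positivity), mul_comm, Real.exp_mul]
  exact Real.rpow_le_rpow (norm_nonneg _) (by linarith [Real.add_one_le_exp ‖x‖]) hp

open scoped MatrixOrder in
-- The Gaussian is the image of the standard one under `√A`, and the bound on the quadratic form
-- says `‖√A x‖ ≤ √k ‖x‖`.
lemma integral_norm_rpow_multivariateGaussian_le {A : Matrix (Fin D) (Fin D) ℝ}
    (hA : A.PosSemidef) {k p : ℝ} (hk : 0 ≤ k) (hp : 0 ≤ p)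
    (h : ∀ x : Vec D, x.ofLp ⬝ᵥ A *ᵥ x.ofLp ≤ k * ‖x‖ ^ 2) :
    ∫ x, ‖x‖ ^ p ∂(multivariateGaussian (0 : Vec D) A)
      ≤ k ^ (p / 2) * ∫ x, ‖x‖ ^ p ∂(stdGaussian (Vec D)) := by
  rw [multivariateGaussian, integral_map (by fun_prop) (by fun_prop), ← integral_const_mul]
  have hb : ∀ x : Vec D, ‖0 + Matrix.toEuclideanCLM (𝕜 := ℝ) (CFC.sqrt A) x‖ ^ p
      ≤ k ^ (p / 2) * ‖x‖ ^ p := fun x => by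
    rw [zero_add]
    have h1 : ‖Matrix.toEuclideanCLM (𝕜 := ℝ) (CFC.sqrt A) x‖ ≤ √k * ‖x‖ := by
      refine abs_le_of_sq_le_sq' ?_ (by positivity) |>.2
      rw [norm_sqrt_apply_sq hA, mul_pow, Real.sq_sqrt hk]
      exact h x
    refine (Real.rpow_le_rpow (norm_nonneg _) h1 hp).trans (le_of_eq ?_)
    rw [Real.mul_rpow (Real.sqrt_nonneg _) (norm_nonneg _), Real.sqrt_eq_rpow, ← Real.rpow_mul hk]
    congr 2; ring
  have hi := (integrable_norm_rpow_gaussian (stdGaussian (Vec D)) hp).const_mul (k ^ (p / 2))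
  exact integral_mono_of_nonneg (Eventually.of_forall fun x => by positivity) hi
    (Eventually.of_forall hb)

lemma integrable_coord_gaussian (ν : Measure (Vec D)) [IsGaussian ν] (d : Fin D) :
    Integrable (fun x : Vec D => x d) ν :=
  IsGaussian.integrable_id.norm.mono' (by fun_prop) (Eventually.of_forall fun x => abs_coord_le x d)

lemma integrable_coord_mul_gaussian (ν : Measure (Vec D)) [IsGaussian ν] (d e : Fin D) :
    Integrable (fun x : Vec D => x d * x e) ν := by
  refine (integrable_norm_rpow_gaussian ν (p := 2) (by norm_num)).mono' (by fun_prop)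
    (Eventually.of_forall fun x => ?_)
  rw [norm_mul, Real.rpow_two, sq]
  exact mul_le_mul (abs_coord_le x d) (abs_coord_le x e) (abs_nonneg _) (norm_nonneg _)

lemma integral_coord_multivariateGaussian (A : Matrix (Fin D) (Fin D) ℝ) (d : Fin D) :
    ∫ x, x d ∂(multivariateGaussian (0 : Vec D) A) = 0 := by
  have := (EuclideanSpace.proj d : Vec D →L[ℝ] ℝ).integral_comp_comm
    (IsGaussian.integrable_fun_id (μ := multivariateGaussian (0 : Vec D) A))
  simpa using this

lemma integral_coord_mul_multivariateGaussian {A : Matrix (Fin D) (Fin D) ℝ} (hA : A.PosSemidef)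
    (d e : Fin D) : ∫ x, x d * x e ∂(multivariateGaussian (0 : Vec D) A) = A d e := by
  have h := covariance_eval_multivariateGaussian (μ := 0) hA d e
  rw [← h, covariance, integral_coord_multivariateGaussian, integral_coord_multivariateGaussian]
  simp

end Gaussian

/-! ### The evolution family generated by `(1/2) tr(Q(t) ∂_{yy})` -/

section Evolution

variable {D : ℕ}

/-- Continuous, symmetric and uniformly elliptic diffusion coefficients. -/
structure IsElliptic (δ₁ δ₂ : ℝ) (Q : ℝ → Matrix (Fin D) (Fin D) ℝ) : Prop where
  pos : 0 < δ₁
  pos' : 0 < δ₂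
  symm : ∀ t, (Q t).IsSymm
  lower : ∀ t (y : Vec D), δ₁ * ‖y‖ ^ 2 ≤ y.ofLp ⬝ᵥ Q t *ᵥ y.ofLp
  upper : ∀ t (y : Vec D), y.ofLp ⬝ᵥ Q t *ᵥ y.ofLp ≤ δ₂ * ‖y‖ ^ 2
  continuous : ∀ d e, Continuous fun t => Q t d e

/-- The covariance `∫_t^s Q(u) du`. -/
def cov (Q : ℝ → Matrix (Fin D) (Fin D) ℝ) (t s : ℝ) : Matrix (Fin D) (Fin D) ℝ :=
  Matrix.of fun d e => ∫ u in t..s, Q u d e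

/-- The evolution family `f ↦ 𝔼[f(y + N(0, ∫_t^s Q))]`. -/
def evol (Q : ℝ → Matrix (Fin D) (Fin D) ℝ) (t s : ℝ) (f : Vec D → ℝ) (y : Vec D) : ℝ :=
  ∫ x, f (y + x) ∂(multivariateGaussian (0 : Vec D) (cov Q t s))

/-- The constant in the estimate of the `p`-th moment of `N(0, ∫_t^s Q)`. -/
def momentConst (D : ℕ) (δ₂ p : ℝ) : ℝ := δ₂ ^ (p / 2) * ∫ x, ‖x‖ ^ p ∂(stdGaussian (Vec D))

/-- The constant in the gradient estimate of the evolution family. -/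
def smoothConst (D : ℕ) (δ₁ : ℝ) : ℝ := (exists_heat_gradient_bound D).choose / √δ₁

lemma momentConst_nonneg {δ₂ : ℝ} (h : 0 ≤ δ₂) (p : ℝ) : 0 ≤ momentConst D δ₂ p :=
  mul_nonneg (Real.rpow_nonneg h _) (integral_nonneg fun _ => by positivity)

lemma smoothConst_pos {δ₁ : ℝ} (h : 0 < δ₁) : 0 < smoothConst D δ₁ :=
  div_pos (exists_heat_gradient_bound D).choose_spec.1 (Real.sqrt_pos.2 h)

variable {δ₁ δ₂ : ℝ} {Q : ℝ → Matrix (Fin D) (Fin D) ℝ}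

lemma IsElliptic.intervalIntegrable (hQ : IsElliptic δ₁ δ₂ Q) (d e : Fin D) (t s : ℝ) :
    IntervalIntegrable (fun u => Q u d e) volume t s := (hQ.continuous d e).intervalIntegrable _ _

lemma cov_dotProduct (hQ : IsElliptic δ₁ δ₂ Q) (t s : ℝ) (y : Fin D → ℝ) :
    y ⬝ᵥ cov Q t s *ᵥ y = ∫ u in t..s, y ⬝ᵥ Q u *ᵥ y := by
  simp only [dotProduct, Matrix.mulVec, cov, Matrix.of_apply]
  rw [intervalIntegral.integral_finsetSum]
  · refine Finset.sum_congr rfl fun d _ => ?_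
    rw [intervalIntegral.integral_const_mul, intervalIntegral.integral_finsetSum]
    · simp_rw [intervalIntegral.integral_mul_const]
    · exact fun e _ => (hQ.intervalIntegrable d e t s).mul_const _
  · refine fun d _ => Continuous.intervalIntegrable ?_ _ _
    exact continuous_const.mul (continuous_finsetSum _ fun e _ => (hQ.continuous d e).mul continuous_const)

lemma continuous_dotProduct (hQ : IsElliptic δ₁ δ₂ Q) (y : Fin D → ℝ) :
    Continuous fun u => y ⬝ᵥ Q u *ᵥ y := by
  simp only [dotProduct, Matrix.mulVec]
  exact continuous_finsetSum _ fun d _ =>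
    continuous_const.mul (continuous_finsetSum _ fun e _ => (hQ.continuous d e).mul continuous_const)

lemma cov_lower (hQ : IsElliptic δ₁ δ₂ Q) {t s : ℝ} (hts : t ≤ s) (y : Vec D) :
    δ₁ * (s - t) * ‖y‖ ^ 2 ≤ y.ofLp ⬝ᵥ cov Q t s *ᵥ y.ofLp := by
  rw [cov_dotProduct hQ]
  have := intervalIntegral.integral_mono_on (f := fun _ => δ₁ * ‖y‖ ^ 2) (μ := volume) hts
    intervalIntegrable_const
    ((continuous_dotProduct hQ y.ofLp).intervalIntegrable t s) fun u _ => hQ.lower u y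
  rw [intervalIntegral.integral_const, smul_eq_mul] at this
  linarith

lemma cov_upper (hQ : IsElliptic δ₁ δ₂ Q) {t s : ℝ} (hts : t ≤ s) (y : Vec D) :
    y.ofLp ⬝ᵥ cov Q t s *ᵥ y.ofLp ≤ δ₂ * (s - t) * ‖y‖ ^ 2 := by
  rw [cov_dotProduct hQ]
  have := intervalIntegral.integral_mono_on (g := fun _ => δ₂ * ‖y‖ ^ 2) (μ := volume) hts
    ((continuous_dotProduct hQ y.ofLp).intervalIntegrable t s) intervalIntegrable_const fun u _ => hQ.upper u y
  rw [intervalIntegral.integral_const, smul_eq_mul] at this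
  linarith

lemma cov_isSymm (hQ : IsElliptic δ₁ δ₂ Q) (t s : ℝ) : (cov Q t s).IsSymm := by
  ext d e
  simp only [cov, Matrix.transpose_apply, Matrix.of_apply]
  simp_rw [fun u => (hQ.symm u).apply d e]

lemma posSemidef_of_forall_vec {A : Matrix (Fin D) (Fin D) ℝ} (hA : A.IsSymm)
    (h : ∀ y : Vec D, 0 ≤ y.ofLp ⬝ᵥ A *ᵥ y.ofLp) : A.PosSemidef :=
  Matrix.PosSemidef.of_dotProduct_mulVec_nonneg hA fun x => by
    simpa using h (WithLp.toLp 2 x)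

lemma cov_posSemidef (hQ : IsElliptic δ₁ δ₂ Q) {t s : ℝ} (hts : t ≤ s) : (cov Q t s).PosSemidef :=
  posSemidef_of_forall_vec (cov_isSymm hQ t s) fun y =>
    (mul_nonneg (mul_nonneg hQ.pos.le (sub_nonneg.2 hts)) (sq_nonneg _)).trans (cov_lower hQ hts y)

lemma cov_add (hQ : IsElliptic δ₁ δ₂ Q) (t r s : ℝ) : cov Q t r + cov Q r s = cov Q t s := by
  ext d e
  exact intervalIntegral.integral_add_adjacent_intervals (hQ.intervalIntegrable d e t r)
    (hQ.intervalIntegrable d e r s)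

lemma measurable_average (ν : Measure (Vec D)) [SFinite ν] {f : Vec D → ℝ} (hf : Measurable f) :
    Measurable fun y => ∫ x, f (y + x) ∂ν := by
  have h : StronglyMeasurable (fun p : Vec D × Vec D => f (p.1 + p.2)) :=
    (hf.comp (measurable_fst.add measurable_snd)).stronglyMeasurable
  exact h.integral_prod_right.measurable

lemma abs_average_le {ν : Measure (Vec D)} [IsProbabilityMeasure ν] {f : Vec D → ℝ} {M : ℝ}
    (hM : ∀ y, |f y| ≤ M) (y : Vec D) : |∫ x, f (y + x) ∂ν| ≤ M := by
  simpa using norm_integral_le_of_norm_le_const (μ := ν) (f := fun x => f (y + x))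
    (Eventually.of_forall fun x => hM (y + x))

lemma evol_measurable {t s : ℝ} {f : Vec D → ℝ} (hf : Measurable f) : Measurable (evol Q t s f) :=
  measurable_average _ hf

lemma abs_evol_le {t s : ℝ} {f : Vec D → ℝ} {M : ℝ} (hM : ∀ y, |f y| ≤ M) (y : Vec D) :
    |evol Q t s f y| ≤ M := abs_average_le hM y

lemma integrable_shift {ν : Measure (Vec D)} [IsFiniteMeasure ν] {f : Vec D → ℝ}
    (hf : Measurable f) {M : ℝ} (hM : ∀ y, |f y| ≤ M) (y : Vec D) :
    Integrable (fun x => f (y + x)) ν :=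
  integrable_of_bounded (hf.comp (measurable_const_add y)) fun x => hM (y + x)

lemma average_conv {ν ν' : Measure (Vec D)} [IsProbabilityMeasure ν] [IsProbabilityMeasure ν']
    {f : Vec D → ℝ} (hf : Measurable f) {M : ℝ} (hM : ∀ y, |f y| ≤ M) (y : Vec D) :
    ∫ x, f (y + x) ∂(ν ∗ ν') = ∫ x, ∫ z, f (y + x + z) ∂ν' ∂ν := by
  rw [integral_conv (integrable_shift hf hM y)]
  simp only [add_assoc]

/-- Chapman–Kolmogorov: the covariances over adjacent intervals add, and the Gaussians convolve
accordingly. -/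
lemma evol_comp (hQ : IsElliptic δ₁ δ₂ Q) {t r s : ℝ} (htr : t ≤ r) (hrs : r ≤ s)
    {f : Vec D → ℝ} (hf : Measurable f) {M : ℝ} (hM : ∀ y, |f y| ≤ M) (y : Vec D) :
    evol Q t s f y = evol Q t r (evol Q r s f) y := by
  rw [evol, ← cov_add hQ t r s,
    ← multivariateGaussian_conv (cov_posSemidef hQ htr) (cov_posSemidef hQ hrs),
    average_conv hf hM]
  rfl

lemma evol_sub {t s : ℝ} {f g : Vec D → ℝ} (hf : Measurable f) (hg : Measurable g) {M M' : ℝ}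
    (hM : ∀ y, |f y| ≤ M) (hM' : ∀ y, |g y| ≤ M') (y : Vec D) :
    evol Q t s (fun y => f y - g y) y = evol Q t s f y - evol Q t s g y :=
  integral_sub (integrable_shift hf hM y) (integrable_shift hg hM' y)

lemma abs_evol_sub_le {t s : ℝ} {f g : Vec D → ℝ} (hf : Measurable f) (hg : Measurable g) {M M' : ℝ}
    (hM : ∀ y, |f y| ≤ M) (hM' : ∀ y, |g y| ≤ M') {ε : ℝ} (hε : ∀ y, |f y - g y| ≤ ε) (y : Vec D) :
    |evol Q t s f y - evol Q t s g y| ≤ ε := by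
  rw [← evol_sub hf hg hM hM']
  exact abs_evol_le hε y

lemma abs_evol_sub_evol_le {t s : ℝ} {f : Vec D → ℝ} (hf : Measurable f) {M : ℝ}
    (hM : ∀ y, |f y| ≤ M) {ω : ℝ → ℝ} (h : ∀ x y, |f x - f y| ≤ ω ‖x - y‖) (x y : Vec D) :
    |evol Q t s f x - evol Q t s f y| ≤ ω ‖x - y‖ := by
  rw [evol, evol, ← integral_sub (integrable_shift hf hM x) (integrable_shift hf hM y)]
  have := norm_integral_le_of_norm_le_const (μ := multivariateGaussian (0 : Vec D) (cov Q t s))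
    (f := fun z => f (x + z) - f (y + z)) (C := ω ‖x - y‖)
    (Eventually.of_forall fun z => by simpa using h (x + z) (y + z))
  simpa using this

lemma integral_norm_rpow_cov_le (hQ : IsElliptic δ₁ δ₂ Q) {t s p : ℝ} (hts : t ≤ s) (hp : 0 ≤ p) :
    ∫ x, ‖x‖ ^ p ∂(multivariateGaussian (0 : Vec D) (cov Q t s))
      ≤ momentConst D δ₂ p * (s - t) ^ (p / 2) := by
  have h := integral_norm_rpow_multivariateGaussian_le (cov_posSemidef hQ hts)
    (mul_nonneg hQ.pos'.le (sub_nonneg.2 hts)) hp (cov_upper hQ hts)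
  rw [Real.mul_rpow hQ.pos'.le (sub_nonneg.2 hts)] at h
  rw [momentConst]
  linarith

/-- The displacement over `[t,s]` has `p`-th moment of order `(s-t)^(p/2)`. Combined with the
evolution property this converts spatial regularity into regularity in time at half the exponent. -/
lemma abs_evol_sub_self_le (hQ : IsElliptic δ₁ δ₂ Q) {t s : ℝ} (hts : t ≤ s) {f : Vec D → ℝ}
    (hf : Measurable f) {M : ℝ} (hM : ∀ y, |f y| ≤ M) {K p : ℝ} (hK : 0 ≤ K) (hp : 0 ≤ p)
    (h : ∀ x y, |f x - f y| ≤ K * ‖x - y‖ ^ p) (y : Vec D) :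
    |evol Q t s f y - f y| ≤ K * momentConst D δ₂ p * (s - t) ^ (p / 2) := by
  set ν := multivariateGaussian (0 : Vec D) (cov Q t s) with hν
  have h1 : evol Q t s f y - f y = ∫ x, (f (y + x) - f y) ∂ν := by
    rw [integral_sub (integrable_shift hf hM y) (integrable_const _)]
    simp [evol, hν]
  rw [h1]
  have h2 : ‖∫ x, (f (y + x) - f y) ∂ν‖ ≤ ∫ x, K * ‖x‖ ^ p ∂ν :=
    norm_integral_le_of_norm_le ((integrable_norm_rpow_gaussian ν hp).const_mul K)
      (Eventually.of_forall fun x => by simpa using h (y + x) y)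
  rw [integral_const_mul] at h2
  refine h2.trans ?_
  rw [mul_assoc]
  exact mul_le_mul_of_nonneg_left (integral_norm_rpow_cov_le hQ hts hp) hK

/-- Gradient estimate of the evolution family on bounded measurable functions. -/
lemma evol_smoothing (hQ : IsElliptic δ₁ δ₂ Q) {t s : ℝ} (hts : t < s) {f : Vec D → ℝ}
    (hf : Measurable f) {M : ℝ} (hM : ∀ y, |f y| ≤ M) :
    Differentiable ℝ (evol Q t s f) ∧
      ∀ y, ‖fderiv ℝ (evol Q t s f) y‖ ≤ smoothConst D δ₁ * M * (s - t) ^ (-(1 / 2) : ℝ) := by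
  have hts' : 0 < s - t := sub_pos.2 hts
  set r := √(δ₁ * (s - t)) with hr
  have hr0 : 0 < r := Real.sqrt_pos.2 (mul_pos hQ.pos hts')
  have hr2 : r ^ 2 = δ₁ * (s - t) := Real.sq_sqrt (mul_pos hQ.pos hts').le
  -- Ellipticity leaves a positive semidefinite remainder after removing `δ₁ (s-t)` times the
  -- identity. Averaging over the remainder keeps the bound `M`, and the isotropic factor of scale
  -- `r` supplies the heat gradient bound.
  set B := cov Q t s - (r ^ 2) • (1 : Matrix (Fin D) (Fin D) ℝ) with hB
  have hBp : B.PosSemidef := by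
    refine posSemidef_of_forall_vec ?_ fun y => ?_
    · rw [hB, Matrix.IsSymm, Matrix.transpose_sub, Matrix.transpose_smul, Matrix.transpose_one,
        (cov_isSymm hQ t s).eq]
    · rw [hB, Matrix.sub_mulVec, Matrix.smul_mulVec, Matrix.one_mulVec, dotProduct_sub,
        dotProduct_smul, hr2]
      have h1 := cov_lower hQ hts.le y
      have h2 : y.ofLp ⬝ᵥ y.ofLp = ‖y‖ ^ 2 := by
        rw [EuclideanSpace.real_norm_sq_eq]; simp [dotProduct, sq]
      rw [h2, smul_eq_mul]
      linarith
  have hconv : multivariateGaussian (0 : Vec D) (cov Q t s)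
      = (stdGaussian (Vec D)).map (fun x => r • x) ∗ multivariateGaussian (0 : Vec D) B := by
    rw [← multivariateGaussian_smul_one,
      multivariateGaussian_conv (Matrix.PosSemidef.one.smul (sq_nonneg r)) hBp, hB, add_sub_cancel]
  have : IsProbabilityMeasure ((stdGaussian (Vec D)).map (fun x => r • x)) :=
    Measure.isProbabilityMeasure_map (by fun_prop)
  set g : Vec D → ℝ := fun y => ∫ z, f (y + z) ∂(multivariateGaussian (0 : Vec D) B) with hg
  have hgm : Measurable g := measurable_average _ hf
  have hev : evol Q t s f = fun y => ∫ x, g (y + r • x) ∂(stdGaussian (Vec D)) := by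
    funext y
    rw [evol, hconv, average_conv hf hM, integral_map (by fun_prop)]
    exact (hgm.comp (measurable_const_add y)).aestronglyMeasurable
  obtain ⟨-, hsm⟩ := (exists_heat_gradient_bound D).choose_spec
  obtain ⟨h1, h2⟩ := hsm g M r hgm (abs_average_le hM) hr0
  rw [hev]
  refine ⟨h1, fun y => (h2 y).trans (le_of_eq ?_)⟩
  rw [smoothConst, hr, Real.sqrt_mul hQ.pos.le, Real.rpow_neg hts'.le, ← Real.sqrt_eq_rpow]
  field_simp

lemma abs_partialDeriv_le_norm_fderiv (f : Vec D → ℝ) (d : Fin D) (y : Vec D) :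
    |partialDeriv d f y| ≤ ‖fderiv ℝ f y‖ := by
  refine ((fderiv ℝ f y).le_opNorm (EuclideanSpace.single d (1 : ℝ))).trans (le_of_eq ?_)
  simp

lemma abs_partialDeriv_evol_le (hQ : IsElliptic δ₁ δ₂ Q) {t s : ℝ} (hts : t < s) {f : Vec D → ℝ}
    (hf : Measurable f) {M : ℝ} (hM : ∀ y, |f y| ≤ M) (d : Fin D) (y : Vec D) :
    |partialDeriv d (evol Q t s f) y| ≤ smoothConst D δ₁ * M * (s - t) ^ (-(1 / 2) : ℝ) :=
  (abs_partialDeriv_le_norm_fderiv _ d y).trans ((evol_smoothing hQ hts hf hM).2 y)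

lemma partialDeriv_comp_add_right (f : Vec D → ℝ) (d : Fin D) (x y : Vec D) :
    partialDeriv d (fun y => f (y + x)) y = partialDeriv d f (y + x) := by
  rw [partialDeriv, fderiv_comp_add_right, partialDeriv]

lemma measurable_partialDeriv (f : Vec D → ℝ) (d : Fin D) : Measurable (partialDeriv d f) :=
  measurable_fderiv_apply_const ℝ f _

lemma evol_partialDeriv {t s : ℝ} {f : Vec D → ℝ} (hf : Differentiable ℝ f) {M M' : ℝ}
    (hM : ∀ y, |f y| ≤ M) (hM' : ∀ d y, |partialDeriv d f y| ≤ M') :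
    Differentiable ℝ (evol Q t s f) ∧
      ∀ d y, partialDeriv d (evol Q t s f) y = evol Q t s (partialDeriv d f) y := by
  have hfm : Measurable f := hf.continuous.measurable
  have key := fun y => hasFDerivAt_integral_of_partialDeriv
    (m := multivariateGaussian (0 : Vec D) (cov Q t s)) (h := fun x y => f (y + x))
    (fun y => (hfm.comp (measurable_const_add y)).aestronglyMeasurable)
    (integrable_shift hfm hM) (Eventually.of_forall fun x => hf.comp (differentiable_id.add_const x))
    (integrable_const M')
    (Eventually.of_forall fun x d y => by rw [partialDeriv_comp_add_right]; exact hM' d (y + x)) y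
  refine ⟨fun y => (key y).1, fun d y => ?_⟩
  have := (key y).2 d
  simp only [partialDeriv_comp_add_right] at this
  exact this

/-- Bounded Lipschitz functions. -/
structure BddLip (M L : ℝ) (f : Vec D → ℝ) : Prop where
  nonneg : 0 ≤ L
  bdd : ∀ y, |f y| ≤ M
  lip : ∀ x y, |f x - f y| ≤ L * ‖x - y‖

lemma BddLip.continuous {M L : ℝ} {f : Vec D → ℝ} (hf : BddLip M L f) : Continuous f := by
  refine (LipschitzWith.of_dist_le_mul (K := L.toNNReal) fun x y => ?_).continuous
  rw [Real.dist_eq, dist_eq_norm, Real.coe_toNNReal _ hf.nonneg]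
  exact hf.lip x y

lemma BddLip.measurable {M L : ℝ} {f : Vec D → ℝ} (hf : BddLip M L f) : Measurable f :=
  hf.continuous.measurable

lemma BddLip.evol {M L t s : ℝ} {f : Vec D → ℝ} (hf : BddLip M L f) : BddLip M L (evol Q t s f) :=
  ⟨hf.nonneg, abs_evol_le hf.bdd, abs_evol_sub_evol_le (ω := fun r => L * r) hf.measurable hf.bdd hf.lip⟩

lemma BddLip.abs_partialDeriv_le {M L : ℝ} {f : Vec D → ℝ} (hf : BddLip M L f) (d : Fin D)
    (y : Vec D) : |partialDeriv d f y| ≤ L := abs_partialDeriv_le_of_lipschitz hf.nonneg hf.lip d y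

lemma rpow_half_split {h : ℝ} (hh : 0 < h) : (h / 2) ^ (-(1 / 2) : ℝ) ≤ 2 * h ^ (-(1 / 2) : ℝ) := by
  rw [Real.div_rpow hh.le zero_le_two, div_eq_mul_inv, mul_comm, ← Real.rpow_neg zero_le_two, neg_neg]
  gcongr
  calc (2 : ℝ) ^ (1 / 2 : ℝ) ≤ 2 ^ (1 : ℝ) := Real.rpow_le_rpow_of_exponent_le one_le_two (by norm_num)
    _ = 2 := Real.rpow_one 2

/-- Derivatives taken on `[r,s]` are transported by `P_{t,r}`, so further smoothing or moment
estimates can be applied on `[t,r]`. -/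
lemma BddLip.evol_deriv_split (hQ : IsElliptic δ₁ δ₂ Q) {M L t r s : ℝ} {f : Vec D → ℝ}
    (hf : BddLip M L f) (htr : t ≤ r) (hrs : r < s) (d : Fin D) (y : Vec D) :
    partialDeriv d (RadnerTaylor.evol Q t s f) y
      = RadnerTaylor.evol Q t r (partialDeriv d (RadnerTaylor.evol Q r s f)) y := by
  have h2 := evol_partialDeriv (Q := Q) (t := t) (s := r) (evol_smoothing hQ hrs hf.measurable hf.bdd).1
    hf.evol.bdd hf.evol.abs_partialDeriv_le
  rw [← h2.2 d y]
  exact partialDeriv_congr (evol_comp hQ htr hrs.le hf.measurable hf.bdd) d y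

/-- Second derivatives of the evolution family on Lipschitz functions. -/
lemma BddLip.evol_deriv_two (hQ : IsElliptic δ₁ δ₂ Q) {M L t s : ℝ} {f : Vec D → ℝ}
    (hf : BddLip M L f) (hts : t < s) (d : Fin D) :
    Differentiable ℝ (partialDeriv d (RadnerTaylor.evol Q t s f)) ∧
      ∀ y, ‖fderiv ℝ (partialDeriv d (RadnerTaylor.evol Q t s f)) y‖
        ≤ 2 * smoothConst D δ₁ * L * (s - t) ^ (-(1 / 2) : ℝ) := by
  -- The midpoint: on `[r,s]` the first derivative stays bounded by `L`, and the other half of the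
  -- interval pays for one more derivative.
  set r := (t + s) / 2 with hr
  have hrt : r - t = (s - t) / 2 := by rw [hr]; ring
  have htr : t < r := by linarith
  have hrs : r < s := by rw [hr]; linarith
  have h := evol_smoothing hQ htr (measurable_partialDeriv (RadnerTaylor.evol Q r s f) d)
    (fun y => hf.evol.abs_partialDeriv_le d y)
  rw [show RadnerTaylor.evol Q t r (partialDeriv d (RadnerTaylor.evol Q r s f))
    = partialDeriv d (RadnerTaylor.evol Q t s f) from
    funext fun y => (hf.evol_deriv_split hQ htr.le hrs d y).symm] at h
  refine ⟨h.1, fun y => (h.2 y).trans ?_⟩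
  rw [hrt]
  have h3 := rpow_half_split (sub_pos.2 hts)
  have h4 : 0 ≤ smoothConst D δ₁ * L := mul_nonneg (smoothConst_pos hQ.pos).le hf.nonneg
  nlinarith

lemma BddLip.abs_evol_deriv_two_le (hQ : IsElliptic δ₁ δ₂ Q) {M L t s : ℝ} {f : Vec D → ℝ}
    (hf : BddLip M L f) (hts : t < s) (d e : Fin D) (y : Vec D) :
    |partialDeriv e (partialDeriv d (RadnerTaylor.evol Q t s f)) y|
        ≤ 2 * smoothConst D δ₁ * L * (s - t) ^ (-(1 / 2) : ℝ) :=
  (abs_partialDeriv_le_norm_fderiv _ e y).trans ((hf.evol_deriv_two hQ hts d).2 y)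

lemma BddLip.abs_evol_deriv_one_sub_le (hQ : IsElliptic δ₁ δ₂ Q) {M L t s : ℝ} {f : Vec D → ℝ}
    (hf : BddLip M L f) (hts : t < s) (d : Fin D) (x y : Vec D) :
    |partialDeriv d (RadnerTaylor.evol Q t s f) x - partialDeriv d (RadnerTaylor.evol Q t s f) y|
        ≤ 2 * smoothConst D δ₁ * L * (s - t) ^ (-(1 / 2) : ℝ) * ‖x - y‖ := by
  simpa using convex_univ.norm_image_sub_le_of_norm_fderiv_le (𝕜 := ℝ)
    (f := partialDeriv d (RadnerTaylor.evol Q t s f)) (x := y) (y := x)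
    (fun z _ => (hf.evol_deriv_two hQ hts d).1 z) (fun z _ => (hf.evol_deriv_two hQ hts d).2 z)
    (mem_univ _) (mem_univ _)

lemma BddLip.evol_deriv_two_split (hQ : IsElliptic δ₁ δ₂ Q) {M L t r s : ℝ} {f : Vec D → ℝ}
    (hf : BddLip M L f) (htr : t ≤ r) (hrs : r < s) (d e : Fin D) (y : Vec D) :
    partialDeriv e (partialDeriv d (RadnerTaylor.evol Q t s f)) y = RadnerTaylor.evol Q t r
      (partialDeriv e (partialDeriv d (RadnerTaylor.evol Q r s f))) y := by
  have h2 := evol_partialDeriv (Q := Q) (t := t) (s := r) (hf.evol_deriv_two hQ hrs d).1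
    (fun y => hf.evol.abs_partialDeriv_le d y) (hf.abs_evol_deriv_two_le hQ hrs d)
  rw [← h2.2 e y]
  exact partialDeriv_congr (hf.evol_deriv_split hQ htr hrs d) e y

/-- The constant in the Lipschitz estimate of second derivatives of the evolution family. -/
def smoothConst₃ (D : ℕ) (δ₁ : ℝ) : ℝ := 8 * smoothConst D δ₁ ^ 2

/-- A further halving of the interval, now applied to the second derivatives. The constant is `8 = 2
· 2 · 2`: one factor from the second derivative bound and two from replacing `((s-t)/2)^(-1/2)` by
`2 (s-t)^(-1/2)`. -/
lemma BddLip.abs_evol_deriv_two_sub_le (hQ : IsElliptic δ₁ δ₂ Q) {M L t s : ℝ} {f : Vec D → ℝ}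
    (hf : BddLip M L f) (hts : t < s) (d e : Fin D) (x y : Vec D) :
    |partialDeriv e (partialDeriv d (RadnerTaylor.evol Q t s f)) x
      - partialDeriv e (partialDeriv d (RadnerTaylor.evol Q t s f)) y|
        ≤ smoothConst₃ D δ₁ * L * (s - t)⁻¹ * ‖x - y‖ := by
  set r := (t + s) / 2 with hr
  have hrt : r - t = (s - t) / 2 := by rw [hr]; ring
  have hsr : s - r = (s - t) / 2 := by rw [hr]; ring
  have htr : t < r := by linarith
  have hrs : r < s := by rw [hr]; linarith
  have h := evol_smoothing hQ htr (measurable_partialDeriv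
    (partialDeriv d (RadnerTaylor.evol Q r s f)) e) (hf.abs_evol_deriv_two_le hQ hrs d e)
  rw [show RadnerTaylor.evol Q t r (partialDeriv e (partialDeriv d (RadnerTaylor.evol Q r s f)))
    = partialDeriv e (partialDeriv d (RadnerTaylor.evol Q t s f)) from
    funext fun y => (hf.evol_deriv_two_split hQ htr.le hrs d e y).symm] at h
  have key := convex_univ.norm_image_sub_le_of_norm_fderiv_le (𝕜 := ℝ)
    (f := partialDeriv e (partialDeriv d (RadnerTaylor.evol Q t s f))) (x := y) (y := x)
    (fun z _ => h.1 z) (fun z _ => h.2 z) (mem_univ _) (mem_univ _)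
  refine (show _ ≤ _ from key).trans (mul_le_mul_of_nonneg_right ?_ (norm_nonneg _))
  rw [hrt, hsr, smoothConst₃]
  have h3 := rpow_half_split (sub_pos.2 hts)
  have h4 : 0 ≤ smoothConst D δ₁ ^ 2 * L := mul_nonneg (sq_nonneg _) hf.nonneg
  have h5 : (s - t) ^ (-(1 / 2) : ℝ) * (s - t) ^ (-(1 / 2) : ℝ) = (s - t)⁻¹ := by
    rw [← Real.rpow_add (sub_pos.2 hts), ← Real.rpow_neg_one]; norm_num
  have h6 : 0 ≤ ((s - t) / 2) ^ (-(1 / 2) : ℝ) :=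
    Real.rpow_nonneg (by linarith [sub_pos.2 hts]) _
  calc smoothConst D δ₁ * (2 * smoothConst D δ₁ * L * ((s - t) / 2) ^ (-(1 / 2) : ℝ))
        * ((s - t) / 2) ^ (-(1 / 2) : ℝ)
      = 2 * (smoothConst D δ₁ ^ 2 * L) *
        (((s - t) / 2) ^ (-(1 / 2) : ℝ) * ((s - t) / 2) ^ (-(1 / 2) : ℝ)) := by ring
    _ ≤ 2 * (smoothConst D δ₁ ^ 2 * L) *
        ((2 * (s - t) ^ (-(1 / 2) : ℝ)) * (2 * (s - t) ^ (-(1 / 2) : ℝ))) := by gcongr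
    _ = 8 * smoothConst D δ₁ ^ 2 * L * (s - t)⁻¹ := by rw [← h5]; ring

/-- The constant in the Hölder estimate of second derivatives of the evolution family. -/
def holderConst (D : ℕ) (δ₁ α : ℝ) : ℝ :=
  (4 * smoothConst D δ₁) ^ (1 - α) * smoothConst₃ D δ₁ ^ α

lemma holderConst_nonneg {δ₁ : ℝ} (h : 0 < δ₁) (α : ℝ) : 0 ≤ holderConst D δ₁ α := by
  have := smoothConst_pos (D := D) h
  unfold holderConst smoothConst₃
  positivity

/-- Interpolation between the sup bound, singular of order `1/2`, and the Lipschitz bound, singular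
of order `1`. The resulting order `(1+α)/2` is less than `1`, hence integrable in `s`; the Lipschitz
bound alone is not. -/
lemma BddLip.abs_evol_deriv_two_sub_le_holder (hQ : IsElliptic δ₁ δ₂ Q) {α : ℝ}
    (hα : α ∈ Ioo (0 : ℝ) 1) {M L t s : ℝ} {f : Vec D → ℝ} (hf : BddLip M L f) (hts : t < s)
    (d e : Fin D) (x y : Vec D) :
    |partialDeriv e (partialDeriv d (RadnerTaylor.evol Q t s f)) x
      - partialDeriv e (partialDeriv d (RadnerTaylor.evol Q t s f)) y|
        ≤ holderConst D δ₁ α * L * (s - t) ^ (-((1 + α) / 2)) * ‖x - y‖ ^ α := by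
  have hh := sub_pos.2 hts
  have hc := smoothConst_pos (D := D) hQ.pos
  have hL := hf.nonneg
  have h1 := hf.abs_evol_deriv_two_sub_le hQ hts d e x y
  have h2 : |partialDeriv e (partialDeriv d (RadnerTaylor.evol Q t s f)) x
      - partialDeriv e (partialDeriv d (RadnerTaylor.evol Q t s f)) y|
      ≤ 4 * smoothConst D δ₁ * (L * (s - t) ^ (-(1 / 2) : ℝ)) := by
    refine (abs_sub _ _).trans ?_
    have := hf.abs_evol_deriv_two_le hQ hts d e x
    have := hf.abs_evol_deriv_two_le hQ hts d e y
    linarith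
  have h3 := holder_of_bounded_of_lipschitz hα.1 hα.2 (abs_nonneg _) (norm_nonneg (x - y))
    (by positivity) (by unfold smoothConst₃; positivity) h2 h1
  refine h3.trans (le_of_eq ?_)
  congr 1
  have h8 : 0 ≤ smoothConst₃ D δ₁ := by unfold smoothConst₃; positivity
  rw [Real.mul_rpow (by positivity) (by positivity), mul_assoc (smoothConst₃ D δ₁),
    Real.mul_rpow h8 (by positivity), Real.mul_rpow hL (by positivity),
    Real.mul_rpow hL (by positivity), ← Real.rpow_neg_one, ← Real.rpow_mul hh.le,
    ← Real.rpow_mul hh.le, holderConst]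
  have h6 : L ^ (1 - α) * L ^ α = L := by
    rw [← Real.rpow_add_of_nonneg hL (by linarith [hα.2]) hα.1.le]; simp
  have h7 : (s - t) ^ (-(1 / 2) * (1 - α)) * (s - t) ^ (-1 * α) = (s - t) ^ (-((1 + α) / 2)) := by
    rw [← Real.rpow_add hh]; congr 1; ring
  rw [← h7]
  linear_combination ((4 * smoothConst D δ₁) ^ (1 - α) * smoothConst₃ D δ₁ ^ α
    * ((s - t) ^ (-(1 / 2) * (1 - α)) * (s - t) ^ (-1 * α))) * h6

/-- Small time expansion of the evolution family. -/
lemma evol_taylor (hQ : IsElliptic δ₁ δ₂ Q) {t s : ℝ} (hts : t ≤ s) {f : Vec D → ℝ}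
    (hf : Differentiable ℝ f) (hf2 : ∀ d, Differentiable ℝ (partialDeriv d f)) {M K α : ℝ}
    (hM : ∀ y, |f y| ≤ M) (hα : 0 < α) (hK : 0 ≤ K)
    (h : ∀ d e x y, |partialDeriv e (partialDeriv d f) x - partialDeriv e (partialDeriv d f) y|
      ≤ K * ‖x - y‖ ^ α) (y : Vec D) :
    |evol Q t s f y - f y - 1 / 2 * ∑ d, ∑ e, cov Q t s d e * partialDeriv e (partialDeriv d f) y|
      ≤ D * D * momentConst D δ₂ (2 + α) * K * (s - t) ^ (1 + α / 2) := by
  set ν := multivariateGaussian (0 : Vec D) (cov Q t s) with hν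
  have hA := cov_posSemidef hQ hts
  have i1 : Integrable (fun x => f (y + x)) ν := integrable_shift hf.continuous.measurable hM y
  have i2 : Integrable (fun x => f (y + x) - f y) ν := i1.sub (integrable_const _)
  have i3 : Integrable (fun x : Vec D => ∑ d, x d * partialDeriv d f y) ν :=
    integrable_finsetSum _ fun d _ => (integrable_coord_gaussian ν d).mul_const _
  have i4 : ∀ d, Integrable (fun x : Vec D =>
      ∑ e, x d * x e * partialDeriv e (partialDeriv d f) y) ν := fun d =>
    integrable_finsetSum _ fun e _ => (integrable_coord_mul_gaussian ν d e).mul_const _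
  have i5 : Integrable (fun x : Vec D => 1 / 2 * ∑ d, ∑ e, x d * x e *
      partialDeriv e (partialDeriv d f) y) ν :=
    (integrable_finsetSum _ fun d _ => i4 d).const_mul _
  -- The Gaussian is centred with covariance `cov Q t s`, so the left side is exactly the mean of
  -- the second order Taylor remainder.
  have h1 : evol Q t s f y - f y
      - 1 / 2 * ∑ d, ∑ e, cov Q t s d e * partialDeriv e (partialDeriv d f) y
      = ∫ x, (f (y + x) - f y - ∑ d, x d * partialDeriv d f y
        - 1 / 2 * ∑ d, ∑ e, x d * x e * partialDeriv e (partialDeriv d f) y) ∂ν := by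
    have i6 : Integrable (fun x => f (y + x) - f y - ∑ d, x d * partialDeriv d f y) ν := i2.sub i3
    rw [integral_sub i6 i5, integral_sub i2 i3, integral_sub i1 (integrable_const _),
      integral_finsetSum _ fun d _ => (integrable_coord_gaussian ν d).mul_const _,
      integral_const_mul, integral_finsetSum _ fun d _ => i4 d]
    have h2 : ∀ d, ∫ x : Vec D, ∑ e, x d * x e * partialDeriv e (partialDeriv d f) y ∂ν
        = ∑ e, cov Q t s d e * partialDeriv e (partialDeriv d f) y := fun d => by
      rw [integral_finsetSum _ fun e _ => (integrable_coord_mul_gaussian ν d e).mul_const _]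
      simp_rw [integral_mul_const, hν, integral_coord_mul_multivariateGaussian hA]
    simp_rw [h2, integral_mul_const, hν, integral_coord_multivariateGaussian]
    simp [evol]
  rw [h1]
  have h3 := norm_integral_le_of_norm_le
    (f := fun x => f (y + x) - f y - ∑ d, x d * partialDeriv d f y
        - 1 / 2 * ∑ d, ∑ e, x d * x e * partialDeriv e (partialDeriv d f) y)
    ((integrable_norm_rpow_gaussian ν (p := 2 + α) (by linarith)).const_mul (D * D * K))
    (Eventually.of_forall fun x => taylor_two hf hf2 hα hK h y x)
  rw [integral_const_mul] at h3
  refine (show _ ≤ _ from h3).trans ?_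
  have h4 := integral_norm_rpow_cov_le hQ hts (p := 2 + α) (by linarith)
  rw [show (2 + α) / 2 = 1 + α / 2 by ring] at h4
  calc D * D * K * ∫ x, ‖x‖ ^ (2 + α) ∂ν
      ≤ D * D * K * (momentConst D δ₂ (2 + α) * (s - t) ^ (1 + α / 2)) := by gcongr
    _ = _ := by ring

end Evolution

/-! ### Potentials `∫_t^T P_{t,s} f_s ds` -/

section Potential

variable {D : ℕ} {δ₁ δ₂ : ℝ} {Q : ℝ → Matrix (Fin D) (Fin D) ℝ}

lemma integrableOn_sub_rpow {p : ℝ} (hp : -1 < p) (t T : ℝ) :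
    IntegrableOn (fun s => (s - t) ^ p) (Ioc t T) := by
  rcases le_total t T with h | h
  · rw [← intervalIntegrable_iff_integrableOn_Ioc_of_le h]
    have := (intervalIntegral.intervalIntegrable_rpow' (a := 0) (b := T - t) hp).comp_sub_right t
    simpa using this
  · simp [Ioc_eq_empty_of_le h]

lemma integral_sub_rpow {p : ℝ} (hp : -1 < p) {t T : ℝ} (h : t ≤ T) :
    ∫ s in Ioc t T, (s - t) ^ p = (T - t) ^ (p + 1) / (p + 1) := by
  rw [← intervalIntegral.integral_of_le h,
    intervalIntegral.integral_comp_sub_right (fun s => s ^ p) t, integral_rpow (Or.inl hp),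
    sub_self, Real.zero_rpow (by linarith), sub_zero]

lemma integral_sub_rpow_neg_half {t T : ℝ} (h : t ≤ T) :
    ∫ s in Ioc t T, (s - t) ^ (-(1 / 2) : ℝ) = 2 * (T - t) ^ (1 / 2 : ℝ) := by
  rw [integral_sub_rpow (by norm_num) h]
  norm_num
  ring

lemma abs_setIntegral_le {G b : ℝ → ℝ} {t T : ℝ} (hb : IntegrableOn b (Ioc t T))
    (h : ∀ s ∈ Ioc t T, |G s| ≤ b s) : |∫ s in Ioc t T, G s| ≤ ∫ s in Ioc t T, b s := by
  have := norm_integral_le_of_norm_le (f := G) hb ((ae_restrict_mem measurableSet_Ioc).mono h)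
  exact this

lemma BddLip.abs_evol_sub_evol_time (hQ : IsElliptic δ₁ δ₂ Q) {M L t s s' : ℝ} {f : Vec D → ℝ}
    (hf : BddLip M L f) (hts : t ≤ s) (hts' : t ≤ s') (y : Vec D) :
    |RadnerTaylor.evol Q t s' f y - RadnerTaylor.evol Q t s f y|
      ≤ L * momentConst D δ₂ 1 * |s' - s| ^ (1 / 2 : ℝ) := by
  wlog h : s ≤ s' generalizing s s'
  · rw [abs_sub_comm, abs_sub_comm s' s]; exact this hts' hts (le_of_not_ge h)
  rw [evol_comp hQ hts h hf.measurable hf.bdd, abs_of_nonneg (sub_nonneg.2 h)]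
  refine abs_evol_sub_le (evol_measurable hf.measurable) hf.measurable (abs_evol_le hf.bdd) hf.bdd
    (fun y => ?_) y
  exact abs_evol_sub_self_le hQ h hf.measurable hf.bdd hf.nonneg zero_le_one
    (by simpa using hf.lip) y

/-- Bounded, Lipschitz in space and continuous in time source terms. -/
structure IsSource (M L : ℝ) (f : ℝ → Vec D → ℝ) : Prop where
  bddLip : ∀ s, BddLip M L (f s)
  continuous_time : ∀ y, Continuous fun s => f s y

variable {M L : ℝ} {f : ℝ → Vec D → ℝ}

lemma IsSource.nonneg (hf : IsSource M L f) : 0 ≤ L := (hf.bddLip 0).nonneg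

lemma IsSource.bound_nonneg (hf : IsSource M L f) : 0 ≤ M :=
  (abs_nonneg _).trans ((hf.bddLip 0).bdd 0)

/-- Two changes are separated: varying the covariance costs `|s - s₀|^(1/2)` uniformly over the
Lipschitz class, and with frozen covariance dominated convergence applies. The result provides
measurability in `s`. -/
lemma IsSource.continuousOn_evol (hQ : IsElliptic δ₁ δ₂ Q) (hf : IsSource M L f) (t : ℝ)
    (y : Vec D) : ContinuousOn (fun s => evol Q t s (f s) y) (Ici t) := by
  intro s₀ hs₀
  have h1 : Tendsto (fun s => L * momentConst D δ₂ 1 * |s - s₀| ^ (1 / 2 : ℝ)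
      + |evol Q t s₀ (f s) y - evol Q t s₀ (f s₀) y|) (𝓝[Ici t] s₀) (𝓝 0) := by
    have h2 : Tendsto (fun s => L * momentConst D δ₂ 1 * |s - s₀| ^ (1 / 2 : ℝ)) (𝓝 s₀) (𝓝 0) := by
      have : Continuous fun s : ℝ => L * momentConst D δ₂ 1 * |s - s₀| ^ (1 / 2 : ℝ) := by
        have : Continuous fun s : ℝ => |s - s₀| ^ (1 / 2 : ℝ) :=
          (continuous_id.sub continuous_const).abs.rpow_const fun _ => Or.inr (by norm_num)
        exact continuous_const.mul this
      simpa using this.tendsto s₀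
    have h3 : Tendsto (fun s => evol Q t s₀ (f s) y) (𝓝 s₀) (𝓝 (evol Q t s₀ (f s₀) y)) := by
      refine tendsto_integral_filter_of_dominated_convergence (fun _ => M)
        (Eventually.of_forall fun s => ?_) (Eventually.of_forall fun s =>
          Eventually.of_forall fun x => (hf.bddLip s).bdd _) (integrable_const _)
        (Eventually.of_forall fun x => (hf.continuous_time (y + x)).tendsto s₀)
      exact ((hf.bddLip s).measurable.comp (measurable_const_add y)).aestronglyMeasurable
    have h4 := (h3.sub_const (evol Q t s₀ (f s₀) y)).abs
    rw [sub_self, abs_zero] at h4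
    simpa using (h2.add h4).mono_left nhdsWithin_le_nhds
  refine tendsto_iff_dist_tendsto_zero.2 (squeeze_zero' (Eventually.of_forall fun _ => dist_nonneg)
    ?_ h1)
  filter_upwards [self_mem_nhdsWithin] with s hs
  rw [Real.dist_eq]
  refine (abs_sub_le _ (evol Q t s₀ (f s) y) _).trans (add_le_add_left ?_ _)
  exact (hf.bddLip s).abs_evol_sub_evol_time hQ hs₀ hs y

lemma IsSource.aesm_evol (hQ : IsElliptic δ₁ δ₂ Q) (hf : IsSource M L f) (t T : ℝ) (y : Vec D) :
    AEStronglyMeasurable (fun s => evol Q t s (f s) y) (volume.restrict (Ioc t T)) :=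
  ((hf.continuousOn_evol hQ t y).mono fun _ hs => hs.1.le).aestronglyMeasurable measurableSet_Ioc

lemma IsSource.ae_differentiable (hQ : IsElliptic δ₁ δ₂ Q) (hf : IsSource M L f) (t T : ℝ) :
    ∀ᵐ s ∂(volume.restrict (Ioc t T)), Differentiable ℝ (evol Q t s (f s)) :=
  (ae_restrict_mem measurableSet_Ioc).mono fun s hs =>
    (evol_smoothing hQ hs.1 (hf.bddLip s).measurable (hf.bddLip s).bdd).1

lemma IsSource.aesm_evol_one (hQ : IsElliptic δ₁ δ₂ Q) (hf : IsSource M L f) (t T : ℝ) (d : Fin D)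
    (y : Vec D) : AEStronglyMeasurable (fun s => partialDeriv d (evol Q t s (f s)) y)
      (volume.restrict (Ioc t T)) :=
  aestronglyMeasurable_partialDeriv (hf.aesm_evol hQ t T) (hf.ae_differentiable hQ t T) d y

lemma IsSource.ae_differentiable_one (hQ : IsElliptic δ₁ δ₂ Q) (hf : IsSource M L f) (t T : ℝ)
    (d : Fin D) : ∀ᵐ s ∂(volume.restrict (Ioc t T)),
      Differentiable ℝ (partialDeriv d (evol Q t s (f s))) :=
  (ae_restrict_mem measurableSet_Ioc).mono fun s hs => ((hf.bddLip s).evol_deriv_two hQ hs.1 d).1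

lemma IsSource.integrable_evol (hQ : IsElliptic δ₁ δ₂ Q) (hf : IsSource M L f) (t T : ℝ)
    (y : Vec D) : IntegrableOn (fun s => evol Q t s (f s) y) (Ioc t T) :=
  Integrable.of_bound (hf.aesm_evol hQ t T y) M
    (Eventually.of_forall fun s => abs_evol_le (hf.bddLip s).bdd y)

lemma IsSource.integrable_evol_one (hQ : IsElliptic δ₁ δ₂ Q) (hf : IsSource M L f) (t T : ℝ)
    (d : Fin D) (y : Vec D) :
    IntegrableOn (fun s => partialDeriv d (evol Q t s (f s)) y) (Ioc t T) :=
  Integrable.of_bound (hf.aesm_evol_one hQ t T d y) L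
    (Eventually.of_forall fun s => (hf.bddLip s).evol.abs_partialDeriv_le d y)

lemma IsSource.integrable_evol_two (hQ : IsElliptic δ₁ δ₂ Q) (hf : IsSource M L f) (t T : ℝ)
    (d e : Fin D) (y : Vec D) :
    IntegrableOn (fun s => partialDeriv e (partialDeriv d (evol Q t s (f s))) y) (Ioc t T) :=
  ((integrableOn_sub_rpow (by norm_num : (-1 : ℝ) < -(1 / 2)) t T).const_mul
    (2 * smoothConst D δ₁ * L)).mono'
    (aestronglyMeasurable_partialDeriv (hf.aesm_evol_one hQ t T d)
      (hf.ae_differentiable_one hQ t T d) e y)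
    ((ae_restrict_mem measurableSet_Ioc).mono fun s hs =>
      (hf.bddLip s).abs_evol_deriv_two_le hQ hs.1 d e y)

/-- The potential `∫_t^T P_{t,s} f_s ds`. -/
def pot (Q : ℝ → Matrix (Fin D) (Fin D) ℝ) (T : ℝ) (f : ℝ → Vec D → ℝ) (t : ℝ) (y : Vec D) : ℝ :=
  ∫ s in Ioc t T, evol Q t s (f s) y

lemma IsSource.pot_deriv (hQ : IsElliptic δ₁ δ₂ Q) (hf : IsSource M L f) (t T : ℝ) :
    Differentiable ℝ (pot Q T f t) ∧ ∀ d y, partialDeriv d (pot Q T f t) y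
      = ∫ s in Ioc t T, partialDeriv d (evol Q t s (f s)) y := by
  have key := fun y => hasFDerivAt_integral_of_partialDeriv (hf.aesm_evol hQ t T)
    (hf.integrable_evol hQ t T) (hf.ae_differentiable hQ t T) (b := fun _ => L)
    (integrable_const _) (Eventually.of_forall fun s d y =>
      (hf.bddLip s).evol.abs_partialDeriv_le d y) y
  exact ⟨fun y => (key y).1, fun d y => (key y).2 d⟩

/-- One derivative is absorbed by the Lipschitz bound on the source; the second costs
`(s-t)^(-1/2)`, which is an integrable majorant. -/
lemma IsSource.pot_deriv_two (hQ : IsElliptic δ₁ δ₂ Q) (hf : IsSource M L f) (t T : ℝ)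
    (d : Fin D) : Differentiable ℝ (partialDeriv d (pot Q T f t)) ∧
      ∀ e y, partialDeriv e (partialDeriv d (pot Q T f t)) y
      = ∫ s in Ioc t T, partialDeriv e (partialDeriv d (evol Q t s (f s))) y := by
  have key := fun y => hasFDerivAt_integral_of_partialDeriv (hf.aesm_evol_one hQ t T d)
    (hf.integrable_evol_one hQ t T d) (hf.ae_differentiable_one hQ t T d)
    (b := fun s => 2 * smoothConst D δ₁ * L * (s - t) ^ (-(1 / 2) : ℝ))
    ((integrableOn_sub_rpow (by norm_num) t T).const_mul _)
    ((ae_restrict_mem measurableSet_Ioc).mono fun s hs e y =>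
      (hf.bddLip s).abs_evol_deriv_two_le hQ hs.1 d e y) y
  rw [show partialDeriv d (pot Q T f t) = fun y => ∫ s in Ioc t T,
    partialDeriv d (evol Q t s (f s)) y from funext ((hf.pot_deriv hQ t T).2 d)]
  exact ⟨fun y => (key y).1, fun d y => (key y).2 d⟩

/-! ### Size and space-time regularity of potentials -/

section Bounds

variable {t T : ℝ}

lemma IsSource.abs_pot_le (hf : IsSource M L f) (h : t ≤ T) (y : Vec D) :
    |pot Q T f t y| ≤ M * (T - t) := by
  have := abs_setIntegral_le (G := fun s => evol Q t s (f s) y) (b := fun _ => M) (t := t) (T := T)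
    (integrable_const _) fun s _ => abs_evol_le (hf.bddLip s).bdd y
  simpa [h, mul_comm, pot] using this

/-- No smoothing is spent here, since `P_{t,s}` preserves Lipschitz constants. The resulting rate `T
- t` is what makes the nonlinear part negligible in the final comparison; the smoothing estimate
would only give its square root. -/
lemma IsSource.abs_pot_one_le (hQ : IsElliptic δ₁ δ₂ Q) (hf : IsSource M L f) (h : t ≤ T)
    (d : Fin D) (y : Vec D) : |partialDeriv d (pot Q T f t) y| ≤ L * (T - t) := by
  rw [(hf.pot_deriv hQ t T).2]
  have := abs_setIntegral_le (G := fun s => partialDeriv d (evol Q t s (f s)) y) (b := fun _ => L)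
    (t := t) (T := T) (integrable_const _) fun s _ => (hf.bddLip s).evol.abs_partialDeriv_le d y
  simpa [h, mul_comm] using this

/-- Only the sup norm of the source enters; this lets the gradient map preserve a ball independently
of the Lipschitz constant of its argument. -/
lemma IsSource.abs_pot_one_le_smooth (hQ : IsElliptic δ₁ δ₂ Q) (hf : IsSource M L f) (h : t ≤ T)
    (d : Fin D) (y : Vec D) :
    |partialDeriv d (pot Q T f t) y| ≤ 2 * smoothConst D δ₁ * M * (T - t) ^ (1 / 2 : ℝ) := by
  rw [(hf.pot_deriv hQ t T).2]
  have := abs_setIntegral_le (G := fun s => partialDeriv d (evol Q t s (f s)) y)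
    ((integrableOn_sub_rpow (by norm_num : (-1 : ℝ) < -(1 / 2)) t T).const_mul _) fun s hs =>
      abs_partialDeriv_evol_le hQ hs.1 (hf.bddLip s).measurable (hf.bddLip s).bdd d y
  rw [integral_const_mul, integral_sub_rpow_neg_half h] at this
  linarith

lemma IsSource.abs_pot_one_sub_le (hQ : IsElliptic δ₁ δ₂ Q) (hf : IsSource M L f) (h : t ≤ T)
    (d : Fin D) (x y : Vec D) :
    |partialDeriv d (pot Q T f t) x - partialDeriv d (pot Q T f t) y|
      ≤ 4 * smoothConst D δ₁ * L * (T - t) ^ (1 / 2 : ℝ) * ‖x - y‖ := by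
  rw [(hf.pot_deriv hQ t T).2, (hf.pot_deriv hQ t T).2,
    ← integral_sub (hf.integrable_evol_one hQ t T d x) (hf.integrable_evol_one hQ t T d y)]
  have := abs_setIntegral_le (G := fun s => partialDeriv d (evol Q t s (f s)) x
      - partialDeriv d (evol Q t s (f s)) y)
    (((integrableOn_sub_rpow (by norm_num : (-1 : ℝ) < -(1 / 2)) t T).const_mul _).mul_const _)
    fun s hs => (hf.bddLip s).abs_evol_deriv_one_sub_le hQ hs.1 d x y
  rw [integral_mul_const, integral_const_mul, integral_sub_rpow_neg_half h] at this
  linarith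

lemma IsSource.abs_pot_two_le (hQ : IsElliptic δ₁ δ₂ Q) (hf : IsSource M L f) (h : t ≤ T)
    (d e : Fin D) (y : Vec D) : |partialDeriv e (partialDeriv d (pot Q T f t)) y|
      ≤ 4 * smoothConst D δ₁ * L * (T - t) ^ (1 / 2 : ℝ) := by
  rw [(hf.pot_deriv_two hQ t T d).2]
  have := abs_setIntegral_le (G := fun s => partialDeriv e (partialDeriv d (evol Q t s (f s))) y)
    ((integrableOn_sub_rpow (by norm_num : (-1 : ℝ) < -(1 / 2)) t T).const_mul _) fun s hs =>
      (hf.bddLip s).abs_evol_deriv_two_le hQ hs.1 d e y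
  rw [integral_const_mul, integral_sub_rpow_neg_half h] at this
  linarith

variable {α : ℝ}

lemma integral_sub_rpow_holder (hα : α ∈ Ioo (0 : ℝ) 1) (h : t ≤ T) :
    ∫ s in Ioc t T, (s - t) ^ (-((1 + α) / 2)) = (T - t) ^ ((1 - α) / 2) / ((1 - α) / 2) := by
  rw [integral_sub_rpow (by linarith [hα.2]) h]
  congr 1 <;> [congr 1; skip] <;> ring

lemma IsSource.abs_pot_two_sub_le (hQ : IsElliptic δ₁ δ₂ Q) (hα : α ∈ Ioo (0 : ℝ) 1)
    (hf : IsSource M L f) (h : t ≤ T) (d e : Fin D) (x y : Vec D) :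
    |partialDeriv e (partialDeriv d (pot Q T f t)) x - partialDeriv e (partialDeriv d (pot Q T f t)) y|
      ≤ holderConst D δ₁ α * L * ((T - t) ^ ((1 - α) / 2) / ((1 - α) / 2)) * ‖x - y‖ ^ α := by
  rw [(hf.pot_deriv_two hQ t T d).2, (hf.pot_deriv_two hQ t T d).2,
    ← integral_sub (hf.integrable_evol_two hQ t T d e x) (hf.integrable_evol_two hQ t T d e y)]
  have := abs_setIntegral_le (G := fun s => partialDeriv e (partialDeriv d (evol Q t s (f s))) x
      - partialDeriv e (partialDeriv d (evol Q t s (f s))) y)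
    (((integrableOn_sub_rpow (by linarith [hα.2] : (-1 : ℝ) < -((1 + α) / 2)) t T).const_mul
      _).mul_const _)
    fun s hs => (hf.bddLip s).abs_evol_deriv_two_sub_le_holder hQ hα hs.1 d e x y
  rwa [integral_mul_const, integral_const_mul, integral_sub_rpow_holder hα h] at this

/-- Comparison of the gradients of two potentials. -/
lemma IsSource.abs_pot_one_sub_pot_one_le (hQ : IsElliptic δ₁ δ₂ Q) (hf : IsSource M L f)
    {M' L' : ℝ} {f' : ℝ → Vec D → ℝ} (hf' : IsSource M' L' f') {ε : ℝ → ℝ}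
    (hε : ∀ s ∈ Ioc t T, ∀ y, |f s y - f' s y| ≤ ε s)
    (hi : IntegrableOn (fun s => smoothConst D δ₁ * ε s * (s - t) ^ (-(1 / 2) : ℝ)) (Ioc t T))
    (d : Fin D) (y : Vec D) :
    |partialDeriv d (pot Q T f t) y - partialDeriv d (pot Q T f' t) y|
      ≤ ∫ s in Ioc t T, smoothConst D δ₁ * ε s * (s - t) ^ (-(1 / 2) : ℝ) := by
  rw [(hf.pot_deriv hQ t T).2, (hf'.pot_deriv hQ t T).2,
    ← integral_sub (hf.integrable_evol_one hQ t T d y) (hf'.integrable_evol_one hQ t T d y)]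
  refine abs_setIntegral_le hi fun s hs => ?_
  have h1 := hf.bddLip s
  have h2 := hf'.bddLip s
  rw [← partialDeriv_sub ((evol_smoothing hQ hs.1 h1.measurable h1.bdd).1 y)
    ((evol_smoothing hQ hs.1 h2.measurable h2.bdd).1 y),
    ← partialDeriv_congr (evol_sub h1.measurable h2.measurable h1.bdd h2.bdd)]
  exact abs_partialDeriv_evol_le hQ hs.1 (h1.measurable.sub h2.measurable) (hε s hs) d y

lemma setIntegral_Ioc_split {G : ℝ → ℝ} {t t' T : ℝ} (h1 : t ≤ t') (h2 : t' ≤ T)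
    (hG : IntegrableOn G (Ioc t T)) :
    ∫ s in Ioc t T, G s = (∫ s in Ioc t t', G s) + ∫ s in Ioc t' T, G s := by
  rw [← Ioc_union_Ioc_eq_Ioc h1 h2, setIntegral_union (Ioc_disjoint_Ioc_of_le le_rfl)
    measurableSet_Ioc (hG.mono_set (Ioc_subset_Ioc_right h2))
    (hG.mono_set (Ioc_subset_Ioc_left h1))]

/-- The integral is split at `t'`. The short piece is bounded by smoothing; on the rest `P_{t,s} =
P_{t,t'} P_{t',s}`, and the Lipschitz bound for the gradient of `P_{t',s} f_s` is turned into time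
regularity by the displacement estimate. -/
lemma IsSource.abs_pot_one_time (hQ : IsElliptic δ₁ δ₂ Q) (hf : IsSource M L f) {t' : ℝ}
    (h1 : t ≤ t') (h2 : t' ≤ T) (d : Fin D) (y : Vec D) :
    |partialDeriv d (pot Q T f t) y - partialDeriv d (pot Q T f t') y|
      ≤ (2 * smoothConst D δ₁ * M
        + 4 * smoothConst D δ₁ * L * momentConst D δ₂ 1 * (T - t') ^ (1 / 2 : ℝ))
        * (t' - t) ^ (1 / 2 : ℝ) := by
  have hi := hf.integrable_evol_one hQ t T d y
  rw [(hf.pot_deriv hQ t T).2, (hf.pot_deriv hQ t' T).2, setIntegral_Ioc_split h1 h2 hi,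
    add_sub_assoc, ← integral_sub (hi.mono_set (Ioc_subset_Ioc_left h1))
    (hf.integrable_evol_one hQ t' T d y)]
  have h3 := hf.abs_pot_one_le_smooth hQ h1 d y
  rw [(hf.pot_deriv hQ t t').2] at h3
  have h4 := abs_setIntegral_le (t := t') (T := T) (G := fun s => partialDeriv d (evol Q t s (f s)) y
      - partialDeriv d (evol Q t' s (f s)) y)
    ((((integrableOn_sub_rpow (by norm_num : (-1 : ℝ) < -(1 / 2)) t' T).const_mul
      (2 * smoothConst D δ₁ * L)).mul_const (momentConst D δ₂ 1)).mul_const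
      ((t' - t) ^ (1 / 2 : ℝ)))
    fun s hs => by
      rw [(hf.bddLip s).evol_deriv_split hQ h1 hs.1]
      refine abs_evol_sub_self_le hQ h1 (measurable_partialDeriv _ d)
        (fun y => (hf.bddLip s).evol.abs_partialDeriv_le d y) ?_ zero_le_one (fun x z => ?_) y
      · exact mul_nonneg (mul_nonneg (mul_nonneg zero_le_two (smoothConst_pos hQ.pos).le) hf.nonneg)
          (Real.rpow_nonneg (sub_nonneg.2 hs.1.le) _)
      · simpa using (hf.bddLip s).abs_evol_deriv_one_sub_le hQ hs.1 d x z
  rw [integral_mul_const, integral_mul_const, integral_const_mul, integral_sub_rpow_neg_half h2] at h4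
  refine (abs_add_le _ _).trans ((add_le_add h3 h4).trans (le_of_eq ?_))
  ring

/-- The same splitting one derivative higher. On `(t',T]` the Hölder seminorm of exponent `α`
replaces the Lipschitz constant, because its singularity at `s = t'` is integrable. -/
lemma IsSource.abs_pot_two_time (hQ : IsElliptic δ₁ δ₂ Q) (hα : α ∈ Ioo (0 : ℝ) 1)
    (hf : IsSource M L f) {t' : ℝ} (h1 : t ≤ t') (h2 : t' ≤ T) (d e : Fin D) (y : Vec D) :
    |partialDeriv e (partialDeriv d (pot Q T f t)) y
      - partialDeriv e (partialDeriv d (pot Q T f t')) y|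
      ≤ 4 * smoothConst D δ₁ * L * (t' - t) ^ (1 / 2 : ℝ)
        + holderConst D δ₁ α * L * ((T - t') ^ ((1 - α) / 2) / ((1 - α) / 2))
        * momentConst D δ₂ α * (t' - t) ^ (α / 2) := by
  have hi := hf.integrable_evol_two hQ t T d e y
  rw [(hf.pot_deriv_two hQ t T d).2, (hf.pot_deriv_two hQ t' T d).2, setIntegral_Ioc_split h1 h2 hi,
    add_sub_assoc, ← integral_sub (hi.mono_set (Ioc_subset_Ioc_left h1))
    (hf.integrable_evol_two hQ t' T d e y)]
  have h3 := hf.abs_pot_two_le hQ h1 d e y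
  rw [(hf.pot_deriv_two hQ t t' d).2] at h3
  have h4 := abs_setIntegral_le (t := t') (T := T)
    (G := fun s => partialDeriv e (partialDeriv d (evol Q t s (f s))) y
      - partialDeriv e (partialDeriv d (evol Q t' s (f s))) y)
    ((((integrableOn_sub_rpow (by linarith [hα.2] : (-1 : ℝ) < -((1 + α) / 2)) t' T).const_mul
      (holderConst D δ₁ α * L)).mul_const (momentConst D δ₂ α)).mul_const ((t' - t) ^ (α / 2)))
    fun s hs => by
      rw [(hf.bddLip s).evol_deriv_two_split hQ h1 hs.1]
      refine abs_evol_sub_self_le hQ h1 (measurable_partialDeriv _ e)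
        ((hf.bddLip s).abs_evol_deriv_two_le hQ hs.1 d e) ?_ hα.1.le
        ((hf.bddLip s).abs_evol_deriv_two_sub_le_holder hQ hα hs.1 d e) y
      exact mul_nonneg (mul_nonneg (holderConst_nonneg hQ.pos α) hf.nonneg)
        (Real.rpow_nonneg (sub_nonneg.2 hs.1.le) _)
  rw [integral_mul_const, integral_mul_const, integral_const_mul,
    integral_sub_rpow_holder hα h2] at h4
  exact (abs_add_le _ _).trans (add_le_add h3 h4)

/-- Small time expansion of the potential. -/
lemma IsSource.pot_taylor (hQ : IsElliptic δ₁ δ₂ Q) (hα : α ∈ Ioo (0 : ℝ) 1)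
    (hf : IsSource M L f) {t' : ℝ} (h1 : t ≤ t') (h2 : t' ≤ T) (y : Vec D) :
    |pot Q T f t y - pot Q T f t' y
      - 1 / 2 * ∑ d, ∑ e, cov Q t t' d e * partialDeriv e (partialDeriv d (pot Q T f t')) y
      - ∫ s in Ioc t t', f s y|
      ≤ D * D * momentConst D δ₂ (2 + α) * (holderConst D δ₁ α * L
        * ((T - t') ^ ((1 - α) / 2) / ((1 - α) / 2))) * (t' - t) ^ (1 + α / 2)
        + L * momentConst D δ₂ 1 * (t' - t) ^ (1 / 2 : ℝ) * (t' - t) := by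
  have hi := hf.integrable_evol hQ t T y
  have i2 : ∀ d e, IntegrableOn (fun s => cov Q t t' d e *
      partialDeriv e (partialDeriv d (evol Q t' s (f s))) y) (Ioc t' T) := fun d e =>
    (hf.integrable_evol_two hQ t' T d e y).const_mul _
  have i3 : IntegrableOn (fun s => 1 / 2 * ∑ d, ∑ e, cov Q t t' d e *
      partialDeriv e (partialDeriv d (evol Q t' s (f s))) y) (Ioc t' T) :=
    (integrable_finsetSum _ fun d _ => integrable_finsetSum _ fun e _ => i2 d e).const_mul _
  have i4 : IntegrableOn (fun s => f s y) (Ioc t t') :=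
    (hf.continuous_time y).integrableOn_Ioc
  have i5 : IntegrableOn (fun s => evol Q t s (f s) y - evol Q t' s (f s) y) (Ioc t' T) :=
    (hi.mono_set (Ioc_subset_Ioc_left h1)).sub (hf.integrable_evol hQ t' T y)
  have e1 : 1 / 2 * ∑ d, ∑ e, cov Q t t' d e * partialDeriv e (partialDeriv d (pot Q T f t')) y
      = ∫ s in Ioc t' T, 1 / 2 * ∑ d, ∑ e, cov Q t t' d e *
        partialDeriv e (partialDeriv d (evol Q t' s (f s))) y := by
    rw [integral_const_mul, integral_finsetSum _ fun d _ => integrable_finsetSum _ fun e _ => i2 d e]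
    congr 1
    refine Finset.sum_congr rfl fun d _ => ?_
    rw [integral_finsetSum _ fun e _ => i2 d e]
    refine Finset.sum_congr rfl fun e _ => ?_
    rw [integral_const_mul, (hf.pot_deriv_two hQ t' T d).2]
  -- On `(t',T]` the expansion `evol_taylor` is applied to `P_{t',s} f_s` and integrated in `s`; on
  -- `(t,t']` the evolution is close to the identity, since the source is Lipschitz.
  have e2 : pot Q T f t y - pot Q T f t' y
      - 1 / 2 * ∑ d, ∑ e, cov Q t t' d e * partialDeriv e (partialDeriv d (pot Q T f t')) y
      - ∫ s in Ioc t t', f s y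
      = (∫ s in Ioc t' T, (evol Q t s (f s) y - evol Q t' s (f s) y
        - 1 / 2 * ∑ d, ∑ e, cov Q t t' d e *
          partialDeriv e (partialDeriv d (evol Q t' s (f s))) y))
        + ∫ s in Ioc t t', (evol Q t s (f s) y - f s y) := by
    rw [e1, integral_sub i5 i3,
      integral_sub (hi.mono_set (Ioc_subset_Ioc_left h1)) (hf.integrable_evol hQ t' T y),
      integral_sub (hf.integrable_evol hQ t t' y) i4, pot, pot, setIntegral_Ioc_split h1 h2 hi]
    ring
  rw [e2]
  refine (abs_add_le _ _).trans (add_le_add ?_ ?_)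
  · have h4 := abs_setIntegral_le (t := t') (T := T)
      (G := fun s => evol Q t s (f s) y - evol Q t' s (f s) y
        - 1 / 2 * ∑ d, ∑ e, cov Q t t' d e * partialDeriv e (partialDeriv d (evol Q t' s (f s))) y)
      ((((integrableOn_sub_rpow (by linarith [hα.2] : (-1 : ℝ) < -((1 + α) / 2)) t' T).const_mul
        (holderConst D δ₁ α * L)).const_mul (D * D * momentConst D δ₂ (2 + α))).mul_const
        ((t' - t) ^ (1 + α / 2)))
      fun s hs => by
        have hb := hf.bddLip s
        rw [evol_comp hQ h1 hs.1.le hb.measurable hb.bdd]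
        refine evol_taylor hQ h1 (evol_smoothing hQ hs.1 hb.measurable hb.bdd).1
          (fun d => (hb.evol_deriv_two hQ hs.1 d).1) hb.evol.bdd hα.1 ?_
          (fun d e => hb.abs_evol_deriv_two_sub_le_holder hQ hα hs.1 d e) y
        exact mul_nonneg (mul_nonneg (holderConst_nonneg hQ.pos α) hf.nonneg)
          (Real.rpow_nonneg (sub_nonneg.2 hs.1.le) _)
    rwa [integral_mul_const, integral_const_mul, integral_const_mul,
      integral_sub_rpow_holder hα h2] at h4
  · have h4 := abs_setIntegral_le (t := t) (T := t') (G := fun s => evol Q t s (f s) y - f s y)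
      (b := fun _ => L * momentConst D δ₂ 1 * (t' - t) ^ (1 / 2 : ℝ)) (integrable_const _)
      fun s hs => by
        have hb := hf.bddLip s
        refine (abs_evol_sub_self_le hQ hs.1.le hb.measurable hb.bdd hb.nonneg zero_le_one
          (by simpa using hb.lip) y).trans ?_
        have := momentConst_nonneg (D := D) hQ.pos'.le 1
        have := hb.nonneg
        have := sub_nonneg.2 hs.1.le
        gcongr
        exact hs.2
    rw [setIntegral_const, smul_eq_mul, Real.volume_real_Ioc_of_le h1] at h4
    linarith

end Bounds

end Potential

/-! ### Parabolic Hölder functions -/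

section ParabolicHolder

variable {D : ℕ} {α T : ℝ} {h k : ℝ → Vec D → ℝ}

lemma rpow_half_eq_sqrt_rpow (r : ℝ) (hr : 0 ≤ r) (α : ℝ) : r ^ (α / 2) = √r ^ α := by
  rw [Real.sqrt_eq_rpow, ← Real.rpow_mul hr]; congr 1; ring

lemma IsParabolicHolder.of_bounds (hα : 0 < α) {M K₁ K₂ : ℝ} (hK₁ : 0 ≤ K₁) (hK₂ : 0 ≤ K₂)
    (hM : ∀ t ∈ Icc 0 T, ∀ y, |h t y| ≤ M)
    (h1 : ∀ t ∈ Icc 0 T, ∀ x y, |h t x - h t y| ≤ K₁ * ‖x - y‖ ^ α)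
    (h2 : ∀ t ∈ Icc 0 T, ∀ t' ∈ Icc 0 T, t ≤ t' → ∀ y, |h t y - h t' y| ≤ K₂ * (t' - t) ^ (α / 2)) :
    IsParabolicHolder α T h := by
  refine ⟨⟨M, hM⟩, K₁ + K₂, fun t ht s hs x y => ?_⟩
  have h3 : |h t x - h s x| ≤ K₂ * |t - s| ^ (α / 2) := by
    rcases le_total t s with hts | hts
    · rw [abs_sub_comm t s, abs_of_nonneg (sub_nonneg.2 hts)]; exact h2 t ht s hs hts x
    · rw [abs_sub_comm (h t x), abs_of_nonneg (sub_nonneg.2 hts)]; exact h2 s hs t ht hts x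
  rw [rpow_half_eq_sqrt_rpow _ (abs_nonneg _)] at h3
  have h4 : √|t - s| ^ α ≤ (√|t - s| + ‖x - y‖) ^ α :=
    Real.rpow_le_rpow (Real.sqrt_nonneg _) (by linarith [norm_nonneg (x - y)]) hα.le
  have h5 : ‖x - y‖ ^ α ≤ (√|t - s| + ‖x - y‖) ^ α :=
    Real.rpow_le_rpow (norm_nonneg _) (by linarith [Real.sqrt_nonneg |t - s|]) hα.le
  have h6 := h1 s hs x y
  calc |h t x - h s y| ≤ |h t x - h s x| + |h s x - h s y| := abs_sub_le _ _ _
    _ ≤ K₂ * (√|t - s| + ‖x - y‖) ^ α + K₁ * (√|t - s| + ‖x - y‖) ^ α := by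
        gcongr
        · exact h3.trans (by gcongr)
        · exact h6.trans (by gcongr)
    _ = _ := by ring

lemma IsParabolicHolder.exists_bounds (hh : IsParabolicHolder α T h) :
    ∃ K : ℝ, 0 ≤ K ∧ (∀ t ∈ Icc 0 T, ∀ y, |h t y| ≤ K) ∧
      (∀ t ∈ Icc 0 T, ∀ x y, |h t x - h t y| ≤ K * ‖x - y‖ ^ α) ∧
      ∀ t ∈ Icc 0 T, ∀ t' ∈ Icc 0 T, ∀ y, |h t y - h t' y| ≤ K * |t - t'| ^ (α / 2) := by
  obtain ⟨⟨M, hM⟩, K, hK⟩ := hh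
  refine ⟨max (max M K) 0, le_max_right _ _, fun t ht y => (hM t ht y).trans
    ((le_max_left _ _).trans (le_max_left _ _)), fun t ht x y => ?_, fun t ht t' ht' y => ?_⟩
  · have := hK t ht t ht x y
    rw [sub_self, abs_zero, Real.sqrt_zero, zero_add] at this
    refine this.trans ?_
    gcongr
    exact (le_max_right _ _).trans (le_max_left _ _)
  · have := hK t ht t' ht' y y
    rw [sub_self y, norm_zero, add_zero, ← rpow_half_eq_sqrt_rpow _ (abs_nonneg _)] at this
    refine this.trans ?_
    gcongr
    exact (le_max_right _ _).trans (le_max_left _ _)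

lemma IsParabolicHolder.congr (hh : IsParabolicHolder α T h)
    (e : ∀ t ∈ Icc 0 T, ∀ y, k t y = h t y) : IsParabolicHolder α T k := by
  obtain ⟨⟨M, hM⟩, K, hK⟩ := hh
  exact ⟨⟨M, fun t ht y => by rw [e t ht]; exact hM t ht y⟩, K, fun t ht s hs x y => by
    rw [e t ht, e s hs]; exact hK t ht s hs x y⟩

lemma IsParabolicHolder.add (hh : IsParabolicHolder α T h) (hk : IsParabolicHolder α T k) :
    IsParabolicHolder α T (fun t y => h t y + k t y) := by
  obtain ⟨⟨M, hM⟩, K, hK⟩ := hh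
  obtain ⟨⟨M', hM'⟩, K', hK'⟩ := hk
  refine ⟨⟨M + M', fun t ht y => (abs_add_le _ _).trans (add_le_add (hM t ht y) (hM' t ht y))⟩,
    K + K', fun t ht s hs x y => ?_⟩
  rw [add_sub_add_comm, add_mul]
  exact (abs_add_le _ _).trans (add_le_add (hK t ht s hs x y) (hK' t ht s hs x y))

lemma IsParabolicHolder.mul (hh : IsParabolicHolder α T h) (hk : IsParabolicHolder α T k) :
    IsParabolicHolder α T (fun t y => h t y * k t y) := by
  obtain ⟨⟨M, hM⟩, K, hK⟩ := hh
  obtain ⟨⟨M', hM'⟩, K', hK'⟩ := hk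
  refine ⟨⟨M * M', fun t ht y => ?_⟩, M' * K + M * K', fun t ht s hs x y => ?_⟩
  · rw [abs_mul]
    exact mul_le_mul (hM t ht y) (hM' t ht y) (abs_nonneg _) ((abs_nonneg _).trans (hM t ht y))
  · have e : h t x * k t x - h s y * k s y = (h t x - h s y) * k t x + h s y * (k t x - k s y) := by
      ring
    rw [e]
    refine (abs_add_le _ _).trans ?_
    rw [abs_mul, abs_mul]
    have a1 := hK t ht s hs x y
    have a2 := hK' t ht s hs x y
    have b1 := mul_le_mul a1 (hM' t ht x) (abs_nonneg _) ((abs_nonneg _).trans a1)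
    have b2 := mul_le_mul (hM s hs y) a2 (abs_nonneg _) ((abs_nonneg _).trans (hM s hs y))
    linarith

lemma isParabolicHolder_const (c : ℝ) : IsParabolicHolder α T (fun (_ : ℝ) (_ : Vec D) => c) :=
  ⟨⟨|c|, fun _ _ _ => le_rfl⟩, 0, fun _ _ _ _ _ _ => by simp⟩

lemma IsParabolicHolder.sum {ι : Type*} (S : Finset ι) {h : ι → ℝ → Vec D → ℝ}
    (hh : ∀ i ∈ S, IsParabolicHolder α T (h i)) :
    IsParabolicHolder α T (fun t y => ∑ i ∈ S, h i t y) := by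
  classical
  induction S using Finset.induction_on with
  | empty => simpa using isParabolicHolder_const 0
  | insert i S hi ih =>
    simp_rw [Finset.sum_insert hi]
    exact (hh i (Finset.mem_insert_self _ _)).add
      (ih fun j hj => hh j (Finset.mem_insert_of_mem hj))

lemma rpow_le_rpow_half {r : ℝ} (hα : 0 < α) (h0 : 0 ≤ r) (h1 : r ≤ 1) : r ^ α ≤ r ^ (α / 2) := by
  rcases h0.eq_or_lt with rfl | h0
  · rw [Real.zero_rpow hα.ne', Real.zero_rpow (by positivity)]
  · exact Real.rpow_le_rpow_of_exponent_ge h0 h1 (by linarith)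

lemma isParabolicHolder_of_time (hα : 0 < α) (hT : T ≤ 1) {q : ℝ → ℝ} {K : ℝ} (hK : 0 ≤ K)
    (hq : ∀ t s, |q t - q s| ≤ K * |t - s| ^ α) :
    IsParabolicHolder α T (fun t (_ : Vec D) => q t) := by
  refine IsParabolicHolder.of_bounds (M := |q 0| + K) (K₁ := 0) (K₂ := K) hα le_rfl hK
    (fun t ht _ => ?_) (fun t _ x y => by simp) fun t ht t' ht' htt' _ => ?_
  · have h1 := hq t 0
    have h2 : |t - 0| ^ α ≤ 1 := Real.rpow_le_one (abs_nonneg _)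
      (by rw [sub_zero, abs_of_nonneg ht.1]; exact ht.2.trans hT) hα.le
    have h3 := abs_sub_abs_le_abs_sub (q t) (q 0)
    nlinarith
  · rw [abs_sub_comm]
    refine (hq t' t).trans ?_
    rw [abs_of_nonneg (sub_nonneg.2 htt')]
    exact mul_le_mul_of_nonneg_left
      (rpow_le_rpow_half hα (sub_nonneg.2 htt') (by linarith [ht.1, ht'.2])) hK

/-- A function with a first order expansion whose error is of order `1 + β` is differentiable. -/
lemma hasDerivWithinAt_of_expansion {φ q : ℝ → ℝ} {S : Set ℝ} {β C : ℝ} (hβ : 0 < β)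
    (hC : 0 ≤ C) (h1 : ∀ t ∈ S, ∀ t' ∈ S, t ≤ t' → |φ t' - φ t - (t' - t) * q t'| ≤ C * (t' - t) ^ (1 + β))
    (h2 : ∀ t ∈ S, ∀ t' ∈ S, |q t - q t'| ≤ C * |t - t'| ^ β) {t : ℝ} (ht : t ∈ S) :
    HasDerivWithinAt φ (q t) S t := by
  -- The given expansion uses the slope at the later of the two times. When that time is not `t`,
  -- Hölder continuity of `q` replaces it by `q t`, which accounts for the second `C`.
  have key : ∀ t' ∈ S, |φ t' - φ t - (t' - t) * q t| ≤ 2 * C * |t' - t| ^ (1 + β) := by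
    intro t' ht'
    have e : ∀ r : ℝ, 0 ≤ r → r ^ (1 + β) = r * r ^ β := fun r hr => by
      rw [Real.rpow_add_of_nonneg hr zero_le_one hβ.le, Real.rpow_one]
    rcases le_total t t' with h | h
    · have a1 := h1 t ht t' ht' h
      have a2 := h2 t' ht' t ht
      have h0 := sub_nonneg.2 h
      rw [abs_of_nonneg h0] at a2 ⊢
      rw [e _ h0] at a1 ⊢
      have e2 : φ t' - φ t - (t' - t) * q t = (φ t' - φ t - (t' - t) * q t') + (t' - t) * (q t' - q t) := by
        ring
      rw [e2]
      refine (abs_add_le _ _).trans ?_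
      rw [abs_mul, abs_of_nonneg h0]
      nlinarith
    · have a1 := h1 t' ht' t ht h
      have h0 := sub_nonneg.2 h
      have e2 : φ t' - φ t - (t' - t) * q t = -(φ t - φ t' - (t - t') * q t) := by ring
      rw [e2, abs_neg, abs_sub_comm t', abs_of_nonneg h0]
      have := Real.rpow_nonneg h0 (1 + β)
      nlinarith
  rw [hasDerivWithinAt_iff_tendsto]
  have hlim : Tendsto (fun t' => 2 * C * |t' - t| ^ β) (𝓝[S] t) (𝓝 0) := by
    have : Continuous fun t' : ℝ => |t' - t| ^ β :=
      (continuous_id.sub continuous_const).abs.rpow_const fun _ => Or.inr hβ.le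
    have h3 : Continuous fun t' : ℝ => 2 * C * |t' - t| ^ β := continuous_const.mul this
    have := h3.tendsto t
    simp only [sub_self, abs_zero, Real.zero_rpow hβ.ne', mul_zero] at this
    exact this.mono_left nhdsWithin_le_nhds
  refine squeeze_zero' (Eventually.of_forall fun _ => by positivity) ?_ hlim
  filter_upwards [self_mem_nhdsWithin] with t' ht'
  have a := key t' ht'
  rw [Real.rpow_add_of_nonneg (abs_nonneg _) zero_le_one hβ.le, Real.rpow_one] at a
  simp only [smul_eq_mul, Real.norm_eq_abs]
  rcases (abs_nonneg (t' - t)).eq_or_lt with h0 | h0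
  · rw [← h0, Real.zero_rpow hβ.ne', inv_zero, zero_mul, mul_zero]
  · rw [inv_mul_le_iff₀ h0]; linarith

lemma continuousOn_uncurry_of_bounds {h : ℝ → Vec D → ℝ} {β K : ℝ} (hβ : 0 < β)
    (h1 : ∀ t ∈ Icc 0 T, ∀ x y, |h t x - h t y| ≤ K * ‖x - y‖)
    (h2 : ∀ t ∈ Icc 0 T, ∀ t' ∈ Icc 0 T, ∀ y, |h t y - h t' y| ≤ K * |t - t'| ^ β) :
    ContinuousOn (fun p : ℝ × Vec D => h p.1 p.2) (Icc 0 T ×ˢ univ) := by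
  rintro ⟨t, y⟩ ⟨ht, -⟩
  refine tendsto_iff_dist_tendsto_zero.2 ?_
  have hlim : Tendsto (fun p : ℝ × Vec D => K * ‖p.2 - y‖ + K * |p.1 - t| ^ β)
      (𝓝[Icc 0 T ×ˢ univ] (t, y)) (𝓝 0) := by
    have c1 : Continuous fun p : ℝ × Vec D => |p.1 - t| ^ β :=
      (continuous_fst.sub continuous_const).abs.rpow_const fun _ => Or.inr hβ.le
    have c2 : Continuous fun p : ℝ × Vec D => K * ‖p.2 - y‖ + K * |p.1 - t| ^ β := by fun_prop
    have := c2.tendsto (t, y)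
    simp only [sub_self, norm_zero, abs_zero, Real.zero_rpow hβ.ne', mul_zero, add_zero] at this
    exact this.mono_left nhdsWithin_le_nhds
  refine squeeze_zero' (Eventually.of_forall fun _ => dist_nonneg) ?_ hlim
  filter_upwards [self_mem_nhdsWithin] with p hp
  rw [Real.dist_eq]
  exact (abs_sub_le _ (h p.1 y) _).trans (add_le_add (h1 p.1 hp.1 p.2 y) (h2 p.1 hp.1 t ht y))

end ParabolicHolder

/-! ### The linear equation -/

section Linear

variable {D : ℕ} {δ₁ δ₂ : ℝ} {Q : ℝ → Matrix (Fin D) (Fin D) ℝ} {α : ℝ}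

/-- Hölder continuity in time of the diffusion coefficients. -/
def IsTimeHolder (α : ℝ) (Q : ℝ → Matrix (Fin D) (Fin D) ℝ) : Prop :=
  ∃ K : ℝ, 0 ≤ K ∧ ∀ d e t s, |Q t d e - Q s d e| ≤ K * |t - s| ^ α

/-- `(1/2) tr(Q H)`. -/
def halfTrace (A H : Matrix (Fin D) (Fin D) ℝ) : ℝ := 1 / 2 * ∑ d, ∑ e, A d e * H d e

lemma abs_sum_sum_mul_le {A H : Matrix (Fin D) (Fin D) ℝ} {a b : ℝ} (ha : ∀ d e, |A d e| ≤ a)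
    (hb : ∀ d e, |H d e| ≤ b) : |∑ d, ∑ e, A d e * H d e| ≤ D * D * (a * b) := by
  calc |∑ d, ∑ e, A d e * H d e| ≤ ∑ d : Fin D, ∑ e : Fin D, a * b :=
        (Finset.abs_sum_le_sum_abs _ _).trans (Finset.sum_le_sum fun d _ =>
          (Finset.abs_sum_le_sum_abs _ _).trans (Finset.sum_le_sum fun e _ => by
            rw [abs_mul]
            exact mul_le_mul (ha d e) (hb d e) (abs_nonneg _) ((abs_nonneg _).trans (ha d e))))
    _ = D * D * (a * b) := by simp; ring

lemma abs_cov_sub_le (hQ : IsElliptic δ₁ δ₂ Q) (hα : 0 < α) {K : ℝ}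
    (hK : 0 ≤ K) (hK' : ∀ d e t s, |Q t d e - Q s d e| ≤ K * |t - s| ^ α) {t t' : ℝ} (h : t ≤ t')
    (d e : Fin D) : |cov Q t t' d e - (t' - t) * Q t' d e| ≤ K * (t' - t) ^ (1 + α) := by
  have h1 : cov Q t t' d e - (t' - t) * Q t' d e = ∫ u in t..t', (Q u d e - Q t' d e) := by
    rw [intervalIntegral.integral_sub (hQ.intervalIntegrable d e t t') intervalIntegrable_const,
      intervalIntegral.integral_const, smul_eq_mul]
    rfl
  rw [h1]
  have h2 := intervalIntegral.norm_integral_le_of_norm_le_const (a := t) (b := t')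
    (f := fun u => Q u d e - Q t' d e) (C := K * (t' - t) ^ α) fun u hu => by
      rw [uIoc_of_le h] at hu
      refine (hK' d e u t').trans ?_
      gcongr
      rw [abs_sub_comm, abs_of_nonneg (by linarith [hu.2])]
      linarith [hu.1]
  rw [abs_of_nonneg (sub_nonneg.2 h)] at h2
  refine (show _ ≤ _ from h2).trans (le_of_eq ?_)
  rw [Real.rpow_add_of_nonneg (sub_nonneg.2 h) zero_le_one hα.le, Real.rpow_one]
  ring

lemma abs_halfTrace_cov_sub_le (hQ : IsElliptic δ₁ δ₂ Q) (hα : 0 < α) {K : ℝ}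
    (hK : 0 ≤ K) (hK' : ∀ d e t s, |Q t d e - Q s d e| ≤ K * |t - s| ^ α) {t t' : ℝ} (h : t ≤ t')
    (h1 : t' - t ≤ 1) {H : Matrix (Fin D) (Fin D) ℝ} {B : ℝ} (hB : ∀ d e, |H d e| ≤ B) (hB0 : 0 ≤ B) :
    |halfTrace (cov Q t t') H - (t' - t) * halfTrace (Q t') H|
      ≤ D * D * K * B * (t' - t) ^ (1 + α / 2) := by
  have e : halfTrace (cov Q t t') H - (t' - t) * halfTrace (Q t') H
      = 1 / 2 * ∑ d, ∑ e, (cov Q t t' - (t' - t) • Q t') d e * H d e := by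
    have e1 : ∑ d, ∑ e, (cov Q t t' - (t' - t) • Q t') d e * H d e
        = ∑ d, ∑ e, cov Q t t' d e * H d e - (t' - t) * ∑ d, ∑ e, Q t' d e * H d e := by
      simp only [Finset.mul_sum, ← Finset.sum_sub_distrib]
      refine Finset.sum_congr rfl fun d _ => Finset.sum_congr rfl fun e _ => ?_
      simp only [Matrix.sub_apply, Matrix.smul_apply, smul_eq_mul]
      ring
    rw [e1, halfTrace, halfTrace]
    ring
  have h0 := sub_nonneg.2 h
  have h2 := abs_sum_sum_mul_le (A := cov Q t t' - (t' - t) • Q t')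
    (fun d e => abs_cov_sub_le hQ hα hK hK' h d e) hB
  have h3 : (t' - t) ^ (1 + α) ≤ (t' - t) ^ (1 + α / 2) := by
    rw [Real.rpow_add_of_nonneg h0 zero_le_one hα.le,
      Real.rpow_add_of_nonneg h0 zero_le_one (by linarith : 0 ≤ α / 2)]
    exact mul_le_mul_of_nonneg_left (rpow_le_rpow_half hα h0 h1) (by positivity)
  rw [e, abs_mul]
  have h4 : |(1 / 2 : ℝ)| ≤ 1 := by norm_num [abs_le]
  calc |(1 / 2 : ℝ)| * |∑ d, ∑ e, (cov Q t t' - (t' - t) • Q t') d e * H d e|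
      ≤ 1 * (D * D * (K * (t' - t) ^ (1 + α) * B)) := mul_le_mul h4 h2 (abs_nonneg _) zero_le_one
    _ ≤ 1 * (D * D * (K * (t' - t) ^ (1 + α / 2) * B)) := by gcongr
    _ = _ := by ring

variable {M L : ℝ} {f : ℝ → Vec D → ℝ} {g : Vec D → ℝ}

/-- The solution of the linear backward equation. -/
def linSol (Q : ℝ → Matrix (Fin D) (Fin D) ℝ) (T : ℝ) (g : Vec D → ℝ) (f : ℝ → Vec D → ℝ)
    (t : ℝ) (y : Vec D) : ℝ := evol Q t T g y + pot Q T f t y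

lemma MemHolderTwo.differentiable (hg : MemHolderTwo α g) : Differentiable ℝ g :=
  hg.contDiff.differentiable (by norm_num)

lemma MemHolderTwo.differentiable_one (hg : MemHolderTwo α g) (d : Fin D) :
    Differentiable ℝ (partialDeriv d g) :=
  (contDiff_partialDeriv hg.contDiff d).differentiable (by norm_num)

/-- A common bound for all the quantities in the definition of `C^{2+α}`. -/
lemma MemHolderTwo.exists_bound (hg : MemHolderTwo α g) : ∃ B : ℝ, 0 ≤ B ∧ (∀ y, |g y| ≤ B) ∧
    (∀ d y, |partialDeriv d g y| ≤ B) ∧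
    (∀ d e y, |partialDeriv e (partialDeriv d g) y| ≤ B) ∧
    ∀ d e x y, |partialDeriv e (partialDeriv d g) x - partialDeriv e (partialDeriv d g) y|
      ≤ B * ‖x - y‖ ^ α := by
  obtain ⟨M, hM⟩ := hg.bounded
  obtain ⟨M', hM'⟩ := hg.bounded_grad
  choose m hm using fun d e => (hg.hess d e).1
  choose k hk using fun d e => (hg.hess d e).2
  set B := |M| + |M'| + (∑ d, ∑ e, |m d e|) + ∑ d, ∑ e, |k d e| with hB
  have s1 : ∀ d e, |m d e| ≤ ∑ d, ∑ e, |m d e| := fun d e =>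
    (Finset.single_le_sum (f := fun e => |m d e|) (fun _ _ => abs_nonneg _) (Finset.mem_univ e)).trans
      (Finset.single_le_sum (f := fun d => ∑ e, |m d e|)
        (fun _ _ => Finset.sum_nonneg fun _ _ => abs_nonneg _) (Finset.mem_univ d))
  have s2 : ∀ d e, |k d e| ≤ ∑ d, ∑ e, |k d e| := fun d e =>
    (Finset.single_le_sum (f := fun e => |k d e|) (fun _ _ => abs_nonneg _) (Finset.mem_univ e)).trans
      (Finset.single_le_sum (f := fun d => ∑ e, |k d e|)
        (fun _ _ => Finset.sum_nonneg fun _ _ => abs_nonneg _) (Finset.mem_univ d))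
  have n1 : 0 ≤ ∑ d, ∑ e, |m d e| := Finset.sum_nonneg fun _ _ => Finset.sum_nonneg fun _ _ => abs_nonneg _
  have n2 : 0 ≤ ∑ d, ∑ e, |k d e| := Finset.sum_nonneg fun _ _ => Finset.sum_nonneg fun _ _ => abs_nonneg _
  have n3 := abs_nonneg M
  have n4 := abs_nonneg M'
  refine ⟨B, by positivity, fun y => ?_, fun d y => ?_, fun d e y => ?_, fun d e x y => ?_⟩
  · linarith [hM y, le_abs_self M]
  · have : |partialDeriv d g y| ≤ M' := hM' y d
    linarith [le_abs_self M']
  · have : |partialDeriv e (partialDeriv d g) y| ≤ m d e := hm d e y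
    linarith [le_abs_self (m d e), s1 d e]
  · have : |partialDeriv e (partialDeriv d g) x - partialDeriv e (partialDeriv d g) y|
      ≤ k d e * ‖x - y‖ ^ α := hk d e x y
    refine this.trans ?_
    gcongr
    linarith [le_abs_self (k d e), s2 d e]

/-- Read off from the displacement estimate over an interval of length zero. -/
lemma evol_self (hQ : IsElliptic δ₁ δ₂ Q) (t : ℝ) {f : Vec D → ℝ} (hf : BddLip M L f) (y : Vec D) :
    evol Q t t f y = f y := by
  have := abs_evol_sub_self_le hQ le_rfl hf.measurable hf.bdd hf.nonneg zero_le_one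
    (by simpa using hf.lip) y (t := t) (s := t)
  rw [sub_self, Real.zero_rpow (by norm_num), mul_zero] at this
  exact sub_eq_zero.1 (abs_nonpos_iff.1 this)

lemma MemHolderTwo.exists_bddLip (hg : MemHolderTwo α g) : ∃ B L : ℝ, BddLip B L g := by
  obtain ⟨B, hB, h1, h2, -, -⟩ := hg.exists_bound
  exact ⟨B, D * B, by positivity, h1, abs_sub_le_of_partialDeriv hg.differentiable h2⟩

lemma MemHolderTwo.evol_deriv (hg : MemHolderTwo α g) (t T : ℝ) :
    Differentiable ℝ (evol Q t T g) ∧ ∀ d,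
      partialDeriv d (evol Q t T g) = evol Q t T (partialDeriv d g) := by
  obtain ⟨B, hB, h1, h2, -, -⟩ := hg.exists_bound
  have := evol_partialDeriv (Q := Q) (t := t) (s := T) hg.differentiable h1 h2
  exact ⟨this.1, fun d => funext (this.2 d)⟩

lemma MemHolderTwo.evol_deriv_two (hg : MemHolderTwo α g) (t T : ℝ) (d : Fin D) :
    Differentiable ℝ (partialDeriv d (evol Q t T g)) ∧ ∀ e,
      partialDeriv e (partialDeriv d (evol Q t T g))
        = evol Q t T (partialDeriv e (partialDeriv d g)) := by
  obtain ⟨B, hB, h1, h2, h3, -⟩ := hg.exists_bound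
  rw [(hg.evol_deriv t T).2 d]
  have := evol_partialDeriv (Q := Q) (t := t) (s := T) (hg.differentiable_one d) (h2 d) (h3 d)
  exact ⟨this.1, fun e => funext (this.2 e)⟩

lemma linSol_deriv (hQ : IsElliptic δ₁ δ₂ Q) (hg : MemHolderTwo α g) (hf : IsSource M L f)
    (t T : ℝ) : Differentiable ℝ (linSol Q T g f t) ∧ ∀ d y, partialDeriv d (linSol Q T g f t) y
      = evol Q t T (partialDeriv d g) y + partialDeriv d (pot Q T f t) y := by
  have h1 := hg.evol_deriv (Q := Q) t T
  have h2 := hf.pot_deriv hQ t T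
  refine ⟨h1.1.add h2.1, fun d y => ?_⟩
  rw [← h1.2 d, ← partialDeriv_add (h1.1 y) (h2.1 y)]
  rfl

lemma linSol_deriv_two (hQ : IsElliptic δ₁ δ₂ Q) (hg : MemHolderTwo α g) (hf : IsSource M L f)
    (t T : ℝ) (d : Fin D) : Differentiable ℝ (partialDeriv d (linSol Q T g f t)) ∧
      ∀ e y, partialDeriv e (partialDeriv d (linSol Q T g f t)) y
      = evol Q t T (partialDeriv e (partialDeriv d g)) y
        + partialDeriv e (partialDeriv d (pot Q T f t)) y := by
  have h1 := hg.evol_deriv_two (Q := Q) t T d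
  have h2 := hf.pot_deriv_two hQ t T d
  rw [(hg.evol_deriv t T).2 d] at h1
  rw [show partialDeriv d (linSol Q T g f t) = fun y => evol Q t T (partialDeriv d g) y
    + partialDeriv d (pot Q T f t) y from funext ((linSol_deriv hQ hg hf t T).2 d)]
  refine ⟨h1.1.add h2.1, fun e y => ?_⟩
  rw [← h1.2 e, ← partialDeriv_add (h1.1 y) (h2.1 y)]

lemma abs_evol_time_le (hQ : IsElliptic δ₁ δ₂ Q) {t t' T p K : ℝ} (h1 : t ≤ t') (h2 : t' ≤ T)
    {f : Vec D → ℝ} (hf : Measurable f) (hM : ∀ y, |f y| ≤ M) (hK : 0 ≤ K) (hp : 0 ≤ p)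
    (h : ∀ x y, |f x - f y| ≤ K * ‖x - y‖ ^ p) (y : Vec D) :
    |evol Q t T f y - evol Q t' T f y| ≤ K * momentConst D δ₂ p * (t' - t) ^ (p / 2) := by
  rw [evol_comp hQ h1 h2 hf hM]
  exact abs_evol_sub_self_le hQ h1 (evol_measurable hf) (abs_evol_le hM) hK hp
    (abs_evol_sub_evol_le (ω := fun r => K * r ^ p) hf hM h) y

variable {T : ℝ}

lemma rpow_half_le_rpow {r : ℝ} (hα : α ∈ Ioo (0 : ℝ) 1) (h0 : 0 ≤ r) (h1 : r ≤ 1) :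
    r ^ (1 / 2 : ℝ) ≤ r ^ (α / 2) := by
  rcases h0.eq_or_lt with rfl | h0
  · rw [Real.zero_rpow (by norm_num), Real.zero_rpow (by linarith [hα.1])]
  · exact Real.rpow_le_rpow_of_exponent_ge h0 h1 (by linarith [hα.2])

/-- Derivatives of `g` commute with `P_{t,T}`, so that term inherits the Hölder seminorm of `∂_{yy}
g`; the other term is covered by the potential estimates. Since `T ≤ 1`, increments of order
`(t'-t)^(1/2)` are also of order `(t'-t)^(α/2)`. -/
lemma linSol_hess_isParabolicHolder (hQ : IsElliptic δ₁ δ₂ Q) (hα : α ∈ Ioo (0 : ℝ) 1)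
    (hT1 : T ≤ 1) (hg : MemHolderTwo α g) (hf : IsSource M L f) (d e : Fin D) :
    IsParabolicHolder α T (fun t y => partialDeriv e (partialDeriv d (linSol Q T g f t)) y) := by
  obtain ⟨B, hB, h1, h2, h3, h4⟩ := hg.exists_bound
  have hL := hf.nonneg
  have hsc := (smoothConst_pos (D := D) hQ.pos).le
  have hhc := holderConst_nonneg (D := D) hQ.pos α
  have hmc := momentConst_nonneg (D := D) hQ.pos'.le α
  have h1α : 0 < (1 - α) / 2 := by linarith [hα.2]
  have hm2 := measurable_partialDeriv (partialDeriv d g) e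
  have hpow : ∀ t ∈ Icc 0 T, ∀ p : ℝ, 0 ≤ p → (T - t) ^ p ≤ 1 := fun t ht p hp =>
    Real.rpow_le_one (by linarith [ht.2]) (by linarith [ht.1]) hp
  have hE : IsParabolicHolder α T (fun t y => evol Q t T (partialDeriv e (partialDeriv d g)) y) :=
    IsParabolicHolder.of_bounds hα.1 hB (mul_nonneg hB hmc)
      (fun t _ y => abs_evol_le (h3 d e) y)
      (fun t _ x y => abs_evol_sub_evol_le (ω := fun r => B * r ^ α) hm2 (h3 d e) (h4 d e) x y)
      fun t ht t' ht' htt' y => abs_evol_time_le hQ htt' ht'.2 hm2 (h3 d e) hB hα.1.le (h4 d e) y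
  have hP : IsParabolicHolder α T (fun t y => partialDeriv e (partialDeriv d (pot Q T f t)) y) := by
    refine IsParabolicHolder.of_bounds (M := 4 * smoothConst D δ₁ * L)
      (K₁ := holderConst D δ₁ α * L * (1 / ((1 - α) / 2)))
      (K₂ := 4 * smoothConst D δ₁ * L + holderConst D δ₁ α * L * (1 / ((1 - α) / 2))
        * momentConst D δ₂ α) hα.1 (by positivity) (by positivity)
      (fun t ht y => ?_) (fun t ht x y => ?_) fun t ht t' ht' htt' y => ?_
    · refine (hf.abs_pot_two_le hQ ht.2 d e y).trans ?_
      exact mul_le_of_le_one_right (by positivity) (hpow t ht _ (by norm_num))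
    · refine (hf.abs_pot_two_sub_le hQ hα ht.2 d e x y).trans ?_
      gcongr
      exact hpow t ht _ h1α.le
    · refine (hf.abs_pot_two_time hQ hα htt' ht'.2 d e y).trans ?_
      have h0 := sub_nonneg.2 htt'
      have := rpow_half_le_rpow hα h0 (by linarith [ht.1, ht'.2])
      rw [add_mul]
      gcongr
      exact hpow t' ht' _ h1α.le
  exact (hE.add hP).congr fun t _ y => (linSol_deriv_two hQ hg hf t T d).2 e y

/-- The equation is obtained without differentiating the Gaussian in time. The expansions of the
evolved datum and of the potential are added, `∫_t^{t'} Q` is replaced by `(t'-t) Q(t')` and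
`∫_t^{t'} f` by `(t'-t) f(t')`; each of the four errors is of order `(t'-t)^(1+α/2)`. -/
lemma linSol_expansion (hQ : IsElliptic δ₁ δ₂ Q) (hQα : IsTimeHolder α Q) (hα : α ∈ Ioo (0 : ℝ) 1)
    (hT1 : T ≤ 1) (hg : MemHolderTwo α g) (hf : IsSource M L f) {K : ℝ} (hK : 0 ≤ K)
    (hfK : ∀ s s' y, |f s y - f s' y| ≤ K * |s - s'| ^ (α / 2)) :
    ∃ C : ℝ, 0 ≤ C ∧ ∀ t ∈ Icc 0 T, ∀ t' ∈ Icc 0 T, t ≤ t' → ∀ y,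
      |linSol Q T g f t' y - linSol Q T g f t y - (t' - t) *
        (-(halfTrace (Q t') (hess (linSol Q T g f t') y) + f t' y))| ≤ C * (t' - t) ^ (1 + α / 2) := by
  obtain ⟨B, hB, h1, h2, h3, h4⟩ := hg.exists_bound
  obtain ⟨Kq, hKq, hKq'⟩ := hQα
  have hL := hf.nonneg
  have hsc := (smoothConst_pos (D := D) hQ.pos).le
  have hhc := holderConst_nonneg (D := D) hQ.pos α
  have hmc := momentConst_nonneg (D := D) hQ.pos'.le
  have h1α : 0 < (1 - α) / 2 := by linarith [hα.2]
  choose m hm using fun d e => (linSol_hess_isParabolicHolder hQ hα hT1 hg hf d e).1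
  set B₂ := ∑ d, ∑ e, |m d e| with hB₂
  have s1 : ∀ d e, m d e ≤ B₂ := fun d e => (le_abs_self _).trans <|
    (Finset.single_le_sum (f := fun e => |m d e|) (fun _ _ => abs_nonneg _) (Finset.mem_univ e)).trans
      (Finset.single_le_sum (f := fun d => ∑ e, |m d e|)
        (fun _ _ => Finset.sum_nonneg fun _ _ => abs_nonneg _) (Finset.mem_univ d))
  have hB₂0 : 0 ≤ B₂ := Finset.sum_nonneg fun _ _ => Finset.sum_nonneg fun _ _ => abs_nonneg _
  have hm1 := hmc 1
  have hm2 := hmc (2 + α)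
  refine ⟨D * D * momentConst D δ₂ (2 + α) * B
    + (D * D * momentConst D δ₂ (2 + α) * (holderConst D δ₁ α * L * (1 / ((1 - α) / 2)))
      + L * momentConst D δ₂ 1) + D * D * Kq * B₂ + K, by positivity, fun t ht t' ht' htt' y => ?_⟩
  have h0 := sub_nonneg.2 htt'
  have h01 : t' - t ≤ 1 := by linarith [ht.1, ht'.2]
  have hpow2 : (t' - t) ^ (1 / 2 : ℝ) * (t' - t) ≤ (t' - t) ^ (1 + α / 2) := by
    rw [Real.rpow_add_of_nonneg h0 zero_le_one (by linarith [hα.1]), Real.rpow_one, mul_comm]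
    exact mul_le_mul_of_nonneg_left (rpow_half_le_rpow hα h0 h01) h0
  have a1 := evol_taylor hQ htt' (hg.evol_deriv (Q := Q) t' T).1
    (fun d => (hg.evol_deriv_two (Q := Q) t' T d).1) (abs_evol_le h1) hα.1 hB
    (fun d e x y => by
      rw [(hg.evol_deriv_two (Q := Q) t' T d).2 e]
      exact abs_evol_sub_evol_le (ω := fun r => B * r ^ α)
        (measurable_partialDeriv (partialDeriv d g) e) (h3 d e) (h4 d e) x y) y
  rw [← evol_comp hQ htt' ht'.2 hg.differentiable.continuous.measurable h1] at a1
  have a2 := hf.pot_taylor hQ hα htt' ht'.2 y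
  have a3 := abs_halfTrace_cov_sub_le hQ hα.1 hKq hKq' htt' h01
    (H := hess (linSol Q T g f t') y) (fun d e => (hm d e t' ht' y).trans (s1 d e)) hB₂0
  have a4 : |(∫ s in Ioc t t', f s y) - (t' - t) * f t' y| ≤ K * (t' - t) ^ (1 + α / 2) := by
    have e1 : (∫ s in Ioc t t', f s y) - (t' - t) * f t' y = ∫ s in Ioc t t', (f s y - f t' y) := by
      rw [integral_sub (hf.continuous_time y).integrableOn_Ioc (integrable_const _),
        setIntegral_const, smul_eq_mul, Real.volume_real_Ioc_of_le htt']
    have := abs_setIntegral_le (G := fun s => f s y - f t' y) (t := t) (T := t')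
      (b := fun _ => K * (t' - t) ^ (α / 2)) (integrable_const _) fun s hs => by
        refine (hfK s t' y).trans ?_
        have : |s - t'| ≤ t' - t := by
          rw [abs_sub_comm, abs_of_nonneg (by linarith [hs.2])]; linarith [hs.1]
        have := hα.1
        gcongr
    rw [e1]
    rw [setIntegral_const, smul_eq_mul, Real.volume_real_Ioc_of_le htt'] at this
    refine this.trans (le_of_eq ?_)
    rw [Real.rpow_add_of_nonneg h0 zero_le_one (by linarith [hα.1]), Real.rpow_one]
    ring
  have e5 : halfTrace (cov Q t t') (hess (linSol Q T g f t') y)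
      = 1 / 2 * ∑ d, ∑ e, cov Q t t' d e * partialDeriv e (partialDeriv d (evol Q t' T g)) y
      + 1 / 2 * ∑ d, ∑ e, cov Q t t' d e * partialDeriv e (partialDeriv d (pot Q T f t')) y := by
    rw [halfTrace, ← mul_add, ← Finset.sum_add_distrib]
    congr 1
    refine Finset.sum_congr rfl fun d _ => ?_
    rw [← Finset.sum_add_distrib]
    refine Finset.sum_congr rfl fun e _ => ?_
    rw [← mul_add, (hg.evol_deriv_two t' T d).2 e, ← (linSol_deriv_two hQ hg hf t' T d).2 e]
    rfl
  have hpT : (T - t') ^ ((1 - α) / 2) ≤ 1 :=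
    Real.rpow_le_one (by linarith [ht'.2]) (by linarith [ht'.1]) h1α.le
  have a2' : D * D * momentConst D δ₂ (2 + α) * (holderConst D δ₁ α * L
        * ((T - t') ^ ((1 - α) / 2) / ((1 - α) / 2))) * (t' - t) ^ (1 + α / 2)
        + L * momentConst D δ₂ 1 * (t' - t) ^ (1 / 2 : ℝ) * (t' - t)
      ≤ (D * D * momentConst D δ₂ (2 + α) * (holderConst D δ₁ α * L * (1 / ((1 - α) / 2)))
        + L * momentConst D δ₂ 1) * (t' - t) ^ (1 + α / 2) := by
    rw [add_mul]
    refine add_le_add (by gcongr) ?_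
    rw [mul_assoc (L * momentConst D δ₂ 1)]
    gcongr
  have e6 : linSol Q T g f t' y - linSol Q T g f t y - (t' - t) *
        (-(halfTrace (Q t') (hess (linSol Q T g f t') y) + f t' y))
      = -(evol Q t T g y - evol Q t' T g y
          - 1 / 2 * ∑ d, ∑ e, cov Q t t' d e * partialDeriv e (partialDeriv d (evol Q t' T g)) y)
        - (pot Q T f t y - pot Q T f t' y
          - 1 / 2 * ∑ d, ∑ e, cov Q t t' d e * partialDeriv e (partialDeriv d (pot Q T f t')) y
          - ∫ s in Ioc t t', f s y)
        - (halfTrace (cov Q t t') (hess (linSol Q T g f t') y)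
          - (t' - t) * halfTrace (Q t') (hess (linSol Q T g f t') y))
        - ((∫ s in Ioc t t', f s y) - (t' - t) * f t' y) := by
    rw [e5]; simp only [linSol]; ring
  rw [e6]
  have b2 := a2.trans a2'
  rw [abs_le] at a1 b2 a3 a4 ⊢
  constructor <;> linarith [a1.1, a1.2, b2.1, b2.2, a3.1, a3.2, a4.1, a4.2]

/-- The gradients feed back into the nonlinearity: the estimate makes the gradient map continuous
and makes the source at its fixed point Hölder in time. -/
lemma linSol_grad_holder (hQ : IsElliptic δ₁ δ₂ Q) (hT1 : T ≤ 1) (hg : MemHolderTwo α g)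
    (hf : IsSource M L f) : ∃ K : ℝ, 0 ≤ K ∧
      (∀ t ∈ Icc 0 T, ∀ d x y, |partialDeriv d (linSol Q T g f t) x
        - partialDeriv d (linSol Q T g f t) y| ≤ K * ‖x - y‖) ∧
      ∀ t ∈ Icc 0 T, ∀ t' ∈ Icc 0 T, ∀ d y, |partialDeriv d (linSol Q T g f t) y
        - partialDeriv d (linSol Q T g f t') y| ≤ K * |t - t'| ^ (1 / 2 : ℝ) := by
  obtain ⟨B, hB, h1, h2, h3, -⟩ := hg.exists_bound
  have hL := hf.nonneg
  have hM := hf.bound_nonneg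
  have hsc := (smoothConst_pos (D := D) hQ.pos).le
  have hmc := momentConst_nonneg (D := D) hQ.pos'.le 1
  have hpow : ∀ t ∈ Icc 0 T, (T - t) ^ (1 / 2 : ℝ) ≤ 1 := fun t ht =>
    Real.rpow_le_one (by linarith [ht.2]) (by linarith [ht.1]) (by norm_num)
  refine ⟨D * (B + 4 * smoothConst D δ₁ * L) + (D * B * momentConst D δ₂ 1 + (2 * smoothConst D δ₁ * M
    + 4 * smoothConst D δ₁ * L * momentConst D δ₂ 1)), by positivity, fun t ht d x y => ?_,
    fun t ht t' ht' d y => ?_⟩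
  · refine (abs_sub_le_of_partialDeriv (linSol_deriv_two hQ hg hf t T d).1
      (M := B + 4 * smoothConst D δ₁ * L) (fun e y => ?_) x y).trans ?_
    · rw [(linSol_deriv_two hQ hg hf t T d).2 e y]
      refine (abs_add_le _ _).trans (add_le_add (abs_evol_le (h3 d e) y) ?_)
      refine (hf.abs_pot_two_le hQ ht.2 d e y).trans ?_
      exact mul_le_of_le_one_right (by positivity) (hpow t ht)
    · gcongr
      exact le_add_of_nonneg_right (by positivity)
  · wlog htt' : t ≤ t' generalizing t t'
    · rw [abs_sub_comm, abs_sub_comm t]; exact this t' ht' t ht (le_of_not_ge htt')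
    have h0 := sub_nonneg.2 htt'
    rw [abs_sub_comm t, abs_of_nonneg h0]
    rw [(linSol_deriv hQ hg hf t T).2 d, (linSol_deriv hQ hg hf t' T).2 d, add_sub_add_comm]
    have b1 := abs_evol_time_le hQ htt' ht'.2 (p := 1)
      (hg.differentiable_one d).continuous.measurable (h2 d)
      (K := D * B) (by positivity) zero_le_one
      (by simpa using abs_sub_le_of_partialDeriv (hg.differentiable_one d) (h3 d)) y
    have b2 := hf.abs_pot_one_time hQ htt' ht'.2 d y
    refine (abs_add_le _ _).trans ((add_le_add b1 b2).trans ?_)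
    rw [← add_mul]
    refine mul_le_mul_of_nonneg_right ?_ (by positivity)
    have : 4 * smoothConst D δ₁ * L * momentConst D δ₂ 1 * (T - t') ^ (1 / 2 : ℝ)
        ≤ 4 * smoothConst D δ₁ * L * momentConst D δ₂ 1 :=
      mul_le_of_le_one_right (by positivity) (hpow t' ht')
    have : 0 ≤ D * (B + 4 * smoothConst D δ₁ * L) := by positivity
    linarith

/-- Classical solvability of the linear backward equation in the parabolic Hölder space. -/
theorem linSol_solves (hQ : IsElliptic δ₁ δ₂ Q) (hQα : IsTimeHolder α Q) (hα : α ∈ Ioo (0 : ℝ) 1)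
    (hT0 : 0 < T) (hT1 : T ≤ 1) (hg : MemHolderTwo α g) (hf : IsSource M L f) {K : ℝ} (hK : 0 ≤ K)
    (hfK : ∀ s s' y, |f s y - f s' y| ≤ K * |s - s'| ^ (α / 2)) :
    MemParabolicHolderTwo α T (linSol Q T g f) ∧
      (∀ t ∈ Icc 0 T, ∀ y, timeDeriv T (linSol Q T g f) t y
        = -(halfTrace (Q t) (hess (linSol Q T g f t) y) + f t y)) ∧
      ∀ y, linSol Q T g f T y = g y := by
  obtain ⟨B, hB, h1, h2, h3, h4⟩ := hg.exists_bound
  have hL := hf.nonneg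
  have hM := hf.bound_nonneg
  have hsc := (smoothConst_pos (D := D) hQ.pos).le
  have hmc := momentConst_nonneg (D := D) hQ.pos'.le 1
  set u := linSol Q T g f with hu
  have hH := linSol_hess_isParabolicHolder hQ hα hT1 hg hf (T := T)
  obtain ⟨C, hC, hexp⟩ := linSol_expansion hQ hQα hα hT1 hg hf hK hfK (T := T)
  set q : ℝ → Vec D → ℝ := fun t y => -(halfTrace (Q t) (hess (u t) y) + f t y) with hq
  -- A bounded Lipschitz function is `α`-Hölder: for `‖x - y‖ ≤ 1` by the Lipschitz bound, beyond
  -- that by `2 M`.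
  have hfP : IsParabolicHolder α T f := by
    refine IsParabolicHolder.of_bounds (K₁ := 2 * M + L) hα.1 (by positivity) hK
      (fun t _ y => (hf.bddLip t).bdd y) (fun t _ x y => ?_) fun t _ t' _ htt' y => ?_
    · rcases le_total ‖x - y‖ 1 with hxy | hxy
      · refine ((hf.bddLip t).lip x y).trans ?_
        have : ‖x - y‖ ≤ ‖x - y‖ ^ α := by
          rcases (norm_nonneg (x - y)).eq_or_lt with h0 | h0
          · rw [← h0, Real.zero_rpow hα.1.ne']
          · simpa using Real.rpow_le_rpow_of_exponent_ge h0 hxy hα.2.le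
        exact mul_le_mul (by linarith) this (norm_nonneg _) (by positivity)
      · have h5 : 1 ≤ ‖x - y‖ ^ α := Real.one_le_rpow hxy hα.1.le
        have h6 := (hf.bddLip t).bdd x
        have h7 := (hf.bddLip t).bdd y
        have h8 := abs_sub (f t x) (f t y)
        nlinarith
    · have := hfK t t' y
      rwa [abs_sub_comm t t', abs_of_nonneg (sub_nonneg.2 htt')] at this
  obtain ⟨Kq, hKq, hKq'⟩ := hQα
  have hqP : IsParabolicHolder α T q := by
    have hs : IsParabolicHolder α T (fun t y => ∑ d, ∑ e, Q t d e *
        partialDeriv e (partialDeriv d (linSol Q T g f t)) y) :=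
      IsParabolicHolder.sum _ fun d _ => IsParabolicHolder.sum _ fun e _ =>
        (isParabolicHolder_of_time hα.1 hT1 hKq (hKq' d e)).mul (hH d e)
    have := (isParabolicHolder_const (D := D) (α := α) (T := T) (-1)).mul
      (((isParabolicHolder_const (1 / 2)).mul hs).add hfP)
    refine this.congr fun t _ y => ?_
    simp only [hq, halfTrace, hess, Matrix.of_apply, hu]
    ring
  obtain ⟨Kt, hKt, hqb, -, hqt⟩ := hqP.exists_bounds
  -- The small time expansion together with Hölder continuity of the candidate `q` identifies the
  -- time derivative, one-sided at the end points.
  have hderiv : ∀ t ∈ Icc 0 T, ∀ y, HasDerivWithinAt (fun s => u s y) (q t y) (Icc 0 T) t := by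
    intro t ht y
    refine hasDerivWithinAt_of_expansion (φ := fun s => u s y) (q := fun s => q s y) (β := α / 2)
      (C := max C Kt) (half_pos hα.1) (le_max_of_le_left hC)
      (fun s hs s' hs' hss' => ?_) (fun s hs s' hs' => ?_) ht
    · refine (hexp s hs s' hs' hss' y).trans ?_
      have := sub_nonneg.2 hss'
      gcongr
      exact le_max_left _ _
    · refine (hqt s hs s' hs' y).trans ?_
      gcongr
      exact le_max_right _ _
  have htd : ∀ t ∈ Icc 0 T, ∀ y, timeDeriv T u t y = q t y := fun t ht y =>
    (hderiv t ht y).derivWithin (uniqueDiffOn_Icc hT0 t ht)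
  have hgrad_bound : ∀ t ∈ Icc 0 T, ∀ d y, |partialDeriv d (u t) y| ≤ B + L := by
    intro t ht d y
    rw [(linSol_deriv hQ hg hf t T).2 d y]
    refine (abs_add_le _ _).trans (add_le_add (abs_evol_le (h2 d) y) ?_)
    refine (hf.abs_pot_one_le hQ ht.2 d y).trans ?_
    exact mul_le_of_le_one_right hL (by linarith [ht.1])
  have hpow : ∀ t ∈ Icc 0 T, (T - t) ^ (1 / 2 : ℝ) ≤ 1 := fun t ht =>
    Real.rpow_le_one (by linarith [ht.2]) (by linarith [ht.1]) (by norm_num)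
  refine ⟨?_, htd, fun y => ?_⟩
  · refine ⟨fun y t ht => (hderiv t ht y).differentiableWithinAt, fun t _ => ?_, ?_, fun d => ?_,
      ⟨B + M, fun t ht y => ?_⟩, ⟨B + L, fun t ht y d => hgrad_bound t ht d y⟩,
      hqP.congr htd, hH⟩
    · refine contDiff_two_of_partialDeriv (linSol_deriv hQ hg hf t T).1 fun d => ?_
      refine contDiff_one_of_partialDeriv (linSol_deriv_two hQ hg hf t T d).1 fun e => ?_
      have e1 : partialDeriv e (partialDeriv d (linSol Q T g f t)) = fun y =>
        evol Q t T (partialDeriv e (partialDeriv d g)) y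
          + partialDeriv e (partialDeriv d (pot Q T f t)) y :=
        funext ((linSol_deriv_two hQ hg hf t T d).2 e)
      have hc : ∀ {w : Vec D → ℝ} {k : ℝ}, (∀ x y, |w x - w y| ≤ k * ‖x - y‖ ^ α) → Continuous w := by
        intro w k hw
        refine continuous_iff_continuousAt.2 fun y => tendsto_iff_dist_tendsto_zero.2 ?_
        have c1 : Continuous fun x : Vec D => k * ‖x - y‖ ^ α :=
          continuous_const.mul ((continuous_id.sub continuous_const).norm.rpow_const
            fun _ => Or.inr hα.1.le)
        have := c1.tendsto y
        simp only [sub_self, norm_zero, Real.zero_rpow hα.1.ne', mul_zero] at this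
        exact squeeze_zero (fun _ => dist_nonneg) (fun x => hw x y) this
      rw [e1]
      refine (hc (abs_evol_sub_evol_le (ω := fun r => B * r ^ α)
        (measurable_partialDeriv (partialDeriv d g) e) (h3 d e) (h4 d e))).add ?_
      rcases le_total t T with htT | htT
      · exact hc (hf.abs_pot_two_sub_le hQ hα htT d e)
      · rw [funext ((hf.pot_deriv_two hQ t T d).2 e)]
        simp only [Ioc_eq_empty_of_le htT, setIntegral_empty]
        exact continuous_const
    · refine continuousOn_uncurry_of_bounds (β := 1) (K := max (D * (B + L)) Kt) one_pos
        (fun t ht x y => ?_) fun t ht t' ht' y => ?_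
      · refine (abs_sub_le_of_partialDeriv (linSol_deriv hQ hg hf t T).1 (hgrad_bound t ht) x y).trans ?_
        gcongr
        exact le_max_left _ _
      · rw [Real.rpow_one]
        have := (convex_Icc 0 T).norm_image_sub_le_of_norm_hasDerivWithin_le
          (fun s hs => hderiv s hs y) (fun s hs => hqb s hs y) ht' ht
        refine (show _ ≤ _ from this).trans ?_
        rw [Real.norm_eq_abs]
        gcongr
        exact le_max_right _ _
    · obtain ⟨Kg, -, hg1, hg2⟩ := linSol_grad_holder hQ hT1 hg hf (T := T)
      exact continuousOn_uncurry_of_bounds (β := 1 / 2) (h := fun t y => partialDeriv d (u t) y)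
        (by norm_num) (fun t ht => hg1 t ht d) fun t ht t' ht' => hg2 t ht t' ht' d
    · refine (abs_add_le _ _).trans (add_le_add (abs_evol_le h1 y) ?_)
      refine (hf.abs_pot_le ht.2 y).trans ?_
      exact mul_le_of_le_one_right hM (by linarith [ht.1])
  · obtain ⟨B', L', hg'⟩ := hg.exists_bddLip
    simp [hu, linSol, pot, evol_self hQ T hg' y]

end Linear

/-! ### Semilinear systems -/

section Semilinear

variable {D I : ℕ} {δ₁ δ₂ : ℝ} {Q : ℝ → Matrix (Fin D) (Fin D) ℝ} {α : ℝ}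

/-- Nonlinearities in the gradients that are Hölder continuous in time and locally Lipschitz. -/
def IsLocallyLipschitz (α : ℝ) (F : ℝ → (Fin I → Fin D → ℝ) → Fin I → ℝ) : Prop :=
  ∀ R : ℝ, ∃ K : ℝ, 0 ≤ K ∧ (∀ t p i, ‖p‖ ≤ R → |F t p i| ≤ K) ∧
    ∀ t s p q i, ‖p‖ ≤ R → ‖q‖ ≤ R → |F t p i - F s q i| ≤ K * (|t - s| ^ α + ‖p - q‖)

/-- Classical solutions of `∂_t u + (1/2) tr(Q ∂_{yy} u) + F(t, ∂_y u) = 0`, `u(T) = g`. -/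
structure IsSemilinearSol (Q : ℝ → Matrix (Fin D) (Fin D) ℝ)
    (F : ℝ → (Fin I → Fin D → ℝ) → Fin I → ℝ) (g : Fin I → Vec D → ℝ) (α T : ℝ)
    (u : Fin I → ℝ → Vec D → ℝ) : Prop where
  regular : ∀ i, MemParabolicHolderTwo α T (u i)
  pde : ∀ i, ∀ t ∈ Icc 0 T, ∀ y, timeDeriv T (u i) t y + halfTrace (Q t) (hess (u i t) y)
    + F t (fun j => grad (u j t) y) i = 0
  terminal : ∀ i y, u i T y = g i y

/-- Truncation of the time variable to `[0,T]`. -/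
def clamp (T t : ℝ) : ℝ := max 0 (min t T)

lemma clamp_mem {T : ℝ} (hT : 0 ≤ T) (t : ℝ) : clamp T t ∈ Icc 0 T :=
  ⟨le_max_left _ _, max_le hT (min_le_right _ _)⟩

lemma clamp_of_mem {T t : ℝ} (ht : t ∈ Icc 0 T) : clamp T t = t := by
  rw [clamp, min_eq_left ht.2, max_eq_right ht.1]

lemma continuous_clamp (T : ℝ) : Continuous (clamp T) := by unfold clamp; fun_prop

lemma abs_clamp_sub_le (T t s : ℝ) : |clamp T t - clamp T s| ≤ |t - s| := by
  have h1 : |clamp T t - clamp T s| ≤ |min t T - min s T| := by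
    rw [clamp, clamp, max_comm, max_comm 0]
    exact abs_max_sub_max_le_abs _ _ _
  refine h1.trans ((abs_min_sub_min_le_max t T s T).trans (max_le le_rfl ?_))
  simp

variable {F : ℝ → (Fin I → Fin D → ℝ) → Fin I → ℝ} {g : Fin I → Vec D → ℝ}

/-- The sup bound `K` depends only on the radius `R` and not on the Lipschitz constant `L` of `w`;
the two constants can therefore be chosen one after the other. -/
lemma isSource_of_lipschitz {R K L : ℝ} (hα : 0 < α) (hK : 0 ≤ K) (hL : 0 ≤ L)
    (hK1 : ∀ t p i, ‖p‖ ≤ R → |F t p i| ≤ K)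
    (hK2 : ∀ t s p q i, ‖p‖ ≤ R → ‖q‖ ≤ R → |F t p i - F s q i| ≤ K * (|t - s| ^ α + ‖p - q‖))
    {w : ℝ → Vec D → Fin I → Fin D → ℝ} (hw1 : ∀ t y, ‖w t y‖ ≤ R)
    (hw2 : ∀ t x y, ‖w t x - w t y‖ ≤ L * ‖x - y‖) (hw3 : ∀ y, Continuous fun t => w t y) (i : Fin I) :
    IsSource K (K * L) (fun s y => F s (w s y) i) := by
  refine ⟨fun s => ⟨mul_nonneg hK hL, fun y => hK1 _ _ _ (hw1 s y), fun x y => ?_⟩, fun y => ?_⟩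
  · have := hK2 s s (w s x) (w s y) i (hw1 s x) (hw1 s y)
    rw [sub_self, abs_zero, Real.zero_rpow hα.ne', zero_add] at this
    refine this.trans ?_
    rw [mul_assoc]
    exact mul_le_mul_of_nonneg_left (hw2 s x y) hK
  · refine continuous_iff_continuousAt.2 fun s => tendsto_iff_dist_tendsto_zero.2 ?_
    have c1 : Continuous fun r : ℝ => K * (|r - s| ^ α + ‖w r y - w s y‖) := by
      have a1 : Continuous fun r : ℝ => |r - s| ^ α :=
        (continuous_id.sub continuous_const).abs.rpow_const fun _ => Or.inr hα.le
      exact continuous_const.mul (a1.add ((hw3 y).sub continuous_const).norm)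
    have := c1.tendsto s
    simp only [sub_self, abs_zero, Real.zero_rpow hα.ne', norm_zero, add_zero, mul_zero] at this
    exact squeeze_zero (fun _ => dist_nonneg)
      (fun r => hK2 r s (w r y) (w s y) i (hw1 r y) (hw1 s y)) this

/-- The fixed point map for the gradients: `w ↦ ∂_y(P g + ∫ P F(w))`. -/
def gradMap (Q : ℝ → Matrix (Fin D) (Fin D) ℝ) (F : ℝ → (Fin I → Fin D → ℝ) → Fin I → ℝ)
    (g : Fin I → Vec D → ℝ) (T : ℝ) (w : ℝ → Vec D → Fin I → Fin D → ℝ) (t : ℝ) (y : Vec D)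
    (i : Fin I) (d : Fin D) : ℝ :=
  partialDeriv d (linSol Q T (g i) (fun s y => F s (w s y) i) (clamp T t)) y

lemma norm_pi_pi_le {p : Fin I → Fin D → ℝ} {r : ℝ} (hr : 0 ≤ r) (h : ∀ i d, |p i d| ≤ r) :
    ‖p‖ ≤ r := by
  refine (pi_norm_le_iff_of_nonneg hr).2 fun i => (pi_norm_le_iff_of_nonneg hr).2 fun d => ?_
  exact h i d

lemma abs_apply_apply_le (p : Fin I → Fin D → ℝ) (i : Fin I) (d : Fin D) : |p i d| ≤ ‖p‖ :=
  (norm_le_pi_norm (p i) d).trans (norm_le_pi_norm p i)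

/-! ### Invariance and contraction of the gradient map -/

section GradMap

variable {T R K L B : ℝ}

/-- The evolved gradient of the terminal datum contributes `B`; for small `T` the smoothing estimate
keeps the potential below `1`. -/
lemma norm_gradMap_le (hQ : IsElliptic δ₁ δ₂ Q) (hg : ∀ i, MemHolderTwo α (g i)) (hT0 : 0 ≤ T)
    (hB : 0 ≤ B) (hgB : ∀ i d y, |partialDeriv d (g i) y| ≤ B) {w : ℝ → Vec D → Fin I → Fin D → ℝ}
    (hw : ∀ i, IsSource K (K * L) (fun s y => F s (w s y) i)) (hK : 0 ≤ K)
    (hTK : 4 * smoothConst D δ₁ * K * T ^ (1 / 2 : ℝ) ≤ 1) (t : ℝ) (y : Vec D) :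
    ‖gradMap Q F g T w t y‖ ≤ B + 1 := by
  refine norm_pi_pi_le (by linarith) fun i d => ?_
  have hc := clamp_mem hT0 t
  rw [gradMap, (linSol_deriv hQ (hg i) (hw i) _ T).2]
  refine (abs_add_le _ _).trans (add_le_add (abs_evol_le (hgB i d) y) ?_)
  refine ((hw i).abs_pot_one_le_smooth hQ hc.2 d y).trans ?_
  have hsc := (smoothConst_pos (D := D) hQ.pos).le
  have h1 : (T - clamp T t) ^ (1 / 2 : ℝ) ≤ T ^ (1 / 2 : ℝ) :=
    Real.rpow_le_rpow (by linarith [hc.2]) (by linarith [hc.1]) (by norm_num)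
  have h2 : 0 ≤ smoothConst D δ₁ * K * T ^ (1 / 2 : ℝ) := by positivity
  calc 2 * smoothConst D δ₁ * K * (T - clamp T t) ^ (1 / 2 : ℝ)
      ≤ 2 * smoothConst D δ₁ * K * T ^ (1 / 2 : ℝ) := by gcongr
    _ ≤ 1 := by linarith

/-- The Lipschitz constraint reproduces itself: `D * B` comes from the second derivatives of the
data, and the potential, carrying a factor `T^(1/2)`, adds at most `1`. -/
lemma norm_gradMap_sub_le (hQ : IsElliptic δ₁ δ₂ Q) (hg : ∀ i, MemHolderTwo α (g i)) (hT0 : 0 ≤ T)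
    (hB : 0 ≤ B) (hgB : ∀ i d e y, |partialDeriv e (partialDeriv d (g i)) y| ≤ B)
    {w : ℝ → Vec D → Fin I → Fin D → ℝ}
    (hw : ∀ i, IsSource K (K * L) (fun s y => F s (w s y) i)) (hKL : 0 ≤ K * L)
    (hTK : 4 * smoothConst D δ₁ * (K * L) * T ^ (1 / 2 : ℝ) ≤ 1) (t : ℝ) (x y : Vec D) :
    ‖gradMap Q F g T w t x - gradMap Q F g T w t y‖ ≤ (D * B + 1) * ‖x - y‖ := by
  refine norm_pi_pi_le (by positivity) fun i d => ?_
  have hc := clamp_mem hT0 t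
  rw [Pi.sub_apply, Pi.sub_apply, gradMap, gradMap, (linSol_deriv hQ (hg i) (hw i) _ T).2,
    (linSol_deriv hQ (hg i) (hw i) _ T).2, add_sub_add_comm, add_mul]
  refine (abs_add_le _ _).trans (add_le_add ?_ ?_)
  · have hm : Measurable (partialDeriv d (g i)) := ((hg i).differentiable_one d).continuous.measurable
    obtain ⟨B', -, -, h2, -⟩ := (hg i).exists_bound
    exact abs_evol_sub_evol_le (ω := fun r => D * B * r) hm (h2 d)
      (abs_sub_le_of_partialDeriv ((hg i).differentiable_one d) (hgB i d)) x y
  · refine ((hw i).abs_pot_one_sub_le hQ hc.2 d x y).trans ?_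
    have hsc := (smoothConst_pos (D := D) hQ.pos).le
    have h1 : (T - clamp T t) ^ (1 / 2 : ℝ) ≤ T ^ (1 / 2 : ℝ) :=
      Real.rpow_le_rpow (by linarith [hc.2]) (by linarith [hc.1]) (by norm_num)
    refine mul_le_mul_of_nonneg_right (le_trans ?_ hTK) (norm_nonneg _)
    gcongr

lemma continuous_gradMap (hQ : IsElliptic δ₁ δ₂ Q) (hg : ∀ i, MemHolderTwo α (g i)) (hT0 : 0 ≤ T)
    (hT1 : T ≤ 1) {w : ℝ → Vec D → Fin I → Fin D → ℝ}
    (hw : ∀ i, IsSource K (K * L) (fun s y => F s (w s y) i)) :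
    Continuous (fun p : ℝ × Vec D => gradMap Q F g T w p.1 p.2) := by
  refine continuous_pi fun i => continuous_pi fun d => ?_
  obtain ⟨Kg, -, hg1, hg2⟩ := linSol_grad_holder hQ hT1 (hg i) (hw i) (T := T)
  have h := continuousOn_uncurry_of_bounds (β := 1 / 2) (T := T)
    (h := fun t y => partialDeriv d (linSol Q T (g i) (fun s y => F s (w s y) i) t) y)
    (by norm_num) (fun t ht => hg1 t ht d) fun t ht t' ht' => hg2 t ht t' ht' d
  exact h.comp_continuous (f := fun p : ℝ × Vec D => (clamp T p.1, p.2))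
    (((continuous_clamp T).comp continuous_fst).prodMk continuous_snd)
    fun p => ⟨clamp_mem hT0 p.1, mem_univ _⟩

/-- The data cancel, and the sup norm of the difference of the sources suffices because the gradient
of a potential gains an integrable singularity. -/
lemma norm_gradMap_sub_gradMap_le (hQ : IsElliptic δ₁ δ₂ Q) (hα : 0 < α)
    (hg : ∀ i, MemHolderTwo α (g i)) (hT0 : 0 ≤ T)
    (hK2 : ∀ t s p q i, ‖p‖ ≤ R → ‖q‖ ≤ R → |F t p i - F s q i| ≤ K * (|t - s| ^ α + ‖p - q‖))
    {w w' : ℝ → Vec D → Fin I → Fin D → ℝ} (hw1 : ∀ t y, ‖w t y‖ ≤ R) (hw1' : ∀ t y, ‖w' t y‖ ≤ R)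
    (hw : ∀ i, IsSource K (K * L) (fun s y => F s (w s y) i))
    (hw' : ∀ i, IsSource K (K * L) (fun s y => F s (w' s y) i)) (hK : 0 ≤ K)
    (hTK : 4 * smoothConst D δ₁ * K * T ^ (1 / 2 : ℝ) ≤ 1) {ρ : ℝ} (hρ : 0 ≤ ρ)
    (h : ∀ t y, ‖w t y - w' t y‖ ≤ ρ) (t : ℝ) (y : Vec D) :
    ‖gradMap Q F g T w t y - gradMap Q F g T w' t y‖ ≤ 1 / 2 * ρ := by
  refine norm_pi_pi_le (by positivity) fun i d => ?_
  have hc := clamp_mem hT0 t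
  rw [Pi.sub_apply, Pi.sub_apply, gradMap, gradMap, (linSol_deriv hQ (hg i) (hw i) _ T).2,
    (linSol_deriv hQ (hg i) (hw' i) _ T).2, add_sub_add_left_eq_sub]
  have hsc := (smoothConst_pos (D := D) hQ.pos).le
  have h1 : (T - clamp T t) ^ (1 / 2 : ℝ) ≤ T ^ (1 / 2 : ℝ) :=
    Real.rpow_le_rpow (by linarith [hc.2]) (by linarith [hc.1]) (by norm_num)
  refine ((hw i).abs_pot_one_sub_pot_one_le hQ (hw' i) (ε := fun _ => K * ρ) (fun s _ z => ?_)
    ((integrableOn_sub_rpow (by norm_num) _ T).const_mul _) d y).trans ?_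
  · have := hK2 s s (w s z) (w' s z) i (hw1 s z) (hw1' s z)
    rw [sub_self, abs_zero, Real.zero_rpow hα.ne', zero_add] at this
    exact this.trans (mul_le_mul_of_nonneg_left (h s z) hK)
  · rw [integral_const_mul, integral_sub_rpow_neg_half hc.2]
    calc smoothConst D δ₁ * (K * ρ) * (2 * (T - clamp T t) ^ (1 / 2 : ℝ))
        ≤ smoothConst D δ₁ * (K * ρ) * (2 * T ^ (1 / 2 : ℝ)) := by gcongr
      _ = 1 / 2 * (4 * smoothConst D δ₁ * K * T ^ (1 / 2 : ℝ)) * ρ := by ring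
      _ ≤ 1 / 2 * 1 * ρ := by gcongr
      _ = 1 / 2 * ρ := by ring

end GradMap

open scoped BoundedContinuousFunction in
-- Contraction holds in the sup norm only. The spatial Lipschitz constraint survives uniform limits,
-- so it can be imposed on the complete space; it makes every iterate, and the fixed point, an
-- admissible source.
lemma exists_fixedPoint_gradMap (hQ : IsElliptic δ₁ δ₂ Q) (hα : 0 < α)
    (hg : ∀ i, MemHolderTwo α (g i)) {T K B : ℝ} (hT0 : 0 ≤ T) (hT1 : T ≤ 1)
    (hB : 0 ≤ B) (hgB : ∀ i d y, |partialDeriv d (g i) y| ≤ B)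
    (hgB' : ∀ i d e y, |partialDeriv e (partialDeriv d (g i)) y| ≤ B) (hK : 0 ≤ K)
    (hK1 : ∀ t p i, ‖p‖ ≤ B + 1 → |F t p i| ≤ K)
    (hK2 : ∀ t s p q i, ‖p‖ ≤ B + 1 → ‖q‖ ≤ B + 1 →
      |F t p i - F s q i| ≤ K * (|t - s| ^ α + ‖p - q‖))
    (hTK : 4 * smoothConst D δ₁ * (K * (D * B + 1)) * T ^ (1 / 2 : ℝ) ≤ 1) :
    ∃ w : ℝ → Vec D → Fin I → Fin D → ℝ, (∀ t y, ‖w t y‖ ≤ B + 1) ∧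
      (∀ i, IsSource K (K * (D * B + 1)) (fun s y => F s (w s y) i)) ∧
      ∀ t y, w t y = gradMap Q F g T w t y := by
  set L : ℝ := D * B + 1 with hL
  have hL0 : 1 ≤ L := by rw [hL]; linarith [mul_nonneg (Nat.cast_nonneg (α := ℝ) D) hB]
  have hTK' : 4 * smoothConst D δ₁ * K * T ^ (1 / 2 : ℝ) ≤ 1 := by
    refine le_trans ?_ hTK
    have hsc := (smoothConst_pos (D := D) hQ.pos).le
    gcongr
    exact le_mul_of_one_le_right hK hL0
  let X := (ℝ × Vec D) →ᵇ (Fin I → Fin D → ℝ)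
  let S : Set X := {w | (∀ p, ‖w p‖ ≤ B + 1) ∧ ∀ t x y, ‖w (t, x) - w (t, y)‖ ≤ L * ‖x - y‖}
  have hev : ∀ p, Continuous fun w : X => w p := fun p =>
    continuous_eval_const p
  have hS : IsClosed S := by
    have : S = (⋂ p, {w : X | ‖w p‖ ≤ B + 1}) ∩
        ⋂ t, ⋂ x, ⋂ y, {w : X | ‖w (t, x) - w (t, y)‖ ≤ L * ‖x - y‖} := by
      ext w; simp [S]
    rw [this]
    refine (isClosed_iInter fun p => isClosed_le (hev p).norm continuous_const).inter ?_
    exact isClosed_iInter fun t => isClosed_iInter fun x => isClosed_iInter fun y =>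
      isClosed_le ((hev _).sub (hev _)).norm continuous_const
  have hsrc : ∀ w ∈ S, ∀ i, IsSource K (K * L) (fun s y => F s (w (s, y)) i) := fun w hw i =>
    isSource_of_lipschitz (w := fun s y => w (s, y)) hα hK (zero_le_one.trans hL0) hK1 hK2
      (fun t y => hw.1 _) hw.2 (fun y => w.continuous.comp (continuous_id.prodMk continuous_const)) i
  let Φ : S → S := fun w => ⟨BoundedContinuousFunction.ofNormedAddCommGroup
    (fun p : ℝ × Vec D => gradMap Q F g T (fun s y => w.1 (s, y)) p.1 p.2)
    (continuous_gradMap hQ hg hT0 hT1 (hsrc w.1 w.2)) (B + 1)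
    fun p => norm_gradMap_le hQ hg hT0 hB hgB (hsrc w.1 w.2) hK hTK' p.1 p.2,
    fun p => norm_gradMap_le hQ hg hT0 hB hgB (hsrc w.1 w.2) hK hTK' p.1 p.2,
    fun t x y => norm_gradMap_sub_le hQ hg hT0 hB hgB' (hsrc w.1 w.2)
      (mul_nonneg hK (zero_le_one.trans hL0)) hTK t x y⟩
  have : CompleteSpace S := hS.completeSpace_coe
  have : Nonempty S := ⟨⟨0, fun p => by
    rw [BoundedContinuousFunction.coe_zero, Pi.zero_apply, norm_zero]; linarith, fun t x y => by
    rw [BoundedContinuousFunction.coe_zero, Pi.zero_apply, Pi.zero_apply, sub_zero, norm_zero]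
    exact mul_nonneg (zero_le_one.trans hL0) (norm_nonneg (x - y))⟩⟩
  have hΦ : ContractingWith (1 / 2) Φ := by
    refine ⟨by rw [← NNReal.coe_lt_coe]; norm_num, LipschitzWith.of_dist_le_mul fun w w' => ?_⟩
    have e : (((1 / 2 : NNReal)) : ℝ) = 1 / 2 := by norm_num
    rw [e, Subtype.dist_eq, Subtype.dist_eq]
    refine (BoundedContinuousFunction.dist_le (by positivity)).2 fun p => ?_
    rw [dist_eq_norm]
    exact norm_gradMap_sub_gradMap_le hQ hα hg hT0 hK2 (fun t y => w.2.1 _) (fun t y => w'.2.1 _)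
      (hsrc w.1 w.2) (hsrc w'.1 w'.2) hK hTK' dist_nonneg (fun t y => by
        rw [← dist_eq_norm]; exact BoundedContinuousFunction.dist_coe_le_dist _) p.1 p.2
  set w := ContractingWith.fixedPoint Φ hΦ with hw
  have hfix : Φ w = w := hΦ.fixedPoint_isFixedPt
  refine ⟨fun t y => w.1 (t, y), fun t y => w.2.1 _, hsrc w.1 w.2, fun t y => ?_⟩
  conv_lhs => rw [← hfix]
  rfl

/-- For `r ≤ 1` both powers are dominated by `r^(α/2)`; for `r ≥ 1` the uniform bound suffices. -/
lemma abs_le_rpow_half_of {a r K₁ K₂ K₃ : ℝ} (hα : α ∈ Ioo (0 : ℝ) 1) (hr : 0 ≤ r) (h1 : |a| ≤ K₁)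
    (hK₂ : 0 ≤ K₂) (hK₃ : 0 ≤ K₃) (h2 : |a| ≤ K₂ * r ^ α + K₃ * r ^ (1 / 2 : ℝ)) :
    |a| ≤ (K₁ + K₂ + K₃) * r ^ (α / 2) := by
  have hK₁ := (abs_nonneg a).trans h1
  rcases le_total r 1 with hr1 | hr1
  · have a1 := rpow_le_rpow_half hα.1 hr hr1
    have a2 := rpow_half_le_rpow hα hr hr1
    have a3 := Real.rpow_nonneg hr (α / 2)
    nlinarith
  · have : 1 ≤ r ^ (α / 2) := Real.one_le_rpow hr1 (by linarith [hα.1])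
    nlinarith

/-- Local existence for semilinear systems, with a bound on the gradients uniform in the
maturity. -/
theorem exists_isSemilinearSol (hQ : IsElliptic δ₁ δ₂ Q) (hQα : IsTimeHolder α Q)
    (hα : α ∈ Ioo (0 : ℝ) 1) (hF : IsLocallyLipschitz α F) (hg : ∀ i, MemHolderTwo α (g i)) :
    ∃ T₀ ∈ Ioc (0 : ℝ) 1, ∃ K : ℝ, 0 ≤ K ∧ ∀ T ∈ Ioo 0 T₀, ∃ u, IsSemilinearSol Q F g α T u ∧
      ∀ i, ∀ t ∈ Icc 0 T, ∀ d y,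
        |partialDeriv d (u i t) y - evol Q t T (partialDeriv d (g i)) y| ≤ K * (T - t) := by
  choose b hb hb1 hb2 hb3 hb4 using fun i => (hg i).exists_bound
  set B := ∑ i, b i with hBdef
  have hbB : ∀ i, b i ≤ B := fun i => Finset.single_le_sum (fun j _ => hb j) (Finset.mem_univ i)
  have hB : 0 ≤ B := Finset.sum_nonneg fun i _ => hb i
  obtain ⟨K, hK, hK1, hK2⟩ := hF (B + 1)
  set L : ℝ := D * B + 1 with hL
  have hL0 : 0 ≤ L := by positivity
  have hsc := (smoothConst_pos (D := D) hQ.pos).le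
  set k := 4 * smoothConst D δ₁ * (K * L) with hk
  have hk0 : 0 ≤ k := by positivity
  -- This maturity forces `k T^(1/2) ≤ 1`, the smallness required for invariance and contraction.
  -- The gradient constant `K * L` is the spatial Lipschitz constant of the source.
  refine ⟨((k + 1) ^ 2)⁻¹, ⟨by positivity, inv_le_one_of_one_le₀ (by nlinarith)⟩, K * L,
    by positivity, fun T hT => ?_⟩
  have hT1 : T ≤ 1 := hT.2.le.trans (inv_le_one_of_one_le₀ (by nlinarith))
  have hTK : k * T ^ (1 / 2 : ℝ) ≤ 1 := by
    have h1 : T ^ (1 / 2 : ℝ) ≤ (k + 1)⁻¹ := by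
      rw [← Real.sqrt_eq_rpow, ← Real.sqrt_sq (inv_nonneg.2 (by linarith : 0 ≤ k + 1)), inv_pow]
      exact Real.sqrt_le_sqrt hT.2.le
    calc k * T ^ (1 / 2 : ℝ) ≤ (k + 1) * (k + 1)⁻¹ := by
          refine mul_le_mul (by linarith) h1 (Real.rpow_nonneg hT.1.le _) (by linarith)
      _ = 1 := mul_inv_cancel₀ (by positivity)
  obtain ⟨w, hw1, hw2, hw3⟩ := exists_fixedPoint_gradMap hQ hα.1 hg hT.1.le hT1 hB
    (fun i d y => (hb2 i d y).trans (hbB i)) (fun i d e y => (hb3 i d e y).trans (hbB i)) hK hK1 hK2 hTK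
  -- Time regularity is not built into the fixed point space. It is recovered from the fixed point
  -- equation, since gradients of linear solutions are `1/2`-Hölder in time.
  have hwt : ∃ Kt : ℝ, 0 ≤ Kt ∧ ∀ t s y, ‖w t y - w s y‖ ≤ Kt * |t - s| ^ (1 / 2 : ℝ) := by
    choose k hk0 hk1 hk2 using fun i => linSol_grad_holder hQ hT1 (hg i) (hw2 i) (T := T)
    refine ⟨∑ i, k i, Finset.sum_nonneg fun i _ => hk0 i, fun t s y => ?_⟩
    have hsum : 0 ≤ ∑ i, k i := Finset.sum_nonneg fun i _ => hk0 i
    refine norm_pi_pi_le (by positivity) fun i d => ?_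
    rw [Pi.sub_apply, Pi.sub_apply, hw3 t y, hw3 s y]
    refine (hk2 i _ (clamp_mem hT.1.le t) _ (clamp_mem hT.1.le s) d y).trans ?_
    have := abs_clamp_sub_le T t s
    gcongr
    exact Finset.single_le_sum (fun j _ => hk0 j) (Finset.mem_univ i)
  obtain ⟨Kt, hKt, hKt'⟩ := hwt
  have hfK : ∀ i s s' y, |F s (w s y) i - F s' (w s' y) i|
      ≤ (2 * K + K + K * Kt) * |s - s'| ^ (α / 2) := fun i s s' y => by
    refine abs_le_rpow_half_of hα (abs_nonneg _) ?_ hK (by positivity) ?_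
    · refine (abs_sub _ _).trans ?_
      linarith [hK1 s _ i (hw1 s y), hK1 s' _ i (hw1 s' y)]
    · refine (hK2 s s' _ _ i (hw1 s y) (hw1 s' y)).trans ?_
      rw [mul_add, mul_assoc]
      gcongr
      exact hKt' s s' y
  have hsol := fun i => linSol_solves hQ hQα hα hT.1 hT1 (hg i) (hw2 i)
    (by positivity : 0 ≤ 2 * K + K + K * Kt) (hfK i)
  have hgrad : ∀ t ∈ Icc 0 T, ∀ y, (fun j => grad (linSol Q T (g j) (fun s y => F s (w s y) j) t) y)
      = w t y := fun t ht y => by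
    funext j d
    rw [hw3 t y, gradMap, clamp_of_mem ht]
    rfl
  refine ⟨fun i => linSol Q T (g i) (fun s y => F s (w s y) i),
    ⟨fun i => (hsol i).1, fun i t ht y => ?_, fun i y => (hsol i).2.2 y⟩, fun i t ht d y => ?_⟩
  · rw [(hsol i).2.1 t ht y, hgrad t ht y]
    ring
  · rw [(linSol_deriv hQ (hg i) (hw2 i) t T).2, add_sub_cancel_left]
    exact (hw2 i).abs_pot_one_le hQ ht.2 d y

end Semilinear

/-! ### Representation and uniqueness of classical solutions -/

section Uniqueness

variable {D I : ℕ} {δ₁ δ₂ : ℝ} {Q : ℝ → Matrix (Fin D) (Fin D) ℝ} {α T : ℝ}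

lemma evol_const_mul {t s : ℝ} (f : Vec D → ℝ) (c : ℝ) (y : Vec D) :
    evol Q t s (fun y => c * f y) y = c * evol Q t s f y := integral_const_mul _ _

lemma MemParabolicHolderTwo.exists_hess_bound {v : ℝ → Vec D → ℝ}
    (hv : MemParabolicHolderTwo α T v) : ∃ K : ℝ, 0 ≤ K ∧
      (∀ t ∈ Icc 0 T, ∀ d e y, |partialDeriv e (partialDeriv d (v t)) y| ≤ K) ∧
      ∀ t ∈ Icc 0 T, ∀ d e x y, |partialDeriv e (partialDeriv d (v t)) x
        - partialDeriv e (partialDeriv d (v t)) y| ≤ K * ‖x - y‖ ^ α := by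
  choose k hk0 hk1 hk2 hk3 using fun d e => (hv.hess d e).exists_bounds
  have s1 : ∀ d e, k d e ≤ ∑ d, ∑ e, k d e := fun d e =>
    (Finset.single_le_sum (f := fun e => k d e) (fun e _ => hk0 d e) (Finset.mem_univ e)).trans
      (Finset.single_le_sum (f := fun d => ∑ e, k d e)
        (fun d _ => Finset.sum_nonneg fun e _ => hk0 d e) (Finset.mem_univ d))
  refine ⟨∑ d, ∑ e, k d e, Finset.sum_nonneg fun d _ => Finset.sum_nonneg fun e _ => hk0 d e,
    fun t ht d e y => (hk1 d e t ht y).trans (s1 d e), fun t ht d e x y => ?_⟩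
  refine (hk2 d e t ht x y).trans ?_
  gcongr
  exact s1 d e

lemma MemParabolicHolderTwo.measurable {v : ℝ → Vec D → ℝ} (hv : MemParabolicHolderTwo α T v)
    {t : ℝ} (ht : t ∈ Icc 0 T) : Measurable (v t) := (hv.contDiff_space t ht).continuous.measurable

lemma MemParabolicHolderTwo.differentiable {v : ℝ → Vec D → ℝ} (hv : MemParabolicHolderTwo α T v)
    {t : ℝ} (ht : t ∈ Icc 0 T) : Differentiable ℝ (v t) :=
  (hv.contDiff_space t ht).differentiable (by norm_num)

lemma MemParabolicHolderTwo.differentiable_one {v : ℝ → Vec D → ℝ}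
    (hv : MemParabolicHolderTwo α T v) {t : ℝ} (ht : t ∈ Icc 0 T) (d : Fin D) :
    Differentiable ℝ (partialDeriv d (v t)) :=
  (contDiff_partialDeriv (hv.contDiff_space t ht) d).differentiable (by norm_num)

variable {M L : ℝ} {f : ℝ → Vec D → ℝ}

/-- One step consistency of a classical solution with the evolution family. -/
lemma MemParabolicHolderTwo.step (hQ : IsElliptic δ₁ δ₂ Q) (hQα : IsTimeHolder α Q)
    (hα : α ∈ Ioo (0 : ℝ) 1) (hT1 : T ≤ 1) {v : ℝ → Vec D → ℝ}
    (hv : MemParabolicHolderTwo α T v)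
    (hpde : ∀ t ∈ Icc 0 T, ∀ y, RadnerTaylor.timeDeriv T v t y
      + halfTrace (Q t) (RadnerTaylor.hess (v t) y) + f t y = 0) :
    ∃ C : ℝ, 0 ≤ C ∧ ∀ s ∈ Icc 0 T, ∀ s' ∈ Icc 0 T, s ≤ s' → ∀ y,
      |evol Q s s' (v s') y - (v s y - (s' - s) * f s' y)| ≤ C * (s' - s) ^ (1 + α / 2) := by
  obtain ⟨Kh, hKh, hh1, hh2⟩ := hv.exists_hess_bound
  obtain ⟨Kt, hKt, -, -, ht3⟩ := hv.timeDeriv.exists_bounds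
  obtain ⟨Kq, hKq, hKq'⟩ := hQα
  obtain ⟨Mv, hMv⟩ := hv.bounded
  have hmc := momentConst_nonneg (D := D) hQ.pos'.le (2 + α)
  refine ⟨D * D * momentConst D δ₂ (2 + α) * Kh + D * D * Kq * Kh + Kt, by positivity,
    fun s hs s' hs' hss' y => ?_⟩
  have h0 := sub_nonneg.2 hss'
  have a1 := evol_taylor hQ hss' (hv.differentiable hs') (hv.differentiable_one hs') (hMv s' hs')
    hα.1 hKh (hh2 s' hs') y
  have a2 := abs_halfTrace_cov_sub_le hQ hα.1 hKq hKq' hss' (by linarith [hs.1, hs'.2])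
    (H := RadnerTaylor.hess (v s') y) (fun d e => hh1 s' hs' d e y) hKh
  have a3 : |v s' y - v s y - (s' - s) * RadnerTaylor.timeDeriv T v s' y|
      ≤ Kt * (s' - s) ^ (1 + α / 2) := by
    have hsub : Icc s s' ⊆ Icc 0 T := Icc_subset_Icc hs.1 hs'.2
    -- Mean value inequality after subtracting the linear function of slope `∂_t v(s')`; the
    -- remaining derivative is small because `∂_t v` is `α/2`-Hölder in time.
    have key := (convex_Icc s s').norm_image_sub_le_of_norm_hasDerivWithin_le
      (f := fun r => v r y - r * RadnerTaylor.timeDeriv T v s' y)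
      (f' := fun r => RadnerTaylor.timeDeriv T v r y - 1 * RadnerTaylor.timeDeriv T v s' y)
      (C := Kt * (s' - s) ^ (α / 2)) (fun r hr =>
        ((hv.differentiableOn_time y r (hsub hr)).hasDerivWithinAt.mono hsub).sub
          ((hasDerivAt_id r).mul_const _).hasDerivWithinAt)
      (fun r hr => by
        rw [one_mul]
        refine (ht3 r (hsub hr) s' hs' y).trans ?_
        have : |r - s'| ≤ s' - s := by
          rw [abs_sub_comm, abs_of_nonneg (by linarith [hr.2])]; linarith [hr.1]
        have := hα.1
        gcongr)
      (left_mem_Icc.2 hss') (right_mem_Icc.2 hss')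
    rw [Real.norm_eq_abs, Real.norm_eq_abs, abs_of_nonneg h0] at key
    rw [Real.rpow_add_of_nonneg h0 zero_le_one (by linarith [hα.1]), Real.rpow_one]
    calc |v s' y - v s y - (s' - s) * RadnerTaylor.timeDeriv T v s' y|
        = |v s' y - s' * RadnerTaylor.timeDeriv T v s' y
          - (v s y - s * RadnerTaylor.timeDeriv T v s' y)| := by congr 1; ring
      _ ≤ Kt * (s' - s) ^ (α / 2) * (s' - s) := key
      _ = _ := by ring
  have e1 : evol Q s s' (v s') y - (v s y - (s' - s) * f s' y)
      = (evol Q s s' (v s') y - v s' y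
          - 1 / 2 * ∑ d, ∑ e, cov Q s s' d e * partialDeriv e (partialDeriv d (v s')) y)
        + (halfTrace (cov Q s s') (RadnerTaylor.hess (v s') y)
          - (s' - s) * halfTrace (Q s') (RadnerTaylor.hess (v s') y))
        + (v s' y - v s y - (s' - s) * RadnerTaylor.timeDeriv T v s' y) := by
    have e2 : halfTrace (cov Q s s') (RadnerTaylor.hess (v s') y)
      = 1 / 2 * ∑ d, ∑ e, cov Q s s' d e * partialDeriv e (partialDeriv d (v s')) y := rfl
    rw [e2]
    -- The first order terms cancel by the equation at the later time `s'`, leaving three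
    -- remainders.
    linear_combination (s' - s) * hpde s' hs' y
  rw [e1]
  refine (abs_add_le _ _).trans ((add_le_add ((abs_add_le _ _).trans (add_le_add a1 a2)) a3).trans ?_)
  rw [add_mul, add_mul]

/-- Classical solutions of the linear equation are given by the representation formula. -/
theorem MemParabolicHolderTwo.eq_linSol (hQ : IsElliptic δ₁ δ₂ Q) (hQα : IsTimeHolder α Q)
    (hα : α ∈ Ioo (0 : ℝ) 1) (hT1 : T ≤ 1) {v : ℝ → Vec D → ℝ}
    (hv : MemParabolicHolderTwo α T v) (hf : IsSource M L f)
    (hpde : ∀ t ∈ Icc 0 T, ∀ y, RadnerTaylor.timeDeriv T v t y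
      + halfTrace (Q t) (RadnerTaylor.hess (v t) y) + f t y = 0) {t : ℝ} (ht : t ∈ Icc 0 T)
    (y : Vec D) : v t y = linSol Q T (v T) f t y := by
  obtain ⟨C, hC, hstep⟩ := hv.step hQ hQα hα hT1 hpde
  obtain ⟨Mv, hMv⟩ := hv.bounded
  obtain ⟨Kq, hKq, hKq'⟩ := id hQα
  -- Hölder continuity of the source in time follows from the equation, since all its other terms
  -- are Hölder.
  have hfP : IsParabolicHolder α T f := by
    have hs : IsParabolicHolder α T (fun t y => ∑ d, ∑ e, Q t d e *
        partialDeriv e (partialDeriv d (v t)) y) :=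
      IsParabolicHolder.sum _ fun d _ => IsParabolicHolder.sum _ fun e _ =>
        (isParabolicHolder_of_time hα.1 hT1 hKq (hKq' d e)).mul (hv.hess d e)
    refine ((isParabolicHolder_const (-1)).mul (((isParabolicHolder_const (1 / 2)).mul hs).add
      hv.timeDeriv)).congr fun t ht y => ?_
    have := hpde t ht y
    simp only [halfTrace, RadnerTaylor.hess, Matrix.of_apply] at this
    linarith
  obtain ⟨Kf, hKf, -, -, hf3⟩ := hfP.exists_bounds
  have hL := hf.nonneg
  have hmc := momentConst_nonneg (D := D) hQ.pos'.le 1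
  -- Duhamel interpolation: `ψ t` is `v t y` and `ψ T` is the representation formula. Its increments
  -- are of order `(s'-s)^(1+α/2)`, so its derivative vanishes and it is constant.
  set ψ : ℝ → ℝ := fun s => evol Q t s (v s) y + pot Q s f t y with hψ
  set C' := C + (L * momentConst D δ₂ 1 + Kf) with hC'
  have hsub : Icc t T ⊆ Icc 0 T := Icc_subset_Icc_left ht.1
  have key : ∀ s ∈ Icc t T, ∀ s' ∈ Icc t T, s ≤ s' →
      |ψ s' - ψ s - (s' - s) * 0| ≤ C' * (s' - s) ^ (1 + α / 2) := by
    intro s hs s' hs' hss'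
    have h0 := sub_nonneg.2 hss'
    have h01 : s' - s ≤ 1 := by linarith [ht.1, hs.1, hs'.2]
    have hb' := hf.bddLip s'
    have mv := hv.measurable (hsub hs)
    have mv' := hv.measurable (hsub hs')
    have mf : Measurable fun y => (s' - s) * f s' y := hb'.measurable.const_mul _
    have a1 : |evol Q t s' (v s') y - (evol Q t s (v s) y - (s' - s) * evol Q t s (f s') y)|
        ≤ C * (s' - s) ^ (1 + α / 2) := by
      rw [evol_comp hQ hs.1 hss' mv' (hMv s' (hsub hs')), ← evol_const_mul,
        ← evol_sub mv mf (hMv s (hsub hs))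
          (M' := (s' - s) * M) (fun y => by
            rw [abs_mul, abs_of_nonneg h0]
            exact mul_le_mul_of_nonneg_left (hb'.bdd y) h0)]
      refine abs_evol_sub_le (M := Mv) (M' := Mv + (s' - s) * M) (evol_measurable mv')
        (mv.sub mf) (abs_evol_le (hMv s' (hsub hs')))
        (fun y => (abs_sub _ _).trans (add_le_add (hMv s (hsub hs) y) ?_))
        (hstep s (hsub hs) s' (hsub hs') hss') y
      rw [abs_mul, abs_of_nonneg h0]
      exact mul_le_mul_of_nonneg_left (hb'.bdd y) h0
    have a2 : |(∫ r in Ioc s s', evol Q t r (f r) y) - (s' - s) * evol Q t s (f s') y|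
        ≤ (L * momentConst D δ₂ 1 + Kf) * (s' - s) ^ (1 + α / 2) := by
      have hi : IntegrableOn (fun r => evol Q t r (f r) y) (Ioc s s') :=
        (hf.integrable_evol hQ t s' y).mono_set (Ioc_subset_Ioc_left hs.1)
      have e1 : (∫ r in Ioc s s', evol Q t r (f r) y) - (s' - s) * evol Q t s (f s') y
          = ∫ r in Ioc s s', (evol Q t r (f r) y - evol Q t s (f s') y) := by
        rw [integral_sub hi (integrable_const _), setIntegral_const, smul_eq_mul,
          Real.volume_real_Ioc_of_le hss']
      have := abs_setIntegral_le (G := fun r => evol Q t r (f r) y - evol Q t s (f s') y)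
        (t := s) (T := s') (b := fun _ => (L * momentConst D δ₂ 1 + Kf) * (s' - s) ^ (α / 2))
        (integrable_const _) fun r hr => by
          have hbr := hf.bddLip r
          have hrT : r ∈ Icc 0 T := ⟨ht.1.trans (hs.1.trans hr.1.le), hr.2.trans hs'.2⟩
          rw [evol_comp hQ hs.1 hr.1.le hbr.measurable hbr.bdd]
          refine abs_evol_sub_le (evol_measurable hbr.measurable) hb'.measurable
            (abs_evol_le hbr.bdd) hb'.bdd (fun z => ?_) y
          have b1 := abs_evol_sub_self_le hQ hr.1.le hbr.measurable hbr.bdd hbr.nonneg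
            zero_le_one (by simpa using hbr.lip) z
          have b2 := hf3 r hrT s' (hsub hs') z
          have c1 : (r - s) ^ (1 / 2 : ℝ) ≤ (s' - s) ^ (α / 2) :=
            (Real.rpow_le_rpow (by linarith [hr.1]) (by linarith [hr.2]) (by norm_num)).trans
              (rpow_half_le_rpow hα h0 h01)
          have c2 : |r - s'| ^ (α / 2) ≤ (s' - s) ^ (α / 2) := by
            refine Real.rpow_le_rpow (abs_nonneg _) ?_ (by linarith [hα.1])
            rw [abs_sub_comm, abs_of_nonneg (by linarith [hr.2])]; linarith [hr.1]
          refine (abs_sub_le _ (f r z) _).trans ((add_le_add b1 b2).trans ?_)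
          rw [add_mul]
          gcongr
      rw [e1]
      rw [setIntegral_const, smul_eq_mul, Real.volume_real_Ioc_of_le hss'] at this
      refine this.trans (le_of_eq ?_)
      rw [Real.rpow_add_of_nonneg h0 zero_le_one (by linarith [hα.1]), Real.rpow_one]
      ring
    have e2 : ψ s' - ψ s - (s' - s) * 0
        = (evol Q t s' (v s') y - (evol Q t s (v s) y - (s' - s) * evol Q t s (f s') y))
          + ((∫ r in Ioc s s', evol Q t r (f r) y) - (s' - s) * evol Q t s (f s') y) := by
      simp only [hψ, pot]
      rw [setIntegral_Ioc_split hs.1 hss' (hf.integrable_evol hQ t s' y)]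
      ring
    rw [e2, hC', add_mul]
    exact (abs_add_le _ _).trans (add_le_add a1 a2)
  have hC'0 : 0 ≤ C' := by positivity
  have hder : ∀ s ∈ Icc t T, HasDerivWithinAt ψ 0 (Icc t T) s := fun s hs =>
    hasDerivWithinAt_of_expansion (q := fun _ => 0) (half_pos hα.1) hC'0 key
      (fun _ _ _ _ => by rw [sub_self, abs_zero]; positivity) hs
  have hconst := (convex_Icc t T).norm_image_sub_le_of_norm_hasDerivWithin_le (C := 0) hder
    (fun s _ => by simp) (left_mem_Icc.2 ht.2) (right_mem_Icc.2 ht.2)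
  rw [zero_mul, norm_le_zero_iff, sub_eq_zero] at hconst
  have hlip : BddLip Mv (D * hv.bounded_grad.choose ⊔ 0) (v t) := by
    refine ⟨le_max_right _ _, hMv t ht, fun x z => ?_⟩
    refine (abs_sub_le_of_partialDeriv (hv.differentiable ht)
      (fun d z => hv.bounded_grad.choose_spec t ht z d) x z).trans ?_
    gcongr
    exact le_max_left _ _
  have e0 : ψ t = v t y := by simp [hψ, pot, evol_self hQ t hlip y]
  rw [← e0, ← hconst]
  rfl

/-- The exponent `1/4` is small enough that the product with the kernel `(s-t)^(-1/2)` is still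
integrable. -/
lemma exp_neg_le_rpow {x : ℝ} (hx : 0 < x) : Real.exp (-x) ≤ x ^ (-(1 / 4) : ℝ) := by
  rw [Real.exp_neg, Real.rpow_neg hx.le]
  refine inv_anti₀ (by positivity) ?_
  rcases le_total x 1 with h | h
  · exact (Real.rpow_le_one hx.le h (by norm_num)).trans (Real.one_le_exp hx.le)
  · calc x ^ (1 / 4 : ℝ) ≤ x ^ (1 : ℝ) := Real.rpow_le_rpow_of_exponent_le h (by norm_num)
      _ = x := Real.rpow_one x
      _ ≤ Real.exp x := by linarith [Real.add_one_le_exp x]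

/-- Exponential weights make singular Volterra kernels contractive. -/
lemma exists_weight (c : ℝ) (hc : 0 ≤ c) : ∃ k : ℝ, ∀ t T : ℝ, t ≤ T → T - t ≤ 1 →
    IntegrableOn (fun s => c * Real.exp (k * (T - s)) * (s - t) ^ (-(1 / 2) : ℝ)) (Ioc t T) ∧
      ∫ s in Ioc t T, c * Real.exp (k * (T - s)) * (s - t) ^ (-(1 / 2) : ℝ)
        ≤ 1 / 2 * Real.exp (k * (T - t)) := by
  -- The weight turns the kernel into `c k^(-1/4) (s-t)^(-3/4)`, whose integral is at most `4 c / (8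
  -- c + 1) ≤ 1/2` on an interval of length at most one.
  set k : ℝ := (8 * c + 1) ^ 4 with hk
  have hk0 : 0 < k := by positivity
  have hk4 : k ^ (-(1 / 4) : ℝ) = (8 * c + 1)⁻¹ := by
    rw [hk, ← Real.rpow_natCast, ← Real.rpow_mul (by positivity)]
    norm_num
    rw [Real.rpow_neg_one]
  refine ⟨k, fun t T htT h1 => ?_⟩
  have hb : ∀ s ∈ Ioc t T, c * Real.exp (k * (T - s)) * (s - t) ^ (-(1 / 2) : ℝ)
      ≤ c * (8 * c + 1)⁻¹ * Real.exp (k * (T - t)) * (s - t) ^ (-(3 / 4) : ℝ) := by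
    intro s hs
    have h0 : 0 < s - t := sub_pos.2 hs.1
    have e1 : Real.exp (k * (T - s)) = Real.exp (k * (T - t)) * Real.exp (-(k * (s - t))) := by
      rw [← Real.exp_add]; congr 1; ring
    have e2 := exp_neg_le_rpow (mul_pos hk0 h0)
    rw [Real.mul_rpow hk0.le h0.le, hk4] at e2
    have e3 : (s - t) ^ (-(3 / 4) : ℝ) = (s - t) ^ (-(1 / 4) : ℝ) * (s - t) ^ (-(1 / 2) : ℝ) := by
      rw [← Real.rpow_add h0]; norm_num
    rw [e1, e3]
    calc c * (Real.exp (k * (T - t)) * Real.exp (-(k * (s - t)))) * (s - t) ^ (-(1 / 2) : ℝ)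
        ≤ c * (Real.exp (k * (T - t)) * ((8 * c + 1)⁻¹ * (s - t) ^ (-(1 / 4) : ℝ)))
          * (s - t) ^ (-(1 / 2) : ℝ) := by gcongr
      _ = _ := by ring
  have hi : IntegrableOn (fun s => c * (8 * c + 1)⁻¹ * Real.exp (k * (T - t))
      * (s - t) ^ (-(3 / 4) : ℝ)) (Ioc t T) :=
    (integrableOn_sub_rpow (by norm_num) t T).const_mul _
  have hi2 : IntegrableOn (fun s => c * Real.exp (k * (T - s)) * (s - t) ^ (-(1 / 2) : ℝ))
      (Ioc t T) := by
    refine hi.mono' ?_ ((ae_restrict_mem measurableSet_Ioc).mono fun s hs => ?_)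
    · exact Measurable.aestronglyMeasurable (by fun_prop)
    · have h0 : 0 < s - t := sub_pos.2 hs.1
      rw [Real.norm_of_nonneg (by positivity)]
      exact hb s hs
  refine ⟨hi2, (setIntegral_mono_on hi2 hi measurableSet_Ioc hb).trans ?_⟩
  rw [integral_const_mul, integral_sub_rpow (by norm_num) htT]
  have h2 : (T - t) ^ (-(3 / 4) + 1 : ℝ) ≤ 1 :=
    Real.rpow_le_one (by linarith) h1 (by norm_num)
  have h3 : c * (8 * c + 1)⁻¹ ≤ 1 / 8 := by
    rw [← div_eq_mul_inv, div_le_iff₀ (by positivity)]; linarith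
  have h4 : (T - t) ^ (-(3 / 4) + 1 : ℝ) / (-(3 / 4) + 1) ≤ 4 := by
    rw [div_le_iff₀ (by norm_num)]; linarith
  have h5 : 0 ≤ (T - t) ^ (-(3 / 4) + 1 : ℝ) / (-(3 / 4) + 1) :=
    div_nonneg (Real.rpow_nonneg (by linarith) _) (by norm_num)
  calc c * (8 * c + 1)⁻¹ * Real.exp (k * (T - t)) * ((T - t) ^ (-(3 / 4) + 1 : ℝ) / (-(3 / 4) + 1))
      ≤ 1 / 8 * Real.exp (k * (T - t)) * 4 := by gcongr
    _ = _ := by ring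

variable {F : ℝ → (Fin I → Fin D → ℝ) → Fin I → ℝ} {g : Fin I → Vec D → ℝ}

/-- The gradients of the components of `u`, with truncated time variable. -/
def clampGrad (T : ℝ) (u : Fin I → ℝ → Vec D → ℝ) (t : ℝ) (y : Vec D) : Fin I → Fin D → ℝ :=
  fun j => grad (u j (clamp T t)) y

lemma IsSemilinearSol.clampGrad_bounds {u : Fin I → ℝ → Vec D → ℝ} (hT0 : 0 ≤ T)
    (hu : IsSemilinearSol Q F g α T u) : ∃ R : ℝ, 0 ≤ R ∧ (∀ t y, ‖clampGrad T u t y‖ ≤ R) ∧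
      (∀ t x y, ‖clampGrad T u t x - clampGrad T u t y‖ ≤ R * ‖x - y‖) ∧
      ∀ y, Continuous fun t => clampGrad T u t y := by
  choose m hm using fun i => (hu.regular i).bounded_grad
  choose k hk0 hk1 hk2 using fun i => (hu.regular i).exists_hess_bound
  set R := ∑ i, |m i| + ∑ i, D * k i with hR
  have n1 : 0 ≤ ∑ i, |m i| := Finset.sum_nonneg fun _ _ => abs_nonneg _
  have n2 : 0 ≤ ∑ i, D * k i := Finset.sum_nonneg fun i _ => mul_nonneg (Nat.cast_nonneg _) (hk0 i)
  refine ⟨R, by positivity, fun t y => norm_pi_pi_le (by positivity) fun i d => ?_,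
    fun t x y => norm_pi_pi_le (by positivity) fun i d => ?_, fun y => ?_⟩
  · refine (hm i _ (clamp_mem hT0 t) y d).trans ((le_abs_self _).trans ?_)
    have := Finset.single_le_sum (f := fun i => |m i|) (fun _ _ => abs_nonneg _) (Finset.mem_univ i)
    linarith
  · refine (abs_sub_le_of_partialDeriv ((hu.regular i).differentiable_one (clamp_mem hT0 t) d)
      (hk1 i _ (clamp_mem hT0 t) d) x y).trans ?_
    have := Finset.single_le_sum (f := fun i => D * k i)
      (fun i _ => mul_nonneg (Nat.cast_nonneg _) (hk0 i)) (Finset.mem_univ i)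
    exact mul_le_mul_of_nonneg_right (by linarith) (norm_nonneg _)
  · refine continuous_pi fun i => continuous_pi fun d => ?_
    exact ((hu.regular i).continuousOn_grad d).comp_continuous
      (f := fun t : ℝ => (clamp T t, y)) ((continuous_clamp T).prodMk continuous_const)
      fun t => ⟨clamp_mem hT0 t, mem_univ _⟩

/-- Uniqueness of classical solutions of semilinear systems. -/
theorem IsSemilinearSol.unique (hQ : IsElliptic δ₁ δ₂ Q) (hQα : IsTimeHolder α Q)
    (hα : α ∈ Ioo (0 : ℝ) 1) (hF : IsLocallyLipschitz α F) (hg : ∀ i, MemHolderTwo α (g i))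
    (hT0 : 0 ≤ T) (hT1 : T ≤ 1) {u v : Fin I → ℝ → Vec D → ℝ}
    (hu : IsSemilinearSol Q F g α T u) (hv : IsSemilinearSol Q F g α T v) (i : Fin I)
    {t : ℝ} (ht : t ∈ Icc 0 T) (y : Vec D) : u i t y = v i t y := by
  obtain ⟨R₁, hR₁, hu1, hu2, hu3⟩ := hu.clampGrad_bounds hT0
  obtain ⟨R₂, hR₂, hv1, hv2, hv3⟩ := hv.clampGrad_bounds hT0
  obtain ⟨K, hK, hK1, hK2⟩ := hF (R₁ + R₂)
  have hu1' : ∀ t y, ‖clampGrad T u t y‖ ≤ R₁ + R₂ := fun t y => (hu1 t y).trans (by linarith)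
  have hv1' : ∀ t y, ‖clampGrad T v t y‖ ≤ R₁ + R₂ := fun t y => (hv1 t y).trans (by linarith)
  have su := isSource_of_lipschitz hα.1 hK hR₁ hK1 hK2 hu1' hu2 hu3
  have sv := isSource_of_lipschitz hα.1 hK hR₂ hK1 hK2 hv1' hv2 hv3
  -- With its own gradients frozen in the nonlinearity, a solution of the system solves a linear
  -- equation and obeys the representation formula.
  have ru : ∀ i, ∀ t ∈ Icc 0 T, ∀ y, u i t y
      = linSol Q T (g i) (fun s y => F s (clampGrad T u s y) i) t y := fun i t ht y => by
    rw [(hu.regular i).eq_linSol hQ hQα hα hT1 (su i) (fun t ht y => ?_) ht y,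
      funext (hu.terminal i)]
    have e : clampGrad T u t y = fun j => grad (u j t) y := by
      unfold clampGrad; rw [clamp_of_mem ht]
    simpa only [e] using hu.pde i t ht y
  have rv : ∀ i, ∀ t ∈ Icc 0 T, ∀ y, v i t y
      = linSol Q T (g i) (fun s y => F s (clampGrad T v s y) i) t y := fun i t ht y => by
    rw [(hv.regular i).eq_linSol hQ hQα hα hT1 (sv i) (fun t ht y => ?_) ht y,
      funext (hv.terminal i)]
    have e : clampGrad T v t y = fun j => grad (v j t) y := by
      unfold clampGrad; rw [clamp_of_mem ht]
    simpa only [e] using hv.pde i t ht y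
  have hsc := (smoothConst_pos (D := D) hQ.pos).le
  obtain ⟨k, hk⟩ := exists_weight (smoothConst D δ₁ * K) (mul_nonneg hsc hK)
  have hKlip : ∀ s y i, |F s (clampGrad T u s y) i - F s (clampGrad T v s y) i|
      ≤ K * ‖clampGrad T u s y - clampGrad T v s y‖ := fun s y i => by
    have := hK2 s s _ _ i (hu1' s y) (hv1' s y)
    rwa [sub_self, abs_zero, Real.zero_rpow hα.1.ne', zero_add] at this
  -- Picard iteration in the weighted norm: a bound on the gradient difference improves by the
  -- factor `1/2`, for any `T ≤ 1`.
  have halve : ∀ N : ℝ, 0 ≤ N →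
      (∀ t ∈ Icc 0 T, ∀ y, ‖clampGrad T u t y - clampGrad T v t y‖ ≤ N * Real.exp (k * (T - t))) →
      ∀ t ∈ Icc 0 T, ∀ y, ‖clampGrad T u t y - clampGrad T v t y‖
        ≤ 1 / 2 * N * Real.exp (k * (T - t)) := by
    intro N hN h t ht y
    refine norm_pi_pi_le (by positivity) fun i d => ?_
    obtain ⟨k1, k2⟩ := hk t T ht.2 (by linarith [ht.1])
    have e1 : clampGrad T u t y i d - clampGrad T v t y i d
        = partialDeriv d (pot Q T (fun s y => F s (clampGrad T u s y) i) t) y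
          - partialDeriv d (pot Q T (fun s y => F s (clampGrad T v s y) i) t) y := by
      simp only [clampGrad, clamp_of_mem ht, grad]
      rw [partialDeriv_congr (ru i t ht), partialDeriv_congr (rv i t ht),
        (linSol_deriv hQ (hg i) (su i) t T).2, (linSol_deriv hQ (hg i) (sv i) t T).2,
        add_sub_add_left_eq_sub]
    rw [Pi.sub_apply, Pi.sub_apply, e1]
    have e2 : ∀ s, smoothConst D δ₁ * (K * (N * Real.exp (k * (T - s)))) * (s - t) ^ (-(1 / 2) : ℝ)
        = N * (smoothConst D δ₁ * K * Real.exp (k * (T - s)) * (s - t) ^ (-(1 / 2) : ℝ)) :=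
      fun s => by ring
    refine ((su i).abs_pot_one_sub_pot_one_le hQ (sv i)
      (ε := fun s => K * (N * Real.exp (k * (T - s)))) (fun s hs z => ?_) ?_ d y).trans ?_
    · exact (hKlip s z i).trans (mul_le_mul_of_nonneg_left
        (h s ⟨ht.1.trans hs.1.le, hs.2⟩ z) hK)
    · simp_rw [e2]
      exact k1.const_mul N
    · simp_rw [e2]
      rw [integral_const_mul]
      calc N * ∫ s in Ioc t T, smoothConst D δ₁ * K * Real.exp (k * (T - s)) * (s - t) ^ (-(1 / 2) : ℝ)
          ≤ N * (1 / 2 * Real.exp (k * (T - t))) := mul_le_mul_of_nonneg_left k2 hN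
        _ = _ := by ring
  -- The factor `exp |k T|` starts the iteration without information on the sign of `k`.
  have hall : ∀ n : ℕ, ∀ t ∈ Icc 0 T, ∀ y, ‖clampGrad T u t y - clampGrad T v t y‖
      ≤ (1 / 2) ^ n * ((R₁ + R₂) * Real.exp |k * T|) * Real.exp (k * (T - t)) := by
    intro n
    induction n with
    | zero =>
      intro t ht y
      refine (norm_sub_le _ _).trans ((add_le_add (hu1 t y) (hv1 t y)).trans ?_)
      rw [pow_zero, one_mul, mul_assoc, ← Real.exp_add]
      refine le_mul_of_one_le_right (by positivity) (Real.one_le_exp ?_)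
      have h1 : |k * (T - t)| ≤ |k * T| := by
        rw [abs_mul, abs_mul]
        refine mul_le_mul_of_nonneg_left ?_ (abs_nonneg _)
        rw [abs_of_nonneg (sub_nonneg.2 ht.2), abs_of_nonneg hT0]
        linarith [ht.1]
      linarith [neg_abs_le (k * (T - t))]
    | succ n ih =>
      intro t ht y
      refine (halve _ (by positivity) ih t ht y).trans (le_of_eq ?_)
      rw [pow_succ]; ring
  have hzero : ∀ t ∈ Icc 0 T, ∀ y, clampGrad T u t y = clampGrad T v t y := by
    intro t ht y
    have hlim : Tendsto (fun n : ℕ => (1 / 2 : ℝ) ^ n * ((R₁ + R₂) * Real.exp |k * T|)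
        * Real.exp (k * (T - t))) atTop (𝓝 0) := by
      have := ((tendsto_pow_atTop_nhds_zero_of_lt_one (by norm_num : (0 : ℝ) ≤ 1 / 2)
        (by norm_num)).mul_const ((R₁ + R₂) * Real.exp |k * T|)).mul_const (Real.exp (k * (T - t)))
      simpa using this
    have := ge_of_tendsto' hlim fun n => hall n t ht y
    exact sub_eq_zero.1 (norm_le_zero_iff.1 this)
  rw [ru i t ht, rv i t ht, linSol, linSol, pot, pot]
  congr 1
  refine setIntegral_congr_fun measurableSet_Ioc fun s hs => ?_
  congr 1
  funext z
  rw [hzero s ⟨ht.1.trans hs.1.le, hs.2⟩]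

end Uniqueness

/-! ### Continuously differentiable vector fields -/

section VectorField

variable {E F P : Type*} [NormedAddCommGroup E] [NormedSpace ℝ E] [FiniteDimensional ℝ E]
  [NormedAddCommGroup F] [NormedSpace ℝ F] [NormedAddCommGroup P] [NormedSpace ℝ P]
  [FiniteDimensional ℝ P]

lemma exists_bound_of_contDiff {Φ : E → F} (hΦ : ContDiff ℝ 1 Φ) (R : ℝ) : ∃ K : ℝ, 0 ≤ K ∧
    (∀ x, ‖x‖ ≤ R → ‖Φ x‖ ≤ K) ∧ ∀ x y, ‖x‖ ≤ R → ‖y‖ ≤ R → ‖Φ x - Φ y‖ ≤ K * ‖x - y‖ := by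
  have := FiniteDimensional.proper ℝ E
  have hc : IsCompact (Metric.closedBall (0 : E) R) := isCompact_closedBall 0 R
  obtain ⟨k, hk⟩ := hΦ.contDiffOn.exists_lipschitzOnWith one_ne_zero (convex_closedBall 0 R) hc
  obtain ⟨m, hm⟩ := hc.exists_bound_of_continuousOn hΦ.continuous.continuousOn
  refine ⟨max k m, le_max_of_le_left k.2, fun x hx => (hm x (by simpa using hx)).trans
    (le_max_right _ _), fun x y hx hy => ?_⟩
  have := hk.dist_le_mul x (by simpa using hx) y (by simpa using hy)
  rw [dist_eq_norm, dist_eq_norm] at this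
  exact this.trans (mul_le_mul_of_nonneg_right (le_max_left _ _) (norm_nonneg _))

/-- Solvability of non-autonomous equations with time-reversed coefficients on an interval that
does not depend on the maturity, and the linear growth of their solutions. -/
theorem exists_uniform_ode_time {Φ : P × E → E} (hΦ : ContDiff ℝ 1 Φ) {c : ℝ → P}
    (hc : Continuous c) {R : ℝ} (hR : ∀ t, ‖c t‖ ≤ R) (x₀ : E) :
    ∃ S ∈ Ioc (0 : ℝ) 1, ∃ K : ℝ, 0 ≤ K ∧ ∀ T ∈ Icc 0 S,
      (∃ x : ℝ → E, x 0 = x₀ ∧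
        ∀ s ∈ Icc 0 T, HasDerivWithinAt x (Φ (c (T - s), x s)) (Icc 0 T) s) ∧
      ∀ x : ℝ → E, x 0 = x₀ →
        (∀ s ∈ Icc 0 T, HasDerivWithinAt x (Φ (c (T - s), x s)) (Icc 0 T) s) →
        ∀ s ∈ Icc 0 T, ‖x s - x₀‖ ≤ K * s := by
  obtain ⟨K, hK, hK1, hK2⟩ := exists_bound_of_contDiff hΦ (max R (‖x₀‖ + 1))
  have hball : ∀ x : E, ‖x - x₀‖ ≤ 1 → ∀ t, ‖(c t, x)‖ ≤ max R (‖x₀‖ + 1) := fun x hx t => by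
    rw [Prod.norm_def]
    refine max_le_max (hR t) ?_
    have := norm_le_norm_add_norm_sub' x x₀
    linarith
  have hK' : (0 : ℝ) < K + 1 := by linarith
  -- The field is bounded by `K` as long as the solution stays within distance `1` of `x₀`, which
  -- takes at least the time `1 / (K + 1)`. The bound on `c` makes this time the same for all
  -- maturities.
  refine ⟨(K + 1)⁻¹, ⟨by positivity, inv_le_one_of_one_le₀ (by linarith)⟩, K + 1, hK'.le,
    fun T hT => ?_⟩
  have hTK : (K + 1) * T ≤ 1 := by
    have := mul_le_mul_of_nonneg_left hT.2 hK'.le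
    rwa [mul_inv_cancel₀ hK'.ne'] at this
  constructor
  · have := FiniteDimensional.complete ℝ E
    have hPL : IsPicardLindelof (fun s x => Φ (c (T - s), x)) (tmin := 0) (tmax := T)
        ⟨0, left_mem_Icc.2 hT.1⟩ x₀ 1 0 ⟨K, hK⟩ ⟨K, hK⟩ := by
      refine ⟨fun t _ => LipschitzOnWith.of_dist_le_mul fun x hx y hy => ?_, fun x _ => ?_,
        fun t _ x hx => ?_, ?_⟩
      · have := hK2 _ _ (hball x (by simpa [dist_eq_norm] using hx) (T - t))
          (hball y (by simpa [dist_eq_norm] using hy) (T - t))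
        rw [Prod.mk_sub_mk, sub_self, Prod.norm_mk, norm_zero, max_eq_right (norm_nonneg _)] at this
        rw [dist_eq_norm, dist_eq_norm]
        exact this
      · exact (hΦ.continuous.comp ((hc.comp (continuous_const.sub continuous_id)).prodMk
          continuous_const)).continuousOn
      · exact hK1 _ (hball x (by simpa [dist_eq_norm] using hx) (T - t))
      · simp only [sub_zero, sub_self, max_eq_left hT.1, NNReal.coe_one, NNReal.coe_zero]
        change K * T ≤ 1
        linarith [hT.1]
    exact hPL.exists_eq_forall_mem_Icc_hasDerivWithinAt₀
  · intro x hx0 hx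
    -- Barrier argument valid for every solution: when the deviation touches the line of slope `K +
    -- 1` it is at most `1`, so its speed is at most `K`, strictly below the slope.
    refine image_norm_le_of_norm_deriv_right_lt_deriv_boundary
      (f := fun s => x s - x₀) (f' := fun s => Φ (c (T - s), x s)) (B' := fun _ => K + 1)
      (fun s hs => ((hx s hs).continuousWithinAt).sub continuousWithinAt_const) (fun s hs => ?_)
      (by simp [hx0]) (fun s => ?_) fun s hs hs' => ?_
    · have := ((hx s (Ico_subset_Icc_self hs)).mono_of_mem_nhdsWithin
        (Icc_mem_nhdsGE_of_mem hs) : HasDerivWithinAt x _ (Ici s) s)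
      exact this.sub_const x₀
    · simpa using (hasDerivAt_id s).const_mul (K + 1)
    · have h1 : ‖x s - x₀‖ ≤ 1 := by
        rw [hs']
        exact (mul_le_mul_of_nonneg_left hs.2.le hK'.le).trans hTK
      exact (hK1 _ (hball _ h1 (T - s))).trans_lt (by linarith)

end VectorField

/-! ### Volatility matrices extended to all times -/

section Volatility

variable {D I N : ℕ} {α : ℝ} {C : ℝ → Matrix (Fin D) (Fin D) ℝ}

lemma isTimeHolder_clamp (hα : 0 < α)
    (hC : ∃ K : ℝ, ∀ s ∈ Icc (0 : ℝ) 1, ∀ t ∈ Icc (0 : ℝ) 1, ∀ d e,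
      |C t d e - C s d e| ≤ K * |t - s| ^ α) : IsTimeHolder α fun t => C (clamp 1 t) := by
  obtain ⟨K, hK⟩ := hC
  refine ⟨|K|, abs_nonneg _, fun d e t s => ?_⟩
  refine (hK _ (clamp_mem zero_le_one s) _ (clamp_mem zero_le_one t) d e).trans ?_
  have h1 : |clamp 1 t - clamp 1 s| ^ α ≤ |t - s| ^ α :=
    Real.rpow_le_rpow (abs_nonneg _) (abs_clamp_sub_le 1 t s) hα.le
  exact mul_le_mul (le_abs_self K) h1 (by positivity) (abs_nonneg _)

lemma exists_bound_clamp (hα : 0 < α)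
    (hC : ∃ K : ℝ, ∀ s ∈ Icc (0 : ℝ) 1, ∀ t ∈ Icc (0 : ℝ) 1, ∀ d e,
      |C t d e - C s d e| ≤ K * |t - s| ^ α) :
    ∃ M : ℝ, 0 ≤ M ∧ ∀ t d e, |C (clamp 1 t) d e| ≤ M := by
  obtain ⟨K, hK⟩ := hC
  refine ⟨|K| + ∑ d, ∑ e, |C 0 d e|, by positivity, fun t d e => ?_⟩
  have hc := clamp_mem zero_le_one t
  have h1 := hK 0 (left_mem_Icc.2 zero_le_one) _ hc d e
  have h2 : |clamp 1 t - 0| ^ α ≤ 1 :=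
    Real.rpow_le_one (abs_nonneg _) (by rw [sub_zero, abs_of_nonneg hc.1]; exact hc.2) hα.le
  have h3 : |C 0 d e| ≤ ∑ d, ∑ e, |C 0 d e| :=
    (Finset.single_le_sum (f := fun e => |C 0 d e|) (fun _ _ => abs_nonneg _)
      (Finset.mem_univ e)).trans (Finset.single_le_sum (f := fun d => ∑ e, |C 0 d e|)
        (fun _ _ => Finset.sum_nonneg fun _ _ => abs_nonneg _) (Finset.mem_univ d))
  have h4 : K * |clamp 1 t - 0| ^ α ≤ |K| :=
    (mul_le_mul_of_nonneg_right (le_abs_self K) (by positivity)).trans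
      (mul_le_of_le_one_right (abs_nonneg _) h2)
  have := abs_sub_abs_le_abs_sub (C (clamp 1 t) d e) (C 0 d e)
  linarith

lemma IsTimeHolder.continuous (hα : 0 < α) (hC : IsTimeHolder α C) : Continuous C := by
  obtain ⟨K, hK, hK'⟩ := hC
  refine continuous_matrix fun d e => continuous_iff_continuousAt.2 fun s =>
    tendsto_iff_dist_tendsto_zero.2 ?_
  have c1 : Continuous fun r : ℝ => K * |r - s| ^ α :=
    continuous_const.mul ((continuous_id.sub continuous_const).abs.rpow_const
      fun _ => Or.inr hα.le)
  have := c1.tendsto s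
  simp only [sub_self, abs_zero, Real.zero_rpow hα.ne', mul_zero] at this
  exact squeeze_zero (fun _ => dist_nonneg) (fun r => hK' d e r s) this

end Volatility

/-! ### The Riccati system -/

section Riccati

variable {D I N : ℕ} {α : ℝ}

/-- The values of the unknowns `(β, γ)` of the Riccati system. -/
abbrev RiccatiState (I D : ℕ) : Type := (Fin I → Fin D → ℝ) × (Fin I → Fin D → Fin D → ℝ)

/-- The right-hand side of the Riccati system. -/
def riccatiField (hND : N ≤ D) (a : Fin I → ℝ) (z : (Fin D → Fin D → ℝ) × RiccatiState I D) :
    RiccatiState I D :=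
  (fun i d => riccatiBeta hND a (Matrix.of z.1) z.2.1 (fun k => Matrix.of (z.2.2 k)) i d,
    fun i d e => riccatiGamma hND a (Matrix.of z.1) (fun k => Matrix.of (z.2.2 k)) i d e)

lemma contDiff_riccatiField (hND : N ≤ D) (a : Fin I → ℝ) :
    ContDiff ℝ 1 (riccatiField (I := I) hND a) := by
  refine ContDiff.prodMk (contDiff_pi.2 fun i => contDiff_pi.2 fun d => ?_)
    (contDiff_pi.2 fun i => contDiff_pi.2 fun d => contDiff_pi.2 fun e => ?_)
  · simp only [riccatiBeta, firstCols, Pi.add_apply, Pi.sub_apply, Pi.smul_apply, Matrix.mulVec,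
      dotProduct, Matrix.mul_apply, Matrix.sub_apply, Matrix.add_apply, Matrix.transpose_apply,
      Matrix.sum_apply, Matrix.submatrix_apply, Finset.sum_apply, Matrix.of_apply, smul_eq_mul]
    fun_prop
  · simp only [riccatiGamma, firstCols, Matrix.mul_apply, Matrix.sub_apply, Matrix.add_apply,
      Matrix.transpose_apply, Matrix.sum_apply, Matrix.submatrix_apply, Matrix.smul_apply,
      Matrix.of_apply, smul_eq_mul]
    fun_prop

/-- The system becomes a single equation in a normed space. Truncating calendar time to `[0,1]`
changes nothing, as `0 ≤ T - s ≤ 1`. -/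
lemma isRiccatiSolution_iff {hND : N ≤ D} {a : Fin I → ℝ} {C : ℝ → Matrix (Fin D) (Fin D) ℝ}
    {h : Fin I → Fin D → ℝ} {j : Fin I → Matrix (Fin D) (Fin D) ℝ} {T : ℝ} (hT : T ≤ 1)
    {β : Fin I → ℝ → Fin D → ℝ} {γ : Fin I → ℝ → Matrix (Fin D) (Fin D) ℝ} :
    IsRiccatiSolution hND a C h j T β γ ↔
      ((fun i => β i 0, fun i d e => γ i 0 d e) : RiccatiState I D)
        = (h, fun i d e => (1 / 2) * j i d e) ∧
      ∀ s ∈ Icc 0 T, HasDerivWithinAt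
        (fun s => ((fun i => β i s, fun i d e => γ i s d e) : RiccatiState I D))
        (riccatiField hND a (fun d e => C (clamp 1 (T - s)) d e,
          (fun i => β i s, fun i d e => γ i s d e))) (Icc 0 T) s := by
  have hcl : ∀ s ∈ Icc 0 T, clamp 1 (T - s) = T - s := fun s hs =>
    clamp_of_mem ⟨by linarith [hs.2], by linarith [hs.1]⟩
  constructor
  · intro H
    refine ⟨Prod.ext (funext fun i => H.beta_zero i) (funext fun i => funext fun d =>
      funext fun e => by simp [H.gamma_zero i]), fun s hs => HasDerivWithinAt.prodMk
      (hasDerivWithinAt_pi.2 fun i => hasDerivWithinAt_pi.2 fun d => ?_)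
      (hasDerivWithinAt_pi.2 fun i => hasDerivWithinAt_pi.2 fun d =>
        hasDerivWithinAt_pi.2 fun e => ?_)⟩
    · rw [hcl s hs]
      exact H.beta_deriv i s hs d
    · rw [hcl s hs]
      exact H.gamma_deriv i s hs d e
  · rintro ⟨H0, H⟩
    have H1 : ∀ s ∈ Icc 0 T, _ := fun s hs =>
      hasFDerivAt_fst.comp_hasDerivWithinAt (𝕜 := ℝ) s (H s hs)
    have H2 : ∀ s ∈ Icc 0 T, _ := fun s hs =>
      hasFDerivAt_snd.comp_hasDerivWithinAt (𝕜 := ℝ) s (H s hs)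
    refine ⟨fun i s hs d e => ?_, fun i s hs d => ?_, fun i => ?_, fun i => ?_⟩
    · have := hasDerivWithinAt_pi.1 (hasDerivWithinAt_pi.1 (hasDerivWithinAt_pi.1 (H2 s hs) i) d) e
      rw [hcl s hs] at this
      exact this
    · have := hasDerivWithinAt_pi.1 (hasDerivWithinAt_pi.1 (H1 s hs) i) d
      rw [hcl s hs] at this
      exact this
    · ext d e
      exact congrFun (congrFun (congrFun (Prod.ext_iff.1 H0).2 i) d) e
    · exact congrFun (Prod.ext_iff.1 H0).1 i

/-- Short time solvability of the Riccati system, uniformly in the maturity, and the deviation of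
its solutions from the initial values. -/
theorem exists_riccati_time (hND : N ≤ D) (a : Fin I → ℝ) {C : ℝ → Matrix (Fin D) (Fin D) ℝ}
    (hα : 0 < α)
    (hC : ∃ K : ℝ, ∀ s ∈ Icc (0 : ℝ) 1, ∀ t ∈ Icc (0 : ℝ) 1, ∀ d e,
      |C t d e - C s d e| ≤ K * |t - s| ^ α)
    (h : Fin I → Fin D → ℝ) (j : Fin I → Matrix (Fin D) (Fin D) ℝ) :
    ∃ S ∈ Ioc (0 : ℝ) 1, ∃ K : ℝ, 0 ≤ K ∧ ∀ T ∈ Icc 0 S,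
      (∃ β γ, IsRiccatiSolution hND a C h j T β γ) ∧
      ∀ β γ, IsRiccatiSolution hND a C h j T β γ → ∀ s ∈ Icc 0 T, ∀ i d,
        |β i s d - h i d| ≤ K * s ∧ ∀ e, |γ i s d e - 1 / 2 * j i d e| ≤ K * s := by
  have hCh := isTimeHolder_clamp hα hC
  obtain ⟨M, hM, hCM⟩ := exists_bound_clamp hα hC
  have hcc : Continuous fun t => (fun d e => C (clamp 1 t) d e : Fin D → Fin D → ℝ) :=
    hCh.continuous hα
  have hR : ∀ t, ‖(fun d e => C (clamp 1 t) d e : Fin D → Fin D → ℝ)‖ ≤ M := fun t =>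
    norm_pi_pi_le hM fun d e => hCM t d e
  obtain ⟨S, hS, K, hK, H⟩ := exists_uniform_ode_time (contDiff_riccatiField (I := I) hND a) hcc hR
    (h, fun i d e => 1 / 2 * j i d e)
  refine ⟨S, hS, K, hK, fun T hT => ⟨?_, fun β γ hβγ s hs => ?_⟩⟩
  · obtain ⟨x, hx0, hx⟩ := (H T hT).1
    refine ⟨fun i s d => (x s).1 i d, fun i s => Matrix.of fun d e => (x s).2 i d e,
      (isRiccatiSolution_iff (hT.2.trans hS.2)).2 ⟨hx0, hx⟩⟩
  · obtain ⟨h0, h1⟩ := (isRiccatiSolution_iff (hT.2.trans hS.2)).1 hβγ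
    have hn := (H T hT).2 _ h0 h1 s hs
    intro i d
    rw [Prod.norm_def] at hn
    have n1 := (le_max_left _ _).trans hn
    have n2 := (le_max_right _ _).trans hn
    refine ⟨(abs_apply_apply_le _ i d).trans n1, fun e => ?_⟩
    set w : Fin I → Fin D → Fin D → ℝ :=
      (fun i d e => γ i s d e) - fun i d e => 1 / 2 * j i d e with hw
    exact ((norm_le_pi_norm (w i d) e).trans ((norm_le_pi_norm (w i) d).trans
      (norm_le_pi_norm w i))).trans n2

/-- The uniform existence time belongs to the set whose supremum is taken. -/
lemma riccatiMaturity_pos (hND : N ≤ D) (a : Fin I → ℝ) {C : ℝ → Matrix (Fin D) (Fin D) ℝ}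
    (hα : 0 < α)
    (hC : ∃ K : ℝ, ∀ s ∈ Icc (0 : ℝ) 1, ∀ t ∈ Icc (0 : ℝ) 1, ∀ d e,
      |C t d e - C s d e| ≤ K * |t - s| ^ α)
    (h : Fin I → Fin D → ℝ) (j : Fin I → Matrix (Fin D) (Fin D) ℝ) :
    0 < riccatiMaturity hND a C h j := by
  obtain ⟨S, hS, K, -, H⟩ := exists_riccati_time hND a hα hC h j
  refine lt_of_lt_of_le (EReal.coe_pos.2 hS.1) (le_sSup fun T hT hTS => ?_)
  exact (H T ⟨hT.1.le, (EReal.coe_lt_coe_iff.1 hTS).le⟩).1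

end Riccati

/-! ### Second moments of Wiener integrals -/

section Moments

variable {Ω : Type*} {D : ℕ} {W : Fin D → ℝ → Ω → ℝ} {C : ℝ → Matrix (Fin D) (Fin D) ℝ}

/-- The increment of the `d`-th coordinate over the `k`-th interval of the partition `k t / n`. -/
def increment (W : Fin D → ℝ → Ω → ℝ) (n : ℕ) (t : ℝ) (p : ℕ × Fin D) (ω : Ω) : ℝ :=
  W p.2 ((p.1 + 1) * t / n) ω - W p.2 (p.1 * t / n) ω

lemma grid_mem {n k : ℕ} {t : ℝ} (ht : t ∈ Icc (0 : ℝ) 1) (hk : k ≤ n) :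
    (k : ℝ) * t / n ∈ Icc (0 : ℝ) 1 := by
  have h0 := ht.1
  refine ⟨by positivity, div_le_one_of_le₀ ?_ (Nat.cast_nonneg n)⟩
  have : (k : ℝ) ≤ n := Nat.cast_le.2 hk
  nlinarith [ht.2, (Nat.cast_nonneg k : (0 : ℝ) ≤ k)]

lemma riemannSum_apply (n : ℕ) (t : ℝ) (ω : Ω) (i : Fin D) : riemannSum C W n t ω i
    = ∑ p ∈ Finset.range n ×ˢ Finset.univ, C (p.1 * t / n) i p.2 * increment W n t p ω := by
  rw [riemannSum, Finset.sum_product, WithLp.ofLp_sum, Finset.sum_apply]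
  rfl

variable [MeasurableSpace Ω] {P : Measure Ω}

lemma eLpNorm_two_eq {f : Ω → Vec D} (hf : MemLp f 2 P) :
    eLpNorm f 2 P = ENNReal.ofReal (√(∫ ω, ‖f ω‖ ^ 2 ∂P)) := by
  rw [hf.eLpNorm_eq_integral_rpow_norm (by norm_num) (by norm_num), Real.sqrt_eq_rpow]
  norm_num

lemma hasLaw_increment (hW : IsBrownianVector W P) {n : ℕ} {t : ℝ} (ht : t ∈ Icc (0 : ℝ) 1)
    {p : ℕ × Fin D} (hp : p.1 < n) :
    HasLaw (increment W n t p) (gaussianReal 0 (t / n).toNNReal) P := by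
  have h1 := grid_mem ht hp.le
  have h2 := grid_mem ht (Nat.succ_le_of_lt hp)
  push_cast at h2
  have h3 : (p.1 : ℝ) * t / n ≤ (p.1 + 1) * t / n := by
    have := ht.1
    gcongr
    linarith
  have := (hW.coord p.2).hasLaw _ _ h1.1 h3 h2.2
  rwa [show ((p.1 : ℝ) + 1) * t / n - p.1 * t / n = t / n by ring] at this

/-- Within one coordinate this is independence of increments; across coordinates it is independence
of the processes, composed with evaluation at two times. -/
lemma indepFun_increment (hW : IsBrownianVector W P) {n : ℕ} {t : ℝ} (ht : t ∈ Icc (0 : ℝ) 1)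
    {p q : ℕ × Fin D} (hp : p.1 < n) (hq : q.1 < n) (hpq : p ≠ q) :
    IndepFun (increment W n t p) (increment W n t q) P := by
  obtain ⟨k, d⟩ := p
  obtain ⟨l, e⟩ := q
  simp only at hp hq
  rcases eq_or_ne d e with rfl | hde
  · have hkl : k ≠ l := fun h => hpq (by rw [h])
    -- Clamping extends the partition to a monotone sequence of times indexed by all of `ℕ`, leaving
    -- the points with `k ≤ n` unchanged.
    set τ : ℕ → Icc (0 : ℝ) 1 := fun k => ⟨clamp 1 (k * t / n), clamp_mem zero_le_one _⟩
    have hτ : Monotone τ := fun k l hkl => by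
      have h0 := ht.1
      refine Subtype.mk_le_mk.2 (max_le_max le_rfl (min_le_min ?_ le_rfl))
      gcongr
    have hτ' : ∀ k, k ≤ n → (τ k : ℝ) = k * t / n := fun k hk => clamp_of_mem (grid_mem ht hk)
    have := ((hW.coord d).indepIncrements.nat hτ).indepFun hkl
    simp only [hτ' k hp.le, hτ' l hq.le, hτ' (k + 1) hp, hτ' (l + 1) hq, Nat.cast_add,
      Nat.cast_one] at this
    exact this
  · have h1 : ∀ k, k < n → Measurable fun w : Icc (0 : ℝ) 1 → ℝ =>
        w ⟨clamp 1 ((k + 1) * t / n), clamp_mem zero_le_one _⟩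
          - w ⟨clamp 1 (k * t / n), clamp_mem zero_le_one _⟩ := fun k _ => by fun_prop
    have h2 : ∀ k : ℕ, k < n → ∀ d, increment W n t (k, d)
        = (fun w : Icc (0 : ℝ) 1 → ℝ => w ⟨clamp 1 ((k + 1) * t / n), clamp_mem zero_le_one _⟩
          - w ⟨clamp 1 (k * t / n), clamp_mem zero_le_one _⟩) ∘
          fun (ω : Ω) (t : Icc (0 : ℝ) 1) => W d t ω := fun k hk d => by
      funext ω
      have g2 := grid_mem ht (Nat.succ_le_of_lt hk)
      push_cast at g2
      simp only [increment, Function.comp_apply, clamp_of_mem (grid_mem ht hk.le), clamp_of_mem g2]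
    rw [h2 k hp, h2 l hq]
    exact (hW.indep.indepFun hde).comp (by fun_prop) (by fun_prop)

lemma memLp_increment (hW : IsBrownianVector W P) {n : ℕ} {t : ℝ} (ht : t ∈ Icc (0 : ℝ) 1)
    {p : ℕ × Fin D} (hp : p.1 < n) : MemLp (increment W n t p) 2 P := by
  have h := hasLaw_increment hW ht hp
  have := memLp_id_gaussianReal (μ := 0) (v := (t / n).toNNReal) 2
  rw [← h.map_eq] at this
  exact this.comp_of_map h.aemeasurable

variable [IsProbabilityMeasure P]

/-- Second moment of a linear combination of increments. -/
lemma integral_sq_sum_increment (hW : IsBrownianVector W P) {n : ℕ} {t : ℝ}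
    (ht : t ∈ Icc (0 : ℝ) 1) (c : ℕ × Fin D → ℝ) :
    MemLp (fun ω => ∑ p ∈ Finset.range n ×ˢ Finset.univ, c p * increment W n t p ω) 2 P ∧
    ∫ ω, (∑ p ∈ Finset.range n ×ˢ Finset.univ, c p * increment W n t p ω) ^ 2 ∂P
      = ∑ p ∈ Finset.range n ×ˢ Finset.univ, c p ^ 2 * (t / n) := by
  have hmem : ∀ p ∈ Finset.range n ×ˢ (Finset.univ : Finset (Fin D)), p.1 < n := fun p hp =>
    Finset.mem_range.1 (Finset.mem_product.1 hp).1
  have hL : ∀ p ∈ Finset.range n ×ˢ (Finset.univ : Finset (Fin D)),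
      MemLp (fun ω => c p * increment W n t p ω) 2 P := fun p hp =>
    (memLp_increment hW ht (hmem p hp)).const_mul (c p)
  have hsum := memLp_finsetSum _ hL
  refine ⟨hsum, ?_⟩
  have hmean : ∫ ω, (∑ p ∈ Finset.range n ×ˢ Finset.univ, c p * increment W n t p ω) ∂P = 0 := by
    rw [integral_finsetSum _ fun p hp => (hL p hp).integrable one_le_two]
    refine Finset.sum_eq_zero fun p hp => ?_
    rw [integral_const_mul, (hasLaw_increment hW ht (hmem p hp)).integral_eq,
      integral_id_gaussianReal, mul_zero]
  rw [← variance_of_integral_eq_zero hsum.aemeasurable hmean]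
  have := IndepFun.variance_sum hL fun p hp q hq hpq =>
    (indepFun_increment hW ht (hmem p hp) (hmem q hq) hpq).comp
      (φ := fun x => c p * x) (ψ := fun x => c q * x) (by fun_prop) (by fun_prop)
  rw [show (∑ p ∈ Finset.range n ×ˢ Finset.univ, fun ω => c p * increment W n t p ω)
    = fun ω => ∑ p ∈ Finset.range n ×ˢ Finset.univ, c p * increment W n t p ω from
      funext fun ω => Finset.sum_apply _ _ _] at this
  rw [this]
  refine Finset.sum_congr rfl fun p hp => ?_
  have h0 : 0 ≤ t / n := div_nonneg ht.1 (Nat.cast_nonneg n)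
  rw [variance_const_mul, (hasLaw_increment hW ht (hmem p hp)).variance_eq, variance_id_gaussianReal,
    Real.coe_toNNReal _ h0]

/-- Each coordinate is a sum of `n D` pairwise independent centred terms with variance at most `M² t
/ n`; the number of partition points cancels. -/
lemma integral_norm_sq_riemannSum_le (hW : IsBrownianVector W P) {M : ℝ}
    (hC : ∀ t ∈ Icc (0 : ℝ) 1, ∀ d e, |C t d e| ≤ M) (n : ℕ) {t : ℝ} (ht : t ∈ Icc (0 : ℝ) 1) :
    MemLp (riemannSum C W n t) 2 P ∧
    ∫ ω, ‖riemannSum C W n t ω‖ ^ 2 ∂P ≤ (D * D * M ^ 2) * t := by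
  have h := fun i => integral_sq_sum_increment hW (n := n) ht fun p => C (p.1 * t / n) i p.2
  simp only [← riemannSum_apply] at h
  refine ⟨MemLp.of_eval_piLp fun i => (h i).1, ?_⟩
  simp_rw [EuclideanSpace.norm_sq_eq, Real.norm_eq_abs, sq_abs]
  rw [integral_finsetSum _ fun i _ => (h i).1.integrable_sq]
  have h0 : 0 ≤ t / n := div_nonneg ht.1 (Nat.cast_nonneg n)
  calc ∑ i, ∫ ω, riemannSum C W n t ω i ^ 2 ∂P
      ≤ ∑ i : Fin D, n * D * (M ^ 2 * (t / n)) := by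
        refine Finset.sum_le_sum fun i _ => ?_
        rw [(h i).2]
        refine (Finset.sum_le_card_nsmul _ _ (M ^ 2 * (t / n)) fun p hp => ?_).trans (le_of_eq ?_)
        · have := hC _ (grid_mem ht (Finset.mem_range.1 (Finset.mem_product.1 hp).1).le) i p.2
          refine mul_le_mul_of_nonneg_right ?_ h0
          rw [← sq_abs]
          exact pow_le_pow_left₀ (abs_nonneg _) this 2
        · simp
    _ = (D * D * M ^ 2) * (n * (t / n)) := by simp; ring
    _ ≤ (D * D * M ^ 2) * t := by
        refine mul_le_mul_of_nonneg_left ?_ (by positivity)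
        -- For `n = 0` the convention `t / 0 = 0` makes the left side zero.
        rcases Nat.eq_zero_or_pos n with rfl | hn
        · simpa using ht.1
        · have : (n : ℝ) ≠ 0 := by positivity
          rw [mul_div_cancel₀ _ this]

/-- Wiener integrals are square integrable with linearly growing second moments. -/
theorem IsWienerIntegral.integral_norm_sq_le (hW : IsBrownianVector W P) {Y : ℝ → Ω → Vec D}
    (hY : IsWienerIntegral C W Y P) {M : ℝ} (hC : ∀ t ∈ Icc (0 : ℝ) 1, ∀ d e, |C t d e| ≤ M)
    {t : ℝ} (ht : t ∈ Icc (0 : ℝ) 1) :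
    MemLp (Y t) 2 P ∧ ∫ ω, ‖Y t ω‖ ^ 2 ∂P ≤ (D * D * M ^ 2) * t := by
  obtain ⟨hm, hlim⟩ := hY t ht
  -- The bound on the Riemann sums is uniform in `n` and passes to the `L²` limit by the triangle
  -- inequality.
  have hb : ∀ n, eLpNorm (Y t) 2 P ≤ eLpNorm (fun ω => riemannSum C W n t ω - Y t ω) 2 P
      + ENNReal.ofReal (√((D * D * M ^ 2) * t)) := fun n => by
    obtain ⟨h1, h2⟩ := integral_norm_sq_riemannSum_le hW hC n ht
    have h3 : eLpNorm (riemannSum C W n t) 2 P ≤ ENNReal.ofReal (√((D * D * M ^ 2) * t)) := by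
      rw [eLpNorm_two_eq h1]
      exact ENNReal.ofReal_le_ofReal (Real.sqrt_le_sqrt h2)
    have h4 : Y t = riemannSum C W n t - fun ω => riemannSum C W n t ω - Y t ω := by
      funext ω; simp
    calc eLpNorm (Y t) 2 P
        = eLpNorm (riemannSum C W n t - fun ω => riemannSum C W n t ω - Y t ω) 2 P := by rw [← h4]
      _ ≤ eLpNorm (riemannSum C W n t) 2 P
          + eLpNorm (fun ω => riemannSum C W n t ω - Y t ω) 2 P :=
          eLpNorm_sub_le h1.1 (h1.1.sub hm) one_le_two
      _ ≤ _ := by rw [add_comm]; gcongr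
  have hb' : eLpNorm (Y t) 2 P ≤ ENNReal.ofReal (√((D * D * M ^ 2) * t)) := by
    have := hlim.add_const (ENNReal.ofReal (√((D * D * M ^ 2) * t)))
    rw [zero_add] at this
    exact ge_of_tendsto' this hb
  have hmem : MemLp (Y t) 2 P := ⟨hm, hb'.trans_lt ENNReal.ofReal_lt_top⟩
  refine ⟨hmem, ?_⟩
  rw [eLpNorm_two_eq hmem, ENNReal.ofReal_le_ofReal_iff (Real.sqrt_nonneg _)] at hb'
  exact (Real.sqrt_le_sqrt_iff (mul_nonneg (by positivity) ht.1)).1 hb'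

end Moments

/-! ### The equilibrium system as a semilinear system -/

section Equilibrium

variable {D I N : ℕ} {α δ₁ δ₂ : ℝ} {C : ℝ → Matrix (Fin D) (Fin D) ℝ}

lemma norm_sq_toLp {n : ℕ} (v : Fin n → ℝ) : ‖(WithLp.toLp 2 v : Vec n)‖ ^ 2 = v ⬝ᵥ v := by
  rw [EuclideanSpace.norm_sq_eq]
  simp [dotProduct, sq]

/-- The nonlinearity of the equilibrium system, as a function of the volatility matrix and the
gradients. -/
def equilibriumField (hND : N ≤ D) (a : Fin I → ℝ)
    (z : (Fin D → Fin D → ℝ) × (Fin I → Fin D → ℝ)) (i : Fin I) : ℝ :=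
  let B := (firstCols hND (Matrix.of z.1))ᵀ
  let l := (riskTolerance a)⁻¹ • (B *ᵥ ∑ j, z.2 j)
  1 / (2 * a i) * (l ⬝ᵥ l) - l ⬝ᵥ (B *ᵥ z.2 i)
    + a i / 2 * ((B *ᵥ z.2 i) ⬝ᵥ (B *ᵥ z.2 i)
      - ((Matrix.of z.1)ᵀ *ᵥ z.2 i) ⬝ᵥ ((Matrix.of z.1)ᵀ *ᵥ z.2 i))

lemma contDiff_equilibriumField (hND : N ≤ D) (a : Fin I → ℝ) :
    ContDiff ℝ 1 (equilibriumField (I := I) hND a) := by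
  refine contDiff_pi.2 fun i => ?_
  simp only [equilibriumField, firstCols, Pi.smul_apply, Matrix.mulVec, dotProduct,
    Matrix.transpose_apply, Matrix.submatrix_apply, Finset.sum_apply, Matrix.of_apply, smul_eq_mul]
  fun_prop

/-- The nonlinearity of the equilibrium system, with truncated time variable. -/
def equilibriumNonlinearity (hND : N ≤ D) (a : Fin I → ℝ) (C : ℝ → Matrix (Fin D) (Fin D) ℝ)
    (t : ℝ) (p : Fin I → Fin D → ℝ) (i : Fin I) : ℝ :=
  equilibriumField hND a (fun d e => C (clamp 1 t) d e, p) i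

/-- The nonlinearity is polynomial in the entries of the volatility and the gradients, hence
Lipschitz on balls; its time dependence enters only through the Hölder function `C`. -/
lemma isLocallyLipschitz_equilibriumNonlinearity (hND : N ≤ D) (a : Fin I → ℝ) (hα : 0 < α)
    (hC : ∃ K : ℝ, ∀ s ∈ Icc (0 : ℝ) 1, ∀ t ∈ Icc (0 : ℝ) 1, ∀ d e,
      |C t d e - C s d e| ≤ K * |t - s| ^ α) :
    IsLocallyLipschitz α (equilibriumNonlinearity (I := I) hND a C) := by
  intro R
  obtain ⟨M, hM, hCM⟩ := exists_bound_clamp hα hC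
  obtain ⟨Kc, hKc, hCh⟩ := isTimeHolder_clamp hα hC
  obtain ⟨K, hK, hK1, hK2⟩ := exists_bound_of_contDiff (contDiff_equilibriumField (I := I) hND a)
    (max M R)
  have hball : ∀ t (p : Fin I → Fin D → ℝ), ‖p‖ ≤ R →
      ‖((fun d e => C (clamp 1 t) d e, p) : (Fin D → Fin D → ℝ) × (Fin I → Fin D → ℝ))‖
        ≤ max M R := fun t p hp => by
    rw [Prod.norm_mk]
    exact max_le_max (norm_pi_pi_le hM fun d e => hCM t d e) hp
  refine ⟨K * (Kc + 1), by positivity, fun t p i hp => ?_, fun t s p q i hp hq => ?_⟩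
  · refine ((norm_le_pi_norm _ i).trans (hK1 _ (hball t p hp))).trans ?_
    exact le_mul_of_one_le_right hK (by linarith)
  · have h1 := (norm_le_pi_norm _ i).trans (hK2 _ _ (hball t p hp) (hball s q hq))
    refine h1.trans ?_
    rw [mul_assoc, Prod.mk_sub_mk, Prod.norm_mk]
    refine mul_le_mul_of_nonneg_left ?_ hK
    have h2 : 0 ≤ |t - s| ^ α := by positivity
    have h3 := norm_nonneg (p - q)
    refine max_le ((norm_pi_pi_le (r := Kc * |t - s| ^ α) (by positivity)
      fun d e => hCh d e t s).trans ?_) ?_ <;> nlinarith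

/-- The instantaneous covariance `C Cᵀ`, with truncated time variable. -/
def covRate (C : ℝ → Matrix (Fin D) (Fin D) ℝ) (t : ℝ) : Matrix (Fin D) (Fin D) ℝ :=
  C (clamp 1 t) * (C (clamp 1 t))ᵀ

lemma isTimeHolder_covRate (hα : 0 < α)
    (hC : ∃ K : ℝ, ∀ s ∈ Icc (0 : ℝ) 1, ∀ t ∈ Icc (0 : ℝ) 1, ∀ d e,
      |C t d e - C s d e| ≤ K * |t - s| ^ α) : IsTimeHolder α (covRate C) := by
  obtain ⟨M, hM, hCM⟩ := exists_bound_clamp hα hC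
  obtain ⟨Kc, hKc, hCh⟩ := isTimeHolder_clamp hα hC
  refine ⟨D * (2 * M * Kc), by positivity, fun d e t s => ?_⟩
  simp only [covRate, Matrix.mul_apply, Matrix.transpose_apply]
  rw [← Finset.sum_sub_distrib]
  refine (Finset.abs_sum_le_sum_abs _ _).trans ((Finset.sum_le_card_nsmul _ _
    (2 * M * Kc * |t - s| ^ α) fun k _ => ?_).trans (le_of_eq (by simp; ring)))
  rw [show C (clamp 1 t) d k * C (clamp 1 t) e k - C (clamp 1 s) d k * C (clamp 1 s) e k
    = C (clamp 1 t) d k * (C (clamp 1 t) e k - C (clamp 1 s) e k)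
      + (C (clamp 1 t) d k - C (clamp 1 s) d k) * C (clamp 1 s) e k by ring]
  refine (abs_add_le _ _).trans ?_
  rw [abs_mul, abs_mul]
  have h1 := mul_le_mul (hCM t d k) (hCh e k t s) (abs_nonneg _) hM
  have h2 := mul_le_mul (hCh d k t s) (hCM s e k) (abs_nonneg _) (by positivity)
  linarith

lemma isElliptic_covRate (hα : 0 < α) (hδ₁ : 0 < δ₁) (hδ : δ₁ < δ₂)
    (hC : ∃ K : ℝ, ∀ s ∈ Icc (0 : ℝ) 1, ∀ t ∈ Icc (0 : ℝ) 1, ∀ d e,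
      |C t d e - C s d e| ≤ K * |t - s| ^ α)
    (hCell : ∀ t ∈ Icc (0 : ℝ) 1, ∀ y : Vec D,
      δ₁ * ‖y‖ ^ 2 ≤ y.ofLp ⬝ᵥ ((C t * (C t)ᵀ) *ᵥ y.ofLp) ∧
        y.ofLp ⬝ᵥ ((C t * (C t)ᵀ) *ᵥ y.ofLp) ≤ δ₂ * ‖y‖ ^ 2) :
    IsElliptic δ₁ δ₂ (covRate C) where
  pos := hδ₁
  pos' := hδ₁.trans hδ
  symm t := by simp [Matrix.IsSymm, covRate, Matrix.transpose_mul]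
  lower t y := (hCell _ (clamp_mem zero_le_one t) y).1
  upper t y := (hCell _ (clamp_mem zero_le_one t) y).2
  continuous d e :=
    ((isTimeHolder_covRate hα hC).continuous hα).matrix_elem d e

/-- The two systems agree term by term: truncation of time is the identity on `[0,T]` because `T ≤
1`, and symmetry of `C Cᵀ` turns the trace into an entrywise sum. -/
lemma isEquilibriumSystem_iff {hND : N ≤ D} {a : Fin I → ℝ} {g : Fin I → Vec D → ℝ} {T : ℝ}
    (hT : T ≤ 1) {u : Fin I → ℝ → Vec D → ℝ} :
    IsEquilibriumSystem hND a C g α T u ↔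
      IsSemilinearSol (covRate C) (equilibriumNonlinearity hND a C) g α T u := by
  have key : ∀ i, ∀ t ∈ Icc 0 T, ∀ y,
      timeDeriv T (u i) t y
        + 1 / (2 * a i) * ‖marketPrice hND a C u t y‖ ^ 2
        - (marketPrice hND a C u t y).ofLp ⬝ᵥ ((firstCols hND (C t))ᵀ *ᵥ grad (u i t) y)
        + a i / 2 *
          (‖WithLp.toLp 2 ((firstCols hND (C t))ᵀ *ᵥ grad (u i t) y)‖ ^ 2
            - ‖WithLp.toLp 2 ((C t)ᵀ *ᵥ grad (u i t) y)‖ ^ 2)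
        + 1 / 2 * (hess (u i t) y * (C t * (C t)ᵀ)).trace
      = timeDeriv T (u i) t y + halfTrace (covRate C t) (hess (u i t) y)
        + equilibriumNonlinearity hND a C t (fun j => grad (u j t) y) i := by
    intro i t ht y
    have e0 : clamp 1 t = t := clamp_of_mem ⟨ht.1, ht.2.trans hT⟩
    have e1 : 1 / 2 * (hess (u i t) y * (C t * (C t)ᵀ)).trace
        = halfTrace (covRate C t) (hess (u i t) y) := by
      rw [halfTrace, covRate, e0]
      simp only [Matrix.trace, Matrix.diag_apply]
      congr 1
      refine Finset.sum_congr rfl fun d _ => ?_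
      rw [Matrix.mul_apply]
      refine Finset.sum_congr rfl fun e _ => ?_
      rw [mul_comm, Matrix.mul_apply, Matrix.mul_apply]
      congr 1
      exact Finset.sum_congr rfl fun k _ => mul_comm _ _
    rw [e1]
    simp only [marketPrice, equilibriumNonlinearity, equilibriumField, norm_sq_toLp, e0]
    have e2 : Matrix.of (fun d e => C t d e) = C t := rfl
    rw [e2]
    ring
  constructor
  · intro h
    exact ⟨h.regular, fun i t ht y => (key i t ht y).symm.trans (h.pde i t ht y), h.terminal⟩
  · intro h
    exact ⟨h.regular, fun i t ht y => (key i t ht y).trans (h.pde i t ht y), h.terminal⟩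

end Equilibrium

/-! ### Comparison of the market prices of risk -/

section Comparison

variable {D I N : ℕ} {α δ₁ δ₂ : ℝ} {Q : ℝ → Matrix (Fin D) (Fin D) ℝ}

/-- With `x = r² / T` this is `x^((1+α)/2) ≤ 1 + x`. It replaces a fractional power by a quadratic
one at the scale of the problem, so that only second moments are needed later. -/
lemma rpow_one_add_le {T r : ℝ} (hα : α ∈ Ioo (0 : ℝ) 1) (hT : 0 < T) (hr : 0 ≤ r) :
    r ^ (1 + α) ≤ T ^ ((1 + α) / 2) * (1 + r ^ 2 / T) := by
  have hp : 0 < 1 + α := by linarith [hα.1]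
  have h1 : r ^ (1 + α) = (r ^ 2) ^ ((1 + α) / 2) := by
    rw [← Real.rpow_natCast, ← Real.rpow_mul hr]
    congr 1
    push_cast
    ring
  have h2 : r ^ 2 = T * (r ^ 2 / T) := by field_simp
  rw [h1]
  nth_rw 1 [h2]
  have h3 : 0 ≤ r ^ 2 / T := by positivity
  rw [Real.mul_rpow hT.le h3]
  refine mul_le_mul_of_nonneg_left ?_ (by positivity)
  rcases le_total (r ^ 2 / T) 1 with h | h
  · exact (Real.rpow_le_one h3 h (by positivity)).trans (by linarith)
  · calc (r ^ 2 / T) ^ ((1 + α) / 2) ≤ (r ^ 2 / T) ^ (1 : ℝ) :=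
          Real.rpow_le_rpow_of_exponent_le h (by linarith [hα.2])
      _ ≤ 1 + r ^ 2 / T := by rw [Real.rpow_one]; linarith

/-- First order expansion at the origin of the evolution of a `C^{1+α}` function. -/
lemma abs_evol_sub_affine_le (hQ : IsElliptic δ₁ δ₂ Q) (hα : α ∈ Ioo (0 : ℝ) 1)
    {f : Vec D → ℝ} (hf : Differentiable ℝ f) {M : ℝ} (hM : ∀ y, |f y| ≤ M) {B : ℝ} (hB : 0 ≤ B)
    (h : ∀ d x y, |partialDeriv d f x - partialDeriv d f y| ≤ B * ‖x - y‖ ^ α)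
    {t T : ℝ} (ht : t ∈ Icc 0 T) (hT : 0 < T) (y : Vec D) :
    |evol Q t T f y - (f 0 + ∑ d, y d * partialDeriv d f 0)|
      ≤ D * B * (2 + 2 * momentConst D δ₂ 2) * (T ^ ((1 + α) / 2) * (1 + ‖y‖ ^ 2 / T)) := by
  set ν := multivariateGaussian (0 : Vec D) (cov Q t T) with hν
  have hm := momentConst_nonneg (D := D) hQ.pos'.le 2
  have hi1 := integrable_shift (ν := ν) hf.continuous.measurable hM y
  have hi2 : Integrable (fun x : Vec D => f 0 + ∑ d, (y + x) d * partialDeriv d f 0) ν := by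
    refine (integrable_const _).add (integrable_finsetSum _ fun d _ => Integrable.mul_const ?_ _)
    simp only [PiLp.add_apply]
    exact (integrable_const _).add (integrable_coord_gaussian ν d)
  -- Affine functions are invariant under centred averaging, so the Taylor polynomial may be moved
  -- inside the integral.
  have e1 : f 0 + ∑ d, y d * partialDeriv d f 0
      = ∫ x, (f 0 + ∑ d, (y + x) d * partialDeriv d f 0) ∂ν := by
    rw [integral_add (integrable_const _) (integrable_finsetSum _ fun d _ =>
      Integrable.mul_const (by
        simp only [PiLp.add_apply]
        exact (integrable_const _).add (integrable_coord_gaussian ν d)) _),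
      integral_finsetSum _ fun d _ => Integrable.mul_const (by
        simp only [PiLp.add_apply]
        exact (integrable_const _).add (integrable_coord_gaussian ν d)) _]
    simp only [PiLp.add_apply, integral_mul_const]
    congr 1
    · simp
    · refine Finset.sum_congr rfl fun d _ => ?_
      rw [integral_add (integrable_const _) (integrable_coord_gaussian ν d),
        integral_coord_multivariateGaussian]
      simp
  rw [evol, e1, ← integral_sub hi1 hi2]
  have hx2 : Integrable (fun x : Vec D => ‖x‖ ^ 2) ν := by
    simpa using integrable_norm_rpow_gaussian ν (p := 2) (by norm_num)
  have hmom : ∫ x, ‖x‖ ^ 2 ∂ν ≤ momentConst D δ₂ 2 * T := by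
    have := integral_norm_rpow_cov_le hQ ht.2 (p := 2) (by norm_num)
    norm_num at this
    exact this.trans (mul_le_mul_of_nonneg_left (by linarith [ht.1]) hm)
  have hi3 : Integrable (fun x : Vec D => (2 * ‖y‖ ^ 2 + 2 * ‖x‖ ^ 2) / T) ν :=
    ((integrable_const _).add (hx2.const_mul 2)).div_const T
  have hdom : Integrable (fun x : Vec D => D * B * (T ^ ((1 + α) / 2)
      * (1 + (2 * ‖y‖ ^ 2 + 2 * ‖x‖ ^ 2) / T))) ν :=
    (((integrable_const _).add hi3).const_mul _).const_mul _
  have hpt : ∀ x : Vec D, ‖f (y + x) - (f 0 + ∑ d, (y + x) d * partialDeriv d f 0)‖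
      ≤ D * B * (T ^ ((1 + α) / 2) * (1 + (2 * ‖y‖ ^ 2 + 2 * ‖x‖ ^ 2) / T)) := fun x => by
    have h1 := taylor_one hf hα.1 hB h 0 (y + x)
    rw [zero_add, sub_sub] at h1
    refine h1.trans (mul_le_mul_of_nonneg_left ?_ (by positivity))
    refine (rpow_one_add_le hα hT (norm_nonneg _)).trans ?_
    have h2 : ‖y + x‖ ^ 2 ≤ 2 * ‖y‖ ^ 2 + 2 * ‖x‖ ^ 2 := by
      have := norm_add_le y x
      nlinarith [norm_nonneg (y + x), sq_nonneg (‖y‖ - ‖x‖)]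
    gcongr
  refine (norm_integral_le_of_norm_le hdom (Eventually.of_forall hpt)).trans ?_
  have e3 : ∫ x, D * B * (T ^ ((1 + α) / 2) * (1 + (2 * ‖y‖ ^ 2 + 2 * ‖x‖ ^ 2) / T)) ∂ν
      = D * B * (T ^ ((1 + α) / 2) * (1 + (2 * ‖y‖ ^ 2 + 2 * ∫ x, ‖x‖ ^ 2 ∂ν) / T)) := by
    rw [integral_const_mul, integral_const_mul,
      integral_add (integrable_const _) hi3,
      integral_div, integral_add (integrable_const _) (hx2.const_mul 2)]
    simp [integral_const_mul]
  rw [e3]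
  have h4 : (2 * ‖y‖ ^ 2 + 2 * ∫ x, ‖x‖ ^ 2 ∂ν) / T ≤ 2 * (‖y‖ ^ 2 / T) + 2 * momentConst D δ₂ 2 := by
    rw [add_div]
    refine add_le_add (le_of_eq (by ring)) ?_
    rw [div_le_iff₀ hT]
    linarith
  have h5 : 0 ≤ ‖y‖ ^ 2 / T := by positivity
  have h6 : 1 + (2 * ‖y‖ ^ 2 + 2 * ∫ x, ‖x‖ ^ 2 ∂ν) / T
      ≤ (2 + 2 * momentConst D δ₂ 2) * (1 + ‖y‖ ^ 2 / T) := by nlinarith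
  calc D * B * (T ^ ((1 + α) / 2) * (1 + (2 * ‖y‖ ^ 2 + 2 * ∫ x, ‖x‖ ^ 2 ∂ν) / T))
      ≤ D * B * (T ^ ((1 + α) / 2) * ((2 + 2 * momentConst D δ₂ 2) * (1 + ‖y‖ ^ 2 / T))) := by
        gcongr
    _ = _ := by ring

lemma norm_le_of_abs_coord_le {n : ℕ} (v : Vec n) {m : ℝ} (h : ∀ i, |v i| ≤ m) :
    ‖v‖ ≤ n * m := by
  conv_lhs => rw [vec_eq_sum v]
  refine (norm_sum_le _ _).trans ((Finset.sum_le_card_nsmul _ _ m fun i _ => ?_).trans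
    (le_of_eq (by simp)))
  rw [norm_smul, PiLp.norm_single, norm_one, mul_one]
  exact h i

lemma norm_firstCols_mulVec_le (hND : N ≤ D) {A : Matrix (Fin D) (Fin D) ℝ} {M m c : ℝ}
    (hM : 0 ≤ M) (hA : ∀ d e, |A d e| ≤ M) {w : Fin D → ℝ} (hw : ∀ d, |w d| ≤ m) :
    ‖(WithLp.toLp 2 (c • ((firstCols hND A)ᵀ *ᵥ w)) : Vec N)‖ ≤ N * |c| * D * M * m := by
  refine (norm_le_of_abs_coord_le _ (m := |c| * (D * (M * m))) fun n => ?_).trans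
    (le_of_eq (by ring))
  simp only [Pi.smul_apply, smul_eq_mul, abs_mul]
  refine mul_le_mul_of_nonneg_left ?_ (abs_nonneg c)
  rw [Matrix.mulVec, dotProduct]
  refine (Finset.abs_sum_le_sum_abs _ _).trans ((Finset.sum_le_card_nsmul _ _ (M * m)
    fun d _ => ?_).trans (le_of_eq (by simp)))
  rw [abs_mul]
  exact mul_le_mul (hA _ _) (hw d) (abs_nonneg _) hM

lemma marketPrice_sub_quadraticMarketPrice (hND : N ≤ D) (a : Fin I → ℝ)
    (C : ℝ → Matrix (Fin D) (Fin D) ℝ) (u : Fin I → ℝ → Vec D → ℝ) (T : ℝ)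
    (β : Fin I → ℝ → Fin D → ℝ) (γ : Fin I → ℝ → Matrix (Fin D) (Fin D) ℝ) (t : ℝ) (y : Vec D) :
    marketPrice hND a C u t y - quadraticMarketPrice hND a C T β γ t y
      = WithLp.toLp 2 ((riskTolerance a)⁻¹ • ((firstCols hND (C t))ᵀ *ᵥ
        ∑ j, (grad (u j t) y
          - (β j (T - t) + (γ j (T - t) + (γ j (T - t))ᵀ) *ᵥ y.ofLp)))) := by
  rw [marketPrice, quadraticMarketPrice, ← WithLp.toLp_sub, ← smul_sub, ← Matrix.mulVec_sub,
    ← Finset.sum_sub_distrib]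

/-- Deviation of an affine function from the first order expansion of a gradient. -/
lemma abs_affine_sub_le {T K : ℝ} (hT : 0 < T) (hT1 : T ≤ 1) (hα : α ∈ Ioo (0 : ℝ) 1)
    (hK : 0 ≤ K) {g : Vec D → ℝ} (hg : ContDiff ℝ 2 g) {b : Fin D → ℝ}
    {G : Matrix (Fin D) (Fin D) ℝ} (d : Fin D) (hb : |b d - grad g 0 d| ≤ K * T)
    (hG : ∀ d e, |G d e - 1 / 2 * hess g 0 d e| ≤ K * T) (y : Vec D) :
    |partialDeriv d g 0 + ∑ e, y e * partialDeriv e (partialDeriv d g) 0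
        - (b + (G + Gᵀ) *ᵥ y.ofLp) d|
      ≤ (1 + 2 * D) * K * (T ^ ((1 + α) / 2) * (1 + ‖y‖ ^ 2 / T)) := by
  have e1 : partialDeriv d g 0 + ∑ e, y e * partialDeriv e (partialDeriv d g) 0
        - (b + (G + Gᵀ) *ᵥ y.ofLp) d
      = -(b d - grad g 0 d) - ∑ e, ((G d e - 1 / 2 * hess g 0 d e)
        + (G e d - 1 / 2 * hess g 0 e d)) * y e := by
    -- Symmetry of the Hessian makes `½ ∂_{yy} g + (½ ∂_{yy} g)ᵀ` equal to `∂_{yy} g`, so `G + Gᵀ`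
    -- matches the linear Taylor coefficient.
    have : ∀ e, ((G d e - 1 / 2 * hess g 0 d e) + (G e d - 1 / 2 * hess g 0 e d)) * y e
        = (G d e + G e d) * y e - y e * partialDeriv e (partialDeriv d g) 0 := fun e => by
      simp only [hess, Matrix.of_apply]
      rw [partialDeriv_comm hg e d]
      ring
    simp only [this, Finset.sum_sub_distrib, Pi.add_apply, Matrix.mulVec, dotProduct,
      Matrix.add_apply, Matrix.transpose_apply, grad]
    ring
  have h1 : |∑ e, ((G d e - 1 / 2 * hess g 0 d e) + (G e d - 1 / 2 * hess g 0 e d)) * y e|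
      ≤ D * ((K * T + K * T) * ‖y‖) := by
    refine (Finset.abs_sum_le_sum_abs _ _).trans ((Finset.sum_le_card_nsmul _ _
      ((K * T + K * T) * ‖y‖) fun e _ => ?_).trans (le_of_eq (by simp)))
    rw [abs_mul]
    exact mul_le_mul ((abs_add_le _ _).trans (add_le_add (hG d e) (hG e d))) (abs_coord_le y e)
      (abs_nonneg _) (by positivity)
  have h2 : T ≤ T ^ ((1 + α) / 2) := by
    conv_lhs => rw [← Real.rpow_one T]
    exact Real.rpow_le_rpow_of_exponent_ge hT hT1 (by linarith [hα.2])
  have h3 : ‖y‖ ^ 2 ≤ ‖y‖ ^ 2 / T := by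
    rw [le_div_iff₀ hT]
    nlinarith [sq_nonneg ‖y‖]
  have h4 : ‖y‖ ≤ 1 + ‖y‖ ^ 2 / T := by nlinarith [sq_nonneg (‖y‖ - 1 / 2)]
  have h5 : 1 ≤ 1 + ‖y‖ ^ 2 / T := by linarith [sq_nonneg ‖y‖]
  rw [e1]
  refine (abs_sub _ _).trans ?_
  rw [abs_neg]
  calc |b d - grad g 0 d|
        + |∑ e, ((G d e - 1 / 2 * hess g 0 d e) + (G e d - 1 / 2 * hess g 0 e d)) * y e|
      ≤ K * (T * 1) + D * ((K * T + K * T) * ‖y‖) := by rw [mul_one]; exact add_le_add hb h1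
    _ = K * (T * 1) + 2 * D * K * (T * ‖y‖) := by ring
    _ ≤ K * (T ^ ((1 + α) / 2) * (1 + ‖y‖ ^ 2 / T))
        + 2 * D * K * (T ^ ((1 + α) / 2) * (1 + ‖y‖ ^ 2 / T)) := by gcongr
    _ = _ := by ring

/-- Integrated version of a pointwise bound that grows quadratically. -/
lemma integrable_norm_comp_and_integral_le {Ω : Type*} [MeasurableSpace Ω] {P : Measure Ω}
    [IsProbabilityMeasure P] {h : Vec D → Vec N} (hc : Continuous h) {T A c r : ℝ} (hT : 0 < T)
    (hA : 0 ≤ A) (hr : 0 ≤ r) (hbd : ∀ y, ‖h y‖ ≤ A * (r * (1 + ‖y‖ ^ 2 / T))) {X : Ω → Vec D}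
    (hX : MemLp X 2 P) (hXc : ∫ ω, ‖X ω‖ ^ 2 ∂P ≤ c * T) :
    Integrable (fun ω => ‖h (X ω)‖) P ∧ ∫ ω, ‖h (X ω)‖ ∂P ≤ A * (1 + c) * r := by
  have hi : Integrable (fun ω => A * (r * (1 + ‖X ω‖ ^ 2 / T))) P :=
    (((integrable_const _).add (hX.integrable_norm_pow (by norm_num) |>.div_const T)).const_mul
      r).const_mul A
  have hint : Integrable (fun ω => ‖h (X ω)‖) P :=
    hi.mono' (hc.comp_aestronglyMeasurable hX.1).norm (Eventually.of_forall fun ω => by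
      rw [norm_norm]; exact hbd (X ω))
  refine ⟨hint, (integral_mono hint hi fun ω => hbd (X ω)).trans ?_⟩
  have e : ∫ ω, A * (r * (1 + ‖X ω‖ ^ 2 / T)) ∂P = A * (r * (1 + (∫ ω, ‖X ω‖ ^ 2 ∂P) / T)) := by
    rw [integral_const_mul, integral_const_mul, integral_add (integrable_const _)
      (hX.integrable_norm_pow (by norm_num) |>.div_const T), integral_div]
    simp
  rw [e]
  have h1 : (∫ ω, ‖X ω‖ ^ 2 ∂P) / T ≤ c := by rwa [div_le_iff₀ hT]
  calc A * (r * (1 + (∫ ω, ‖X ω‖ ^ 2 ∂P) / T)) ≤ A * (r * (1 + c)) := by gcongr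
    _ = _ := by ring

end Comparison

/-! ### Pointwise comparison of the prices at short maturity -/

section Main

variable {D I N : ℕ} {α δ₁ δ₂ : ℝ} {C : ℝ → Matrix (Fin D) (Fin D) ℝ} {g : Fin I → Vec D → ℝ}

/-- Pointwise comparison of the two market prices of risk for a short maturity. -/
lemma exists_norm_marketPrice_sub_le (hND : N ≤ D) (a : Fin I → ℝ) (hα : α ∈ Ioo (0 : ℝ) 1)
    (hQ : IsElliptic δ₁ δ₂ (covRate C)) (hg : ∀ i, MemHolderTwo α (g i)) {M : ℝ} (hM : 0 ≤ M)
    (hCM : ∀ t ∈ Icc (0 : ℝ) 1, ∀ d e, |C t d e| ≤ M) {K₁ K₂ : ℝ} (hK₁ : 0 ≤ K₁) (hK₂ : 0 ≤ K₂) :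
    ∃ A : ℝ, 0 ≤ A ∧ ∀ T ∈ Ioc (0 : ℝ) 1, ∀ t ∈ Icc 0 T, ∀ (u : Fin I → ℝ → Vec D → ℝ)
      (β : Fin I → ℝ → Fin D → ℝ) (γ : Fin I → ℝ → Matrix (Fin D) (Fin D) ℝ),
      (∀ i d y, |partialDeriv d (u i t) y - evol (covRate C) t T (partialDeriv d (g i)) y|
        ≤ K₁ * (T - t)) →
      (∀ i d, |β i (T - t) d - grad (g i) 0 d| ≤ K₂ * (T - t) ∧
        ∀ e, |γ i (T - t) d e - 1 / 2 * hess (g i) 0 d e| ≤ K₂ * (T - t)) →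
      ∀ y, ‖marketPrice hND a C u t y - quadraticMarketPrice hND a C T β γ t y‖
        ≤ A * (T ^ ((1 + α) / 2) * (1 + ‖y‖ ^ 2 / T)) := by
  choose b hb hb1 hb2 hb3 hb4 using fun i => (hg i).exists_bound
  have hm := momentConst_nonneg (D := D) hQ.pos'.le 2
  -- The three summands are the constants of the nonlinear correction, of the averaged Taylor
  -- remainder and of the Riccati deviation.
  set k : Fin I → ℝ := fun i =>
    K₁ + D * b i * (2 + 2 * momentConst D δ₂ 2) + (1 + 2 * D) * K₂ with hk
  have hk0 : ∀ i, 0 ≤ k i := fun i => by have := hb i; positivity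
  refine ⟨N * |(riskTolerance a)⁻¹| * D * M * ∑ i, k i, mul_nonneg (by positivity)
    (Finset.sum_nonneg fun i _ => hk0 i), fun T hT t ht u β γ hu hβγ y => ?_⟩
  have hT0 : 0 < T := hT.1
  set r := T ^ ((1 + α) / 2) * (1 + ‖y‖ ^ 2 / T) with hr
  have hTr : T ≤ r := by
    have h1 : T ≤ T ^ ((1 + α) / 2) := by
      conv_lhs => rw [← Real.rpow_one T]
      exact Real.rpow_le_rpow_of_exponent_ge hT.1 hT.2 (by linarith [hα.2])
    have h2 : 0 ≤ ‖y‖ ^ 2 / T := by positivity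
    exact h1.trans (le_mul_of_one_le_right (by positivity) (by linarith))
  have hr0 : 0 ≤ r := hT0.le.trans hTr
  rw [marketPrice_sub_quadraticMarketPrice, mul_assoc]
  refine norm_firstCols_mulVec_le hND hM (hCM t ⟨ht.1, ht.2.trans hT.2⟩) fun d => ?_
  rw [Finset.sum_apply, Finset.sum_mul]
  refine (Finset.abs_sum_le_sum_abs _ _).trans (Finset.sum_le_sum fun i _ => ?_)
  have hs : T - t ≤ T := by linarith [ht.1]
  have h1 := (hu i d y).trans (mul_le_mul_of_nonneg_left (hs.trans hTr) hK₁)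
  have h2 := abs_evol_sub_affine_le hQ hα ((hg i).differentiable_one d) (hb2 i d) (hb i)
    (hb4 i d) ht hT0 y
  have h3 := abs_affine_sub_le hT0 hT.2 hα hK₂ (hg i).contDiff d
    ((hβγ i d).1.trans (mul_le_mul_of_nonneg_left hs hK₂))
    (fun d e => ((hβγ i d).2 e).trans (mul_le_mul_of_nonneg_left hs hK₂)) y
  rw [← hr] at h2 h3
  rw [Pi.sub_apply, hk]
  simp only [grad]
  calc _ ≤ |partialDeriv d (u i t) y - evol (covRate C) t T (partialDeriv d (g i)) y|
        + |evol (covRate C) t T (partialDeriv d (g i)) y - (partialDeriv d (g i) 0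
          + ∑ e, y e * partialDeriv e (partialDeriv d (g i)) 0)|
        + |partialDeriv d (g i) 0 + ∑ e, y e * partialDeriv e (partialDeriv d (g i)) 0
          - (β i (T - t) + (γ i (T - t) + (γ i (T - t))ᵀ) *ᵥ y.ofLp) d| := by
        refine (abs_sub_le _ (partialDeriv d (g i) 0
          + ∑ e, y e * partialDeriv e (partialDeriv d (g i)) 0) _).trans ?_
        gcongr
        exact abs_sub_le _ _ _
    _ ≤ K₁ * r + D * b i * (2 + 2 * momentConst D δ₂ 2) * r + (1 + 2 * D) * K₂ * r :=
        add_le_add (add_le_add h1 h2) h3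
    _ = _ := by ring

lemma continuous_marketPrice {hND : N ≤ D} {a : Fin I → ℝ} {t : ℝ} {u : Fin I → ℝ → Vec D → ℝ}
    (hu : ∀ i, ContDiff ℝ 2 (u i t)) : Continuous (marketPrice hND a C u t) := by
  have h : ∀ j, Continuous fun y => grad (u j t) y := fun j =>
    continuous_pi fun d => (contDiff_partialDeriv (hu j) d).continuous
  unfold marketPrice
  fun_prop

lemma continuous_quadraticMarketPrice {hND : N ≤ D} {a : Fin I → ℝ} {t T : ℝ}
    {β : Fin I → ℝ → Fin D → ℝ} {γ : Fin I → ℝ → Matrix (Fin D) (Fin D) ℝ} :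
    Continuous (quadraticMarketPrice hND a C T β γ t) := by
  unfold quadraticMarketPrice
  fun_prop

end Main

end RadnerTaylor

end

/-! ### Conclusion of the argument -/

theorem theorem4p2 {D N I : ℕ} (hN : 1 ≤ N) (hND : N ≤ D) (hI : 1 ≤ I)
    (a : Fin I → ℝ) (ha : ∀ i, 0 < a i)
    (α : ℝ) (hα : α ∈ Ioo (0 : ℝ) 1)
    (δ₁ δ₂ : ℝ) (hδ₁ : 0 < δ₁) (hδ : δ₁ < δ₂)
    (C : ℝ → Matrix (Fin D) (Fin D) ℝ)
    (hC : ∃ K : ℝ, ∀ s ∈ Icc (0 : ℝ) 1, ∀ t ∈ Icc (0 : ℝ) 1, ∀ d e,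
      |C t d e - C s d e| ≤ K * |t - s| ^ α)
    (hCell : ∀ t ∈ Icc (0 : ℝ) 1, ∀ y : Vec D,
      δ₁ * ‖y‖ ^ 2 ≤ y.ofLp ⬝ᵥ ((C t * (C t)ᵀ) *ᵥ y.ofLp) ∧
        y.ofLp ⬝ᵥ ((C t * (C t)ᵀ) *ᵥ y.ofLp) ≤ δ₂ * ‖y‖ ^ 2)
    (g : Fin I → Vec D → ℝ) (hg : ∀ i, MemHolderTwo α (g i))
    {Ω : Type*} [MeasurableSpace Ω] (P : Measure Ω) [IsProbabilityMeasure P]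
    (W : Fin D → ℝ → Ω → ℝ) (hW : IsBrownianVector W P)
    (Y : ℝ → Ω → Vec D) (hY : IsWienerIntegral C W Y P) :
    ∃ T₀ ∈ Ioc (0 : ℝ) 1,
      (∀ T ∈ Ioo 0 T₀,
        (∃ u, IsEquilibriumSystem hND a C g α T u) ∧
        ∀ u v, IsEquilibriumSystem hND a C g α T u → IsEquilibriumSystem hND a C g α T v →
          ∀ i, ∀ t ∈ Icc 0 T, ∀ y, u i t y = v i t y) ∧
      0 < riccatiMaturity hND a C (fun i => grad (g i) 0) (fun i => hess (g i) 0) ∧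
      ∀ T₁ : ℝ,
        (T₁ : EReal) < riccatiMaturity hND a C (fun i => grad (g i) 0) (fun i => hess (g i) 0) →
        ∃ K : ℝ, ∀ T ∈ Ioo 0 T₀, T ≤ T₁ →
          ∀ u, IsEquilibriumSystem hND a C g α T u →
          ∀ β γ, IsRiccatiSolution hND a C (fun i => grad (g i) 0) (fun i => hess (g i) 0) T β γ →
          ∀ t ∈ Icc 0 T,
            Integrable (fun ω =>
              ‖marketPrice hND a C u t (Y t ω) - quadraticMarketPrice hND a C T β γ t (Y t ω)‖) P ∧
            ∫ ω, ‖marketPrice hND a C u t (Y t ω)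
                - quadraticMarketPrice hND a C T β γ t (Y t ω)‖ ∂P
              ≤ K * T ^ ((1 + α) / 2) := by
  have hα0 := hα.1
  have hQ := isElliptic_covRate hα0 hδ₁ hδ hC hCell
  have hQα := isTimeHolder_covRate hα0 hC
  have hF := isLocallyLipschitz_equilibriumNonlinearity (I := I) hND a hα0 hC
  obtain ⟨M, hM, hCM⟩ := exists_bound_clamp hα0 hC
  have hCM' : ∀ t ∈ Icc (0 : ℝ) 1, ∀ d e, |C t d e| ≤ M := fun t ht d e => by
    have := hCM t d e
    rwa [clamp_of_mem ht] at this
  obtain ⟨T₁, hT₁, K₁, hK₁, H₁⟩ := exists_isSemilinearSol hQ hQα hα hF hg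
  obtain ⟨T₂, hT₂, K₂, hK₂, H₂⟩ := exists_riccati_time hND a hα0 hC
    (fun i => grad (g i) 0) (fun i => hess (g i) 0)
  obtain ⟨A, hA, H⟩ := exists_norm_marketPrice_sub_le hND a hα hQ hg hM hCM' hK₁ hK₂
  have hlt : ∀ T ∈ Ioo 0 (min T₁ T₂), T ∈ Ioo 0 T₁ ∧ T ∈ Icc 0 T₂ ∧ T ∈ Ioc (0 : ℝ) 1 :=
    fun T hT =>
      have h1 := hT.2.trans_le (min_le_left _ _)
      ⟨⟨hT.1, h1⟩, ⟨hT.1.le, (hT.2.trans_le (min_le_right _ _)).le⟩, hT.1, h1.le.trans hT₁.2⟩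
  have huniq : ∀ T ∈ Ioo 0 (min T₁ T₂), ∀ u v, IsEquilibriumSystem hND a C g α T u →
      IsEquilibriumSystem hND a C g α T v → ∀ i, ∀ t ∈ Icc 0 T, ∀ y, u i t y = v i t y :=
    fun T hT u v hu hv i t ht y => by
      obtain ⟨-, -, hT1⟩ := hlt T hT
      exact ((isEquilibriumSystem_iff hT1.2).1 hu).unique hQ hQα hα hF hg hT1.1.le hT1.2
        ((isEquilibriumSystem_iff hT1.2).1 hv) i ht y
  -- Below this minimum both the gradient estimate and the linear Riccati deviation hold with
  -- constants free of `T`. One constant then serves all maturity bounds: `1 + D * D * M ^ 2` comes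
  -- from the second moment of `Y_t`.
  refine ⟨min T₁ T₂, ⟨lt_min hT₁.1 hT₂.1, (min_le_left _ _).trans hT₁.2⟩,
    fun T hT => ⟨?_, huniq T hT⟩, riccatiMaturity_pos hND a hα0 hC _ _,
    fun _ _ => ⟨A * (1 + D * D * M ^ 2), fun T hT _ u hu β γ hβγ t ht => ?_⟩⟩
  · obtain ⟨hT1, -, hT'⟩ := hlt T hT
    obtain ⟨u, hu, -⟩ := H₁ T hT1
    exact ⟨u, (isEquilibriumSystem_iff hT'.2).2 hu⟩
  · obtain ⟨hT1, hT2, hT'⟩ := hlt T hT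
    obtain ⟨v, hv, hvb⟩ := H₁ T hT1
    -- The gradient estimate is known for the constructed solution `v`; uniqueness hands it to the
    -- given `u`.
    have huv := huniq T hT u v hu ((isEquilibriumSystem_iff hT'.2).2 hv)
    have hbd := H T hT' t ht u β γ (fun i d y => by
        rw [partialDeriv_congr (huv i t ht)]
        exact hvb i t ht d y)
      ((H₂ T hT2).2 β γ hβγ (T - t) ⟨by linarith [ht.2], by linarith [ht.1]⟩)
    obtain ⟨hY2, hY3⟩ := hY.integral_norm_sq_le hW hCM' (t := t) ⟨ht.1, ht.2.trans hT'.2⟩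
    exact integrable_norm_comp_and_integral_le
      ((continuous_marketPrice fun i => (hu.regular i).contDiff_space t ht).sub
        continuous_quadraticMarketPrice) hT'.1 hA (Real.rpow_nonneg hT'.1.le _) hbd hY2
      (hY3.trans (mul_le_mul_of_nonneg_left ht.2 (by positivity)))
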